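/- Let $0<a<\infty$, $I=(-a,a)$, let $q\in L^1(I)$ be complex valued, and let $L=\frac{d^2}{dx^2}-q$. Here $W^{k,1}(I)$ is the space of $f\in L^1(I)$ whose distributional derivatives up to order $k$ are in $L^1(I)$; point values of a function in $W^{1,1}(I)$ are those of its continuous representative. A weak solution of $u''-qu=h$ (with $h\in L^1(I)$) is a $u\in W^{1,1}(I)$ that satisfies the equation in the sense of distributions on $I$. A *standard $L$-base* is a sequence $\{\varphi_k\}_{k\ge 0}$ such that, in the sense of weak solutions, $L\varphi_0=L\varphi_1=0$ and $L\varphi_k=k(k-1)\varphi_{k-2}$ for $k\ge2$, and such that $\varphi_k(0)=\varphi_k'(0)=0$ for all $k\ge2$. A linear map $T$ with domain $D_T\subseteq L^1(I)$ is a *transmutation operator* on $\chi\subseteq W^{2,1}(I)$ if for every $u\in\chi$ we have $u,u''\in D_T$, $Tu\in W^{2,1}(I)$ and $LTu=T(u'')$; it is an *s-transmutation* if moreover $\{T[x^k]\}_{k\ge 0}$ is a standard $L$-base. Put $P_\pm u(x)=\frac{u(x)\pm u(-x)}2$, $Au(x)=\int_0^x u(s)\,ds$, and $W(f,g)=fg'-f'g$.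 Let $H$ be the unique continuous solution on $\{|u|+|v|\le a\}$ of $$H(u,v)=\tfrac12\int_0^u q(s)\,ds+\int_0^u\!\int_0^v q(\alpha+\beta)H(\alpha,\beta)\,d\beta\,d\alpha ,$$ put $K(x,t)=H\!\left(\tfrac{x+t}2,\tfrac{x-t}2\right)$, and $$\mathbf T u(x)=u(x)+\int_{-x}^{x}K(x,t)u(t)\,dt .$$ ($H$ exists and is unique, and $\mathbf T$ is a bounded bijection of $L^1(I)$ with bounded inverse $\mathbf T^{-1}$; this is part of the claim.) **Theorem.** Let $\{\varphi_k\}$ be a standard $L$-base. Then there is an s-transmutation $T_\varphi$ on $W^{3,1}(I)$, with domain $W^{1,1}(I)$ and values in $L^1(I)$, such that $T_\varphi[x^k]=\varphi_k$ for all $k\ge0$. The equality $$T_\varphi=\varphi_0(0)\,\mathbf T P_+ +\varphi_0'(0)\,\mathbf T A P_+ +\varphi_1(0)\,\mathbf T\tfrac{d}{dx}P_- +\varphi_1'(0)\,\mathbf T P_-$$ holds on $W^{1,1}(I)$, and $T_\varphi:W^{1,1}(I)\to L^1(I)$ is bounded. The Wronskian $W(\varphi_0,\varphi_1)$ is constant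 on $I$. If $W(\varphi_0,\varphi_1)\ne0$, then the operator $$M_\varphi=\frac1{W(\varphi_0,\varphi_1)}\left\{\varphi_1'(0)P_+\mathbf T^{-1}-\varphi_0'(0)AP_+\mathbf T^{-1}-\varphi_1(0)\tfrac{d}{dx}P_-\mathbf T^{-1}+\varphi_0(0)P_-\mathbf T^{-1}\right\}$$ satisfies $T_\varphi M_\varphi u=M_\varphi T_\varphi u=u$ for all $u\in W^{2,1}(I)$ (all the compositions being well defined there). If $\varphi_1(0)=0$, then $T_\varphi$ extends to a bounded operator on $L^1(I)$, given there by the formula above without its third term; and if in addition $\varphi_0(0)\ne0$ and $W(\varphi_0,\varphi_1)\neq 0$, then this operator on $L^1(I)$ is invertible with bounded inverse $M_\varphi$ (the formula without its third term, defined on all of $L^1(I)$). -/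

import Mathlib

open MeasureTheory Set
open scoped ContDiff

noncomputable section

namespace Transmutation

/-- The complex Banach space `L¹(I)`, `I = (-a, a)`. -/
abbrev L1 (a : ℝ) : Type := Lp ℂ 1 (volume.restrict (Ioo (-a) a))

/-- Test functions on `I = (-a, a)`: the complex valued functions in `C_c^∞(I)`. -/
def IsTest (a : ℝ) (ψ : ℝ → ℂ) : Prop :=
  ContDiff ℝ ∞ ψ ∧ HasCompactSupport ψ ∧ tsupport ψ ⊆ Ioo (-a) a

/-- `g` is the distributional derivative of `f` on `I`. -/
def IsWeakDeriv {a : ℝ} (f g : L1 a) : Prop :=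
  ∀ ψ : ℝ → ℂ, IsTest a ψ →
    ∫ x in Ioo (-a) a, f x * deriv ψ x = -∫ x in Ioo (-a) a, g x * ψ x

theorem integrable_mul_of_bounded {a : ℝ} (f : L1 a) {ψ : ℝ → ℂ} (hψ : Continuous ψ)
    (hc : HasCompactSupport ψ) :
    Integrable (fun x => f x * ψ x) (volume.restrict (Ioo (-a) a)) := by
  obtain ⟨C, hC⟩ := hc.exists_bound_of_continuous hψ
  exact (L1.integrable_coeFn f).mul_bdd hψ.aestronglyMeasurable (Filter.Eventually.of_forall hC)

theorem IsWeakDeriv.add {a : ℝ} {f g f' g' : L1 a} (h : IsWeakDeriv f f')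
    (k : IsWeakDeriv g g') : IsWeakDeriv (f + g) (f' + g') := by
  intro ψ hψ
  have hd : Continuous (deriv ψ) := hψ.1.continuous_deriv (by norm_num)
  have e1 : ∫ x in Ioo (-a) a, (f + g : L1 a) x * deriv ψ x
      = ∫ x in Ioo (-a) a, (f x * deriv ψ x + g x * deriv ψ x) := by
    refine integral_congr_ae ?_
    filter_upwards [Lp.coeFn_add f g] with x hx
    rw [hx, Pi.add_apply, add_mul]
  have e2 : ∫ x in Ioo (-a) a, (f' + g' : L1 a) x * ψ x
      = ∫ x in Ioo (-a) a, (f' x * ψ x + g' x * ψ x) := by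
    refine integral_congr_ae ?_
    filter_upwards [Lp.coeFn_add f' g'] with x hx
    rw [hx, Pi.add_apply, add_mul]
  rw [e1, e2, integral_add (integrable_mul_of_bounded f hd hψ.2.1.deriv)
    (integrable_mul_of_bounded g hd hψ.2.1.deriv),
    integral_add (integrable_mul_of_bounded f' hψ.1.continuous hψ.2.1)
    (integrable_mul_of_bounded g' hψ.1.continuous hψ.2.1), h ψ hψ, k ψ hψ]
  ring

theorem IsWeakDeriv.smul {a : ℝ} {f f' : L1 a} (c : ℂ) (h : IsWeakDeriv f f') :
    IsWeakDeriv (c • f) (c • f') := by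
  intro ψ hψ
  have e1 : ∫ x in Ioo (-a) a, (c • f : L1 a) x * deriv ψ x
      = ∫ x in Ioo (-a) a, c * (f x * deriv ψ x) := by
    refine integral_congr_ae ?_
    filter_upwards [Lp.coeFn_smul c f] with x hx
    rw [hx, Pi.smul_apply, smul_eq_mul, mul_assoc]
  have e2 : ∫ x in Ioo (-a) a, (c • f' : L1 a) x * ψ x
      = ∫ x in Ioo (-a) a, c * (f' x * ψ x) := by
    refine integral_congr_ae ?_
    filter_upwards [Lp.coeFn_smul c f'] with x hx
    rw [hx, Pi.smul_apply, smul_eq_mul, mul_assoc]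
  rw [e1, e2, integral_const_mul, integral_const_mul, h ψ hψ]
  ring

theorem IsWeakDeriv.zero {a : ℝ} : IsWeakDeriv (0 : L1 a) 0 := by
  have h : ∀ g : ℝ → ℂ, ∫ x in Ioo (-a) a, (0 : L1 a) x * g x = 0 := by
    intro g
    rw [← integral_zero ℝ ℂ (μ := volume.restrict (Ioo (-a) a))]
    refine integral_congr_ae ?_
    filter_upwards [Lp.coeFn_zero ℂ 1 (volume.restrict (Ioo (-a) a))] with x hx
    rw [hx, Pi.zero_apply, zero_mul]
  intro ψ _
  rw [h, h, neg_zero]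

/-- The Sobolev space `W^{k,1}(I)`: the functions in `L¹(I)` whose distributional derivatives
up to order `k` are in `L¹(I)`. -/
def sobolev (a : ℝ) : ℕ → Submodule ℂ (L1 a)
  | 0 => ⊤
  | k + 1 =>
    { carrier := {f | ∃ g ∈ sobolev a k, IsWeakDeriv f g}
      zero_mem' := ⟨0, zero_mem _, IsWeakDeriv.zero⟩
      add_mem' := by
        rintro f g ⟨f', hf', h⟩ ⟨g', hg', k⟩
        exact ⟨f' + g', add_mem hf' hg', h.add k⟩
      smul_mem' := by
        rintro c f ⟨f', hf', h⟩
        exact ⟨c • f', Submodule.smul_mem _ c hf', h.smul c⟩ }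

open Classical in
/-- The distributional derivative `f'` in `L¹(I)` of `f` in `W^{1,1}(I)`
(and `0` if `f` is not in `W^{1,1}(I)`). -/
def wderiv {a : ℝ} (f : L1 a) : L1 a :=
  if h : ∃ g : L1 a, IsWeakDeriv f g then h.choose else 0

open Classical in
/-- The continuous representative of `f`, when there is one
(as is the case for every `f` in `W^{1,1}(I)`). For `0 < a` its values on `[-a, a]` are determined
by `f`. It gives a meaning to the point values `f(x)`. -/
def crep {a : ℝ} (f : L1 a) : ℝ → ℂ :=
  if h : ∃ g : ℝ → ℂ, Continuous g ∧ f =ᵐ[volume.restrict (Ioo (-a) a)] g then h.choose else 0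

/-- `u` in `W^{1,1}(I)` is a weak solution of `u'' - q u = h` on `I`,
i.e. the equation holds in the sense of distributions. -/
def IsWeakSolution {a : ℝ} (q : ℝ → ℂ) (u h : L1 a) : Prop :=
  u ∈ sobolev a 1 ∧ ∀ ψ : ℝ → ℂ, IsTest a ψ →
    (∫ x in Ioo (-a) a, u x * deriv (deriv ψ) x) - ∫ x in Ioo (-a) a, q x * u x * ψ x
      = ∫ x in Ioo (-a) a, h x * ψ x

/-- Standard `L`-bases for `L = d²/dx² - q`. -/
structure IsStandardLBase {a : ℝ} (q : ℝ → ℂ) (φ : ℕ → L1 a) : Prop where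
  zero : IsWeakSolution q (φ 0) 0
  one : IsWeakSolution q (φ 1) 0
  add_two : ∀ k : ℕ, IsWeakSolution q (φ (k + 2)) ((((k : ℂ) + 2) * ((k : ℂ) + 1)) • φ k)
  value : ∀ k : ℕ, 2 ≤ k → crep (φ k) 0 = 0
  deriv_value : ∀ k : ℕ, 2 ≤ k → crep (wderiv (φ k)) 0 = 0

/-- The Wronskian `W(f, g) = f g' - f' g`. -/
def wronskian {a : ℝ} (f g : L1 a) (x : ℝ) : ℂ :=
  crep f x * crep (wderiv g) x - crep (wderiv f) x * crep g x

/-- The linear map `T`, with domain `T.domain ⊆ L¹(I)`, is a transmutation operator on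
`χ ⊆ W^{2,1}(I)` for `L = d²/dx² - q`: for every `u ∈ χ` both `u` and `u''` are in the domain
of `T`, `Tu` is in `W^{2,1}(I)`, and `(Tu)'' - q Tu = T(u'')`. -/
def IsTransmutation {a : ℝ} (q : ℝ → ℂ) (T : L1 a →ₗ.[ℂ] L1 a) (χ : Set (L1 a)) : Prop :=
  ∀ u ∈ χ, u ∈ sobolev a 2 ∧
    ∃ (hu : u ∈ T.domain) (hu2 : wderiv (wderiv u) ∈ T.domain),
      T ⟨u, hu⟩ ∈ sobolev a 2 ∧
      (fun x => wderiv (wderiv (T ⟨u, hu⟩)) x - q x * T ⟨u, hu⟩ x)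
        =ᵐ[volume.restrict (Ioo (-a) a)] T ⟨wderiv (wderiv u), hu2⟩

theorem integrable_of_continuous {a : ℝ} {f : ℝ → ℂ} (hf : Continuous f) :
    Integrable f (volume.restrict (Ioo (-a) a)) :=
  (hf.continuousOn.integrableOn_Icc (a := -a) (b := a)).mono_set Ioo_subset_Icc_self

/-- The power `x^k` as an element of `L¹(I)`. -/
def power (a : ℝ) (k : ℕ) : L1 a :=
  (memLp_one_iff_integrable.2
    (integrable_of_continuous (a := a) (f := fun x : ℝ => (x : ℂ) ^ k) (by fun_prop))).toLp _

/-- `T` maps the powers `x^k` to the functions `φ k`. -/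
def MapsPowers {a : ℝ} (T : L1 a →ₗ.[ℂ] L1 a) (φ : ℕ → L1 a) : Prop :=
  ∀ k : ℕ, ∃ h : power a k ∈ T.domain, T ⟨power a k, h⟩ = φ k

/-- Standard transmutation operators (s-transmutations) on `χ`. -/
def IsStandardTransmutation {a : ℝ} (q : ℝ → ℂ) (T : L1 a →ₗ.[ℂ] L1 a) (χ : Set (L1 a)) : Prop :=
  IsTransmutation q T χ ∧ ∃ φ : ℕ → L1 a, IsStandardLBase q φ ∧ MapsPowers T φ

theorem measurePreserving_neg (a : ℝ) :
    MeasurePreserving (fun x : ℝ => -x) (volume.restrict (Ioo (-a) a))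
      (volume.restrict (Ioo (-a) a)) := by
  have h := (Measure.measurePreserving_neg (volume : Measure ℝ)).restrict_preimage
    (measurableSet_Ioo (a := -a) (b := a))
  have e : (Neg.neg : ℝ → ℝ) ⁻¹' Ioo (-a) a = Ioo (-a) a := by
    ext x; simp only [mem_preimage, mem_Ioo]; constructor <;> rintro ⟨h1, h2⟩ <;>
      constructor <;> linarith
  rwa [e] at h

/-- The reflection `u(x) ↦ u(-x)` on `L¹(I)`. -/
def reflect (a : ℝ) : L1 a →ₗ[ℂ] L1 a :=
  Lp.compMeasurePreservingₗ ℂ (fun x : ℝ => -x) (measurePreserving_neg a)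

/-- `P₊ u(x) = (u(x) + u(-x)) / 2`. -/
def Pplus (a : ℝ) : L1 a →ₗ[ℂ] L1 a := (1 / 2 : ℂ) • (LinearMap.id + reflect a)

/-- `P₋ u(x) = (u(x) - u(-x)) / 2`. -/
def Pminus (a : ℝ) : L1 a →ₗ[ℂ] L1 a := (1 / 2 : ℂ) • (LinearMap.id - reflect a)

theorem integrable_primitive {a : ℝ} (u : L1 a) :
    Integrable (fun x : ℝ => ∫ s in (0 : ℝ)..x, u s) (volume.restrict (Ioo (-a) a)) := by
  rcases le_or_gt a 0 with h | h
  · have e : (volume : Measure ℝ).restrict (Ioo (-a) a) = 0 :=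
      Measure.restrict_eq_zero.2 (by rw [Ioo_eq_empty (by linarith)]; simp)
    simp only [e]
    exact integrable_zero_measure
  have hi : IntegrableOn (fun s => u s) (uIcc (-a) a) := by
    rw [uIcc_of_le (by linarith), integrableOn_Icc_iff_integrableOn_Ioo]
    exact L1.integrable_coeFn u
  have hc := intervalIntegral.continuousOn_primitive_interval' (a := 0)
    (intervalIntegrable_iff.2 (hi.mono_set uIoc_subset_uIcc))
    (by rw [uIcc_of_le (by linarith)]; constructor <;> linarith)
  rw [uIcc_of_le (by linarith)] at hc
  exact hc.integrableOn_Icc.mono_set Ioo_subset_Icc_self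

theorem primitive_congr {a x : ℝ} (hx : x ∈ Ioo (-a) a) {f g : ℝ → ℂ}
    (h : f =ᵐ[volume.restrict (Ioo (-a) a)] g) :
    ∫ s in (0 : ℝ)..x, f s = ∫ s in (0 : ℝ)..x, g s := by
  refine intervalIntegral.integral_congr_ae ?_
  filter_upwards [(ae_restrict_iff' measurableSet_Ioo).1 h] with s hs hm
  refine hs ?_
  obtain ⟨h1, h2⟩ := hx
  rcases mem_uIoc.1 hm with ⟨h3, h4⟩ | ⟨h3, h4⟩ <;> constructor <;> linarith

theorem intervalIntegrable_coeFn {a x : ℝ} (hx : x ∈ Ioo (-a) a) (u : L1 a) :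
    IntervalIntegrable (fun s => u s) volume 0 x := by
  refine intervalIntegrable_iff.2 (IntegrableOn.mono_set (L1.integrable_coeFn u) ?_)
  intro s hm
  obtain ⟨h1, h2⟩ := hx
  rcases mem_uIoc.1 hm with ⟨h3, h4⟩ | ⟨h3, h4⟩ <;> constructor <;> linarith

/-- `A u(x) = ∫₀ˣ u(s) ds`. -/
def primitive (a : ℝ) : L1 a →ₗ[ℂ] L1 a where
  toFun u := (memLp_one_iff_integrable.2 (integrable_primitive u)).toLp _
  map_add' u v := by
    refine Lp.ext ?_
    filter_upwards [MemLp.coeFn_toLp (memLp_one_iff_integrable.2 (integrable_primitive (u + v))),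
      MemLp.coeFn_toLp (memLp_one_iff_integrable.2 (integrable_primitive u)),
      MemLp.coeFn_toLp (memLp_one_iff_integrable.2 (integrable_primitive v)),
      Lp.coeFn_add ((memLp_one_iff_integrable.2 (integrable_primitive u)).toLp _)
        ((memLp_one_iff_integrable.2 (integrable_primitive v)).toLp _),
      ae_restrict_mem measurableSet_Ioo] with x h1 h2 h3 h4 hx
    rw [h1, h4, Pi.add_apply, h2, h3, primitive_congr hx (Lp.coeFn_add u v)]
    exact intervalIntegral.integral_add (intervalIntegrable_coeFn hx u)
      (intervalIntegrable_coeFn hx v)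
  map_smul' c u := by
    refine Lp.ext ?_
    filter_upwards [MemLp.coeFn_toLp (memLp_one_iff_integrable.2 (integrable_primitive (c • u))),
      MemLp.coeFn_toLp (memLp_one_iff_integrable.2 (integrable_primitive u)),
      Lp.coeFn_smul c ((memLp_one_iff_integrable.2 (integrable_primitive u)).toLp _),
      ae_restrict_mem measurableSet_Ioo] with x h1 h2 h3 hx
    rw [h1, RingHom.id_apply, h3, Pi.smul_apply, h2, primitive_congr hx (Lp.coeFn_smul c u)]
    exact intervalIntegral.integral_smul c _

/-- `H` is a continuous solution, on the square `|u| + |v| ≤ a`, of the integral equation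
`H(u,v) = ½ ∫₀ᵘ q(s) ds + ∫₀ᵘ ∫₀ᵛ q(α+β) H(α,β) dβ dα`. -/
def IsGoursatSolution (a : ℝ) (q : ℝ → ℂ) (H : ℝ → ℝ → ℂ) : Prop :=
  ContinuousOn (fun p : ℝ × ℝ => H p.1 p.2) {p | |p.1| + |p.2| ≤ a} ∧
  ∀ u v : ℝ, |u| + |v| ≤ a →
    H u v = (1 / 2) * (∫ s in (0 : ℝ)..u, q s)
      + ∫ α in (0 : ℝ)..u, ∫ β in (0 : ℝ)..v, q (α + β) * H α β

/-- The kernel `K(x,t) = H((x+t)/2, (x-t)/2)`. -/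
def kernel (H : ℝ → ℝ → ℂ) (x t : ℝ) : ℂ := H ((x + t) / 2) ((x - t) / 2)

/-- `𝐓 u(x) = u(x) + ∫_{-x}^{x} K(x,t) u(t) dt` on `L¹(I)`. -/
def IsVolterra {a : ℝ} (K : ℝ → ℝ → ℂ) (T : L1 a → L1 a) : Prop :=
  ∀ u : L1 a, T u =ᵐ[volume.restrict (Ioo (-a) a)] fun x => u x + ∫ t in (-x)..x, K x t * u t

/-- `φ₀(0) 𝐓P₊u + φ₀'(0) 𝐓AP₊u + φ₁(0) 𝐓(d/dx)P₋u + φ₁'(0) 𝐓P₋u`.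
This is meaningful if `P₋u` is in `W^{1,1}(I)`, or if `φ₁(0) = 0`
(the third term is then `0` whatever `u` is). -/
def fundamentalSum {a : ℝ} (T : L1 a ≃L[ℂ] L1 a) (φ₀ φ₁ u : L1 a) : L1 a :=
  crep φ₀ 0 • T (Pplus a u) + crep (wderiv φ₀) 0 • T (primitive a (Pplus a u))
    + crep φ₁ 0 • T (wderiv (Pminus a u)) + crep (wderiv φ₁) 0 • T (Pminus a u)

/-- `M_φ v = W⁻¹ {φ₁'(0) P₊𝐓⁻¹v - φ₀'(0) AP₊𝐓⁻¹v - φ₁(0) (d/dx)P₋𝐓⁻¹v + φ₀(0) P₋𝐓⁻¹v}`,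
where `W = W(φ₀, φ₁)`. This is meaningful if `P₋𝐓⁻¹v` is in `W^{1,1}(I)`, or if `φ₁(0) = 0`
(the third term is then `0` whatever `v` is). -/
def inverseSum {a : ℝ} (T : L1 a ≃L[ℂ] L1 a) (φ₀ φ₁ v : L1 a) : L1 a :=
  (wronskian φ₀ φ₁ 0)⁻¹ •
    (crep (wderiv φ₁) 0 • Pplus a (T.symm v)
      - crep (wderiv φ₀) 0 • primitive a (Pplus a (T.symm v))
      - crep φ₁ 0 • wderiv (Pminus a (T.symm v))
      + crep φ₀ 0 • Pminus a (T.symm v))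

end Transmutation

end

open Transmutation

/-!
The proof rests on one identity. For `w` in `W^{2,1}(I)` the function `𝐓w` satisfies
`(𝐓w)'' - q 𝐓w = 𝐓(w'')`, and it has the same value and derivative at `0` as `w`
(`volterra_transmutes`). For integrable `q` the kernel `K` is not differentiable, so the identity is
proved in the form integrated twice from `0` (`transmutation_identity`). The Goursat equation says
that `H(u,v)` is a superposition of the step functions `1[α ≤ u] 1[β ≤ v]`: those with `β = 0` and
density `q(α)/2`, and those with density `q(α+β) H(α,β)`. By Fubini's theorem it is enough to treat
one step function, and there the identity is the fundamental theorem of calculus for an explicit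
antiderivative (`elementary_identity`). Negative `x` are reduced to positive ones by reflection.

The remaining analytic facts are of Volterra type. The Goursat equation is solved on the whole
plane, with `q` extended by zero, by a contraction in the supremum norm with weight `exp(-l|u|)`;
the same estimate gives uniqueness on the square and uniqueness for the Cauchy problem
`y'' - q y = h`. The powers of the integral operator in `𝐓` tend to zero in norm on `L¹(I)`, so `𝐓`
is invertible. Cauchy uniqueness also shows that `𝐓⁻¹` maps `W^{2,1}(I)` to itself.

Finally `T_φ = 𝐓R` with `R = φ₀(0) P₊ + φ₀'(0) A P₊ + φ₁(0) (d/dx) P₋ + φ₁'(0) P₋`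
(`paritySum`). The operator `R` commutes with `d²/dx²` on `W^{3,1}(I)` and acts linearly on the data
`(u(0), u'(0))`, so that `T_φ[x^k]` and `φ_k` solve the same Cauchy problem, by induction on `k`.
Its inverse is computed from the parity relations `P_± A = A P_∓`.

Elements of `W^{1,1}(I)` are handled as `c · 1 + A g`, by the lemma of du Bois-Reymond
(`IsWeakDeriv.exists_eq_add_primitive`); then `g` is the weak derivative and `c` the value at `0`.
-/

noncomputable section

namespace Transmutation

/-! ### Primitives of locally integrable functions -/

theorem integral_primitive_eq_integral_indicator {r : ℝ → ℂ} {x s : ℝ} (hs : s ∈ Ioc 0 x) :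
    ∫ t in (0 : ℝ)..s, r t = ∫ t in Ioc 0 x, (Iic s).indicator r t := by
  rw [setIntegral_indicator measurableSet_Iic, Ioc_inter_Iic, min_eq_right hs.2,
    intervalIntegral.integral_of_le hs.1.le]

/-- The variant with a strict inequality, for the complement of `t ≤ s` in the square. -/
theorem integral_primitive_eq_integral_indicator' {r : ℝ → ℂ} {x s : ℝ} (hs : s ∈ Ioc 0 x) :
    ∫ t in (0 : ℝ)..s, r t = ∫ t in Ioc 0 x, (Iio s).indicator r t := by
  have e : Ioc 0 x ∩ Iio s = Ioo 0 s := by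
    ext t; simp only [mem_inter_iff, mem_Ioc, mem_Iio, mem_Ioo]
    constructor
    · rintro ⟨⟨h1, _⟩, h3⟩; exact ⟨h1, h3⟩
    · rintro ⟨h1, h3⟩; exact ⟨⟨h1, h3.le.trans hs.2⟩, h3⟩
  rw [setIntegral_indicator measurableSet_Iio, e, ← integral_Ioc_eq_integral_Ioo,
    intervalIntegral.integral_of_le hs.1.le]

theorem intervalIntegrable_of_locallyIntegrable {r : ℝ → ℂ} (hr : LocallyIntegrable r) (b c : ℝ) :
    IntervalIntegrable r volume b c :=
  intervalIntegrable_iff.2 ((hr.integrableOn_isCompact isCompact_uIcc).mono_set uIoc_subset_uIcc)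

theorem continuous_primitive_of_locallyIntegrable {r : ℝ → ℂ} (hr : LocallyIntegrable r) :
    Continuous fun x : ℝ => ∫ t in (0 : ℝ)..x, r t :=
  intervalIntegral.continuous_primitive (intervalIntegrable_of_locallyIntegrable hr) 0

theorem primitive_mul_primitive_of_nonneg {p r : ℝ → ℂ} (hp : LocallyIntegrable p)
    (hr : LocallyIntegrable r) {x : ℝ} (hx : 0 ≤ x) :
    (∫ s in (0 : ℝ)..x, p s) * (∫ s in (0 : ℝ)..x, r s)
      = ∫ s in (0 : ℝ)..x, (p s * (∫ t in (0 : ℝ)..s, r t) + (∫ t in (0 : ℝ)..s, p t) * r s) := by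
  have hp' : Integrable p (volume.restrict (Ioc 0 x)) :=
    (hp.integrableOn_isCompact isCompact_Icc).mono_set Ioc_subset_Icc_self
  have hr' : Integrable r (volume.restrict (Ioc 0 x)) :=
    (hr.integrableOn_isCompact isCompact_Icc).mono_set Ioc_subset_Icc_self
  have hpr := hp'.mul_prod hr'
  have hm : MeasurableSet {z : ℝ × ℝ | z.2 ≤ z.1} := measurableSet_le measurable_snd measurable_fst
  have hI1 := hpr.indicator hm
  have hI2 := hpr.indicator hm.compl
  have e1 : ∫ s in (0 : ℝ)..x, p s * (∫ t in (0 : ℝ)..s, r t)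
      = ∫ z, {z : ℝ × ℝ | z.2 ≤ z.1}.indicator (fun z => p z.1 * r z.2) z
        ∂((volume.restrict (Ioc 0 x)).prod (volume.restrict (Ioc 0 x))) := by
    rw [integral_prod _ hI1, intervalIntegral.integral_of_le hx]
    refine setIntegral_congr_fun measurableSet_Ioc fun s hs => ?_
    rw [integral_primitive_eq_integral_indicator hs, ← integral_const_mul]
    congr 1 with t
    by_cases h : t ≤ s <;> simp [indicator, h]
  have e2 : ∫ s in (0 : ℝ)..x, (∫ t in (0 : ℝ)..s, p t) * r s
      = ∫ z, {z : ℝ × ℝ | z.2 ≤ z.1}ᶜ.indicator (fun z => p z.1 * r z.2) z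
        ∂((volume.restrict (Ioc 0 x)).prod (volume.restrict (Ioc 0 x))) := by
    rw [integral_prod_symm _ hI2, intervalIntegral.integral_of_le hx]
    refine setIntegral_congr_fun measurableSet_Ioc fun s hs => ?_
    rw [integral_primitive_eq_integral_indicator' hs, ← integral_mul_const]
    congr 1 with t
    by_cases h : t < s
    · simp [indicator, h]
    · simp [indicator, h, not_lt.1 h]
  have i1 : IntervalIntegrable (fun s => p s * (∫ t in (0 : ℝ)..s, r t)) volume 0 x :=
    (intervalIntegrable_of_locallyIntegrable hp 0 x).mul_continuousOn
      (continuous_primitive_of_locallyIntegrable hr).continuousOn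
  have i2 : IntervalIntegrable (fun s => (∫ t in (0 : ℝ)..s, p t) * r s) volume 0 x :=
    (intervalIntegrable_of_locallyIntegrable hr 0 x).continuousOn_mul
      (continuous_primitive_of_locallyIntegrable hp).continuousOn
  rw [intervalIntegral.integral_add i1 i2, e1, e2, integral_indicator hm,
    integral_indicator hm.compl, integral_add_compl hm hpr, integral_prod_mul,
    intervalIntegral.integral_of_le hx, intervalIntegral.integral_of_le hx]

theorem locallyIntegrable_comp_neg {p : ℝ → ℂ} (hp : LocallyIntegrable p) :
    LocallyIntegrable fun s => p (-s) := by
  rw [locallyIntegrable_iff] at hp ⊢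
  intro k hk
  have h := hp (-k) hk.neg
  have := (Measure.measurePreserving_neg (volume : Measure ℝ)).integrableOn_comp_preimage
    (MeasurableEquiv.neg ℝ).measurableEmbedding (f := p) (s := -k)
  have e : (Neg.neg : ℝ → ℝ) ⁻¹' (-k) = k := by ext; simp
  rw [e] at this
  exact this.2 h

/-- The primitive of the reflected function, up to sign. -/
theorem primitive_comp_neg (p : ℝ → ℂ) (x : ℝ) :
    ∫ s in (0 : ℝ)..x, p (-s) = -∫ s in (0 : ℝ)..(-x), p s := by
  rw [intervalIntegral.integral_comp_neg, intervalIntegral.integral_symm, neg_zero]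

/-- The product rule for absolutely continuous functions vanishing at `0`, from Fubini's theorem
on the square cut along its diagonal. -/
theorem primitive_mul_primitive {p r : ℝ → ℂ} (hp : LocallyIntegrable p)
    (hr : LocallyIntegrable r) (x : ℝ) :
    (∫ s in (0 : ℝ)..x, p s) * (∫ s in (0 : ℝ)..x, r s)
      = ∫ s in (0 : ℝ)..x, (p s * (∫ t in (0 : ℝ)..s, r t) + (∫ t in (0 : ℝ)..s, p t) * r s) := by
  rcases le_total 0 x with hx | hx
  · exact primitive_mul_primitive_of_nonneg hp hr hx
  · have h := primitive_mul_primitive_of_nonneg (locallyIntegrable_comp_neg hp)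
      (locallyIntegrable_comp_neg hr) (x := -x) (by linarith)
    simp only [primitive_comp_neg, neg_neg] at h
    rw [neg_mul_neg] at h
    rw [h]
    have := primitive_comp_neg (fun s =>
      p s * (∫ t in (0 : ℝ)..s, r t) + (∫ t in (0 : ℝ)..s, p t) * r s) (-x)
    rw [neg_neg] at this
    rw [← neg_eq_iff_eq_neg.2 this, ← intervalIntegral.integral_neg]
    congr 1 with s
    ring

/-- The product rule for absolutely continuous functions. -/
theorem add_primitive_mul_add_primitive {p r : ℝ → ℂ} (hp : LocallyIntegrable p)
    (hr : LocallyIntegrable r) (c d : ℂ) (x : ℝ) :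
    (c + ∫ s in (0 : ℝ)..x, p s) * (d + ∫ s in (0 : ℝ)..x, r s)
      = c * d + ∫ s in (0 : ℝ)..x,
        (p s * (d + ∫ t in (0 : ℝ)..s, r t) + (c + ∫ t in (0 : ℝ)..s, p t) * r s) := by
  have i1 : IntervalIntegrable (fun s => p s * (∫ t in (0 : ℝ)..s, r t)) volume 0 x :=
    (intervalIntegrable_of_locallyIntegrable hp 0 x).mul_continuousOn
      (continuous_primitive_of_locallyIntegrable hr).continuousOn
  have i2 : IntervalIntegrable (fun s => (∫ t in (0 : ℝ)..s, p t) * r s) volume 0 x :=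
    (intervalIntegrable_of_locallyIntegrable hr 0 x).continuousOn_mul
      (continuous_primitive_of_locallyIntegrable hp).continuousOn
  have e : (fun s => p s * (d + ∫ t in (0 : ℝ)..s, r t) + (c + ∫ t in (0 : ℝ)..s, p t) * r s)
      = fun s => (p s * d + c * r s)
        + (p s * (∫ t in (0 : ℝ)..s, r t) + (∫ t in (0 : ℝ)..s, p t) * r s) := by
    ext s; ring
  rw [e, intervalIntegral.integral_add
    (((intervalIntegrable_of_locallyIntegrable hp 0 x).mul_const d).add ((intervalIntegrable_of_locallyIntegrable hr 0 x).const_mul c)) (i1.add i2),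
    intervalIntegral.integral_add ((intervalIntegrable_of_locallyIntegrable hp 0 x).mul_const d)
      ((intervalIntegrable_of_locallyIntegrable hr 0 x).const_mul c), intervalIntegral.integral_mul_const,
    intervalIntegral.integral_const_mul, ← primitive_mul_primitive hp hr]
  ring

/-- Cauchy's formula for the repeated primitive. -/
theorem primitive_primitive {r : ℝ → ℂ} (hr : LocallyIntegrable r) (x : ℝ) :
    ∫ y in (0 : ℝ)..x, ∫ t in (0 : ℝ)..y, r t = ∫ y in (0 : ℝ)..x, ((x : ℂ) - y) * r y := by
  have h := add_primitive_mul_add_primitive (p := fun _ => (1 : ℂ))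
    continuous_const.locallyIntegrable hr (-x : ℂ) 0 x
  simp only [intervalIntegral.integral_const, sub_zero, zero_add, one_mul, mul_zero,
    Complex.real_smul, mul_one] at h
  rw [neg_add_cancel, zero_mul, intervalIntegral.integral_add
    ((continuous_primitive_of_locallyIntegrable hr).intervalIntegrable _ _)
    ((intervalIntegrable_of_locallyIntegrable hr 0 x).continuousOn_mul (by fun_prop))] at h
  rw [eq_neg_of_add_eq_zero_left h.symm, ← intervalIntegral.integral_neg]
  congr 1 with s
  ring

/-! ### Weak derivatives and the lemma of du Bois-Reymond -/

section WeakDerivative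

variable {a : ℝ}

/-- A function of `L¹(I)`, extended by zero to the real line. -/
def ext (u : L1 a) : ℝ → ℂ := (Ioo (-a) a).indicator u

theorem integrable_ext (u : L1 a) : Integrable (ext u) :=
  (integrable_indicator_iff measurableSet_Ioo).2 (L1.integrable_coeFn u)

theorem ext_ae_eq (u : L1 a) : ext u =ᵐ[volume.restrict (Ioo (-a) a)] u :=
  indicator_ae_eq_restrict measurableSet_Ioo

theorem integral_norm_ext (u : L1 a) : ∫ y, ‖ext u y‖ = ‖u‖ := by
  rw [L1.norm_eq_integral_norm, ← integral_indicator measurableSet_Ioo]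
  congr 1 with y
  rw [ext, norm_indicator_eq_indicator_norm]

theorem coeFn_primitive (u : L1 a) :
    primitive a u =ᵐ[volume.restrict (Ioo (-a) a)] fun x => ∫ s in (0 : ℝ)..x, ext u s := by
  have h := MemLp.coeFn_toLp (memLp_one_iff_integrable.2 (integrable_primitive u))
  filter_upwards [h, ae_restrict_mem measurableSet_Ioo] with x h1 hx
  exact h1.trans (primitive_congr hx (ext_ae_eq u)).symm

theorem continuous_primitive_ext (u : L1 a) :
    Continuous fun x : ℝ => ∫ s in (0 : ℝ)..x, ext u s :=
  continuous_primitive_of_locallyIntegrable (integrable_ext u).locallyIntegrable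

theorem coeFn_power (a : ℝ) (k : ℕ) :
    power a k =ᵐ[volume.restrict (Ioo (-a) a)] fun x : ℝ => (x : ℂ) ^ k :=
  MemLp.coeFn_toLp _

theorem coeFn_add_primitive (c : ℂ) (g : L1 a) :
    (c • power a 0 + primitive a g : L1 a) =ᵐ[volume.restrict (Ioo (-a) a)]
      fun x => c + ∫ s in (0 : ℝ)..x, ext g s := by
  filter_upwards [Lp.coeFn_add (c • power a 0) (primitive a g), Lp.coeFn_smul c (power a 0),
    coeFn_power a 0, coeFn_primitive g] with x h1 h2 h3 h4
  rw [h1, Pi.add_apply, h2, Pi.smul_apply, h3, h4, pow_zero, smul_eq_mul, mul_one]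

theorem IsTest.eq_zero {ψ : ℝ → ℂ} (h : IsTest a ψ) {x : ℝ} (hx : x ∉ Ioo (-a) a) : ψ x = 0 :=
  image_eq_zero_of_notMem_tsupport fun h' => hx (h.2.2 h')

theorem IsTest.isTest_deriv {ψ : ℝ → ℂ} (h : IsTest a ψ) : IsTest a (deriv ψ) :=
  ⟨(contDiff_infty_iff_deriv.1 h.1).2, h.2.1.deriv, tsupport_deriv_subset.trans h.2.2⟩

theorem IsTest.eq_add_primitive {ψ : ℝ → ℂ} (h : IsTest a ψ) (x : ℝ) :
    ψ x = ψ 0 + ∫ s in (0 : ℝ)..x, deriv ψ s := by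
  rw [intervalIntegral.integral_deriv_eq_sub (fun x _ => (h.1.differentiable (by simp)) x)
    (h.isTest_deriv.1.continuous.intervalIntegrable _ _)]
  ring

/-- Primitives are weakly differentiable: the product rule, integrated against a test function. -/
theorem isWeakDeriv_add_primitive (ha : 0 < a) (c : ℂ) (g : L1 a) :
    IsWeakDeriv (c • power a 0 + primitive a g) g := by
  intro ψ hψ
  have hP := continuous_primitive_ext g
  have hd := hψ.isTest_deriv.1.continuous
  have e1 : ∫ x in Ioo (-a) a, (c • power a 0 + primitive a g : L1 a) x * deriv ψ x
      = ∫ x in (-a)..a, (c + ∫ s in (0 : ℝ)..x, ext g s) * deriv ψ x := by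
    rw [intervalIntegral.integral_of_le (by linarith), integral_Ioc_eq_integral_Ioo]
    refine integral_congr_ae ?_
    filter_upwards [coeFn_add_primitive c g] with x hx
    rw [hx]
  have e2 : ∫ x in Ioo (-a) a, g x * ψ x = ∫ x in (-a)..a, ext g x * ψ x := by
    rw [intervalIntegral.integral_of_le (by linarith), integral_Ioc_eq_integral_Ioo]
    refine integral_congr_ae ?_
    filter_upwards [ext_ae_eq g] with x hx
    rw [hx]
  have hp (x : ℝ) := add_primitive_mul_add_primitive (integrable_ext g).locallyIntegrable
    hd.locallyIntegrable c (ψ 0) x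
  simp only [← hψ.eq_add_primitive] at hp
  have h1 := hp a
  have h2 := hp (-a)
  rw [hψ.eq_zero (by simp)] at h1 h2
  have i1 (b c : ℝ) : IntervalIntegrable (fun x => ext g x * ψ x) volume b c :=
    (integrable_ext g).intervalIntegrable.mul_continuousOn hψ.1.continuous.continuousOn
  have i2 (b d : ℝ) : IntervalIntegrable
      (fun x => (c + ∫ s in (0 : ℝ)..x, ext g s) * deriv ψ x) volume b d :=
    ((continuous_const.add hP).mul hd).intervalIntegrable _ _
  have h3 := intervalIntegral.integral_interval_sub_left ((i1 0 a).add (i2 0 a))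
    ((i1 0 (-a)).add (i2 0 (-a)))
  rw [e1, e2, eq_neg_iff_add_eq_zero, add_comm, ← intervalIntegral.integral_add (i1 _ _) (i2 _ _),
    ← h3]
  linear_combination h2 - h1

/-- A smooth function with integral zero, supported in `I`, is the derivative of a test
function. -/
theorem exists_isTest_deriv_eq {k : ℝ → ℝ} (hk : ContDiff ℝ ∞ k) (hc : HasCompactSupport k)
    (hs : tsupport k ⊆ Ioo (-a) a) (h0 : ∫ x, k x = 0) (ha : 0 < a) :
    ∃ ψ : ℝ → ℂ, IsTest a ψ ∧ ∀ x, deriv ψ x = k x := by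
  -- an interval `[-b, b]` in `I` that contains the support of `k`, hence that of its primitive
  obtain ⟨b, hb, hba, hkb⟩ : ∃ b, 0 < b ∧ b < a ∧ tsupport k ⊆ Icc (-b) b := by
    have hK : IsCompact (insert 0 (tsupport k)) := hc.insert 0
    obtain ⟨m, hm, hmax⟩ := hK.exists_isMaxOn ⟨0, mem_insert _ _⟩ continuous_abs.continuousOn
    have hma : |m| < a := by
      rcases hm with rfl | hm
      · simpa using ha
      · exact abs_lt.2 (hs hm)
    obtain ⟨b, hb1, hb2⟩ := exists_between hma
    refine ⟨b, (abs_nonneg m).trans_lt hb1, hb2, fun x hx => ?_⟩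
    exact abs_le.1 ((hmax (mem_insert_of_mem _ hx)).trans hb1.le)
  have hz : ∀ x, x ∉ Icc (-b) b → k x = 0 := fun x hx =>
    image_eq_zero_of_notMem_tsupport fun h' => hx (hkb h')
  have hD (x : ℝ) : HasDerivAt (fun x => ((∫ s in (-a)..x, k s : ℝ) : ℂ)) (k x : ℂ) x :=
    (hk.continuous.integral_hasStrictDerivAt (-a) x).hasDerivAt.ofReal_comp
  have hd : deriv (fun x => ((∫ s in (-a)..x, k s : ℝ) : ℂ)) = fun x => (k x : ℂ) :=
    funext fun x => (hD x).deriv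
  have hsupp : Function.support (fun x => ((∫ s in (-a)..x, k s : ℝ) : ℂ)) ⊆ Icc (-b) b := by
    intro x hx
    by_contra hxb
    refine hx ?_
    rw [Complex.ofReal_eq_zero]
    rcases lt_or_ge x (-b) with h | h
    · refine (intervalIntegral.integral_congr fun s hs' => ?_).trans
        intervalIntegral.integral_zero
      refine hz s fun hsb => ?_
      have := hsb.1
      rcases le_total (-a) x with h1 | h1
      · rw [uIcc_of_le h1] at hs'; linarith [hs'.2]
      · rw [uIcc_of_ge h1] at hs'; linarith [hs'.2]
    · have hxb' : b < x := by
        by_contra h'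
        exact hxb ⟨h, not_lt.1 h'⟩
      rw [intervalIntegral.integral_eq_integral_of_support_subset, h0]
      intro s hs'
      have := hkb (subset_tsupport _ hs')
      exact ⟨by linarith [this.1], by linarith [this.2]⟩
  refine ⟨_, ⟨contDiff_infty_iff_deriv.2 ⟨fun x => (hD x).differentiableAt, ?_⟩,
    HasCompactSupport.intro isCompact_Icc fun x hx => by_contra fun h' => hx (hsupp h'), ?_⟩,
    fun x => (hD x).deriv⟩
  · rw [hd]
    exact Complex.ofRealCLM.contDiff.comp hk
  · exact (closure_minimal hsupp isClosed_Icc).trans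
      fun x hx => ⟨by linarith [hx.1], by linarith [hx.2]⟩

/-- The lemma of du Bois-Reymond. -/
theorem ae_eq_const_of_forall_integral_mul_deriv_eq_zero (ha : 0 < a) {f : ℝ → ℂ}
    (hf : IntegrableOn f (Ioo (-a) a))
    (h : ∀ ψ : ℝ → ℂ, IsTest a ψ → ∫ x in Ioo (-a) a, f x * deriv ψ x = 0) :
    ∃ c : ℂ, f =ᵐ[volume.restrict (Ioo (-a) a)] fun _ => c := by
  let χ : ContDiffBump (0 : ℝ) := ⟨a / 4, a / 2, by linarith, by linarith⟩
  have hχs : tsupport (χ.normed volume) ⊆ Ioo (-a) a := by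
    rw [χ.tsupport_normed_eq, Real.closedBall_eq_Icc]
    intro x hx
    have h1 : 0 - a / 2 ≤ x := hx.1
    have h2 : x ≤ 0 + a / 2 := hx.2
    constructor <;> linarith
  have hχc : HasCompactSupport (χ.normed volume) := χ.hasCompactSupport_normed
  have hχd : ContDiff ℝ ∞ (χ.normed volume) := χ.contDiff_normed
  set C : ℂ := ∫ x in Ioo (-a) a, f x * (χ.normed volume x : ℂ) with hC
  refine ⟨C, (ae_restrict_iff' measurableSet_Ioo).2 ?_⟩
  have hloc : LocallyIntegrableOn (fun x => f x - C) (Ioo (-a) a) :=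
    (hf.sub (integrableOn_const (by simp))).locallyIntegrableOn
  have key := isOpen_Ioo.ae_eq_zero_of_integral_contDiff_smul_eq_zero hloc ?_
  · filter_upwards [key] with x hx hm
    exact sub_eq_zero.1 (hx hm)
  intro g hg hgc hgs
  have hmul {p : ℝ → ℝ} (hp : Continuous p) (hpc : HasCompactSupport p) :
      Integrable (fun x => f x * (p x : ℂ)) (volume.restrict (Ioo (-a) a)) := by
    obtain ⟨M, hM⟩ := hpc.exists_bound_of_continuous hp
    exact hf.mul_bdd (c := M) (by fun_prop) (Filter.Eventually.of_forall fun x => by simpa using hM x)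
  set G : ℝ := ∫ x, g x with hG
  -- subtracting a multiple of the bump function `χ` makes the integral of `g` zero
  obtain ⟨ψ, hψ, hψd⟩ := exists_isTest_deriv_eq (a := a)
    (k := fun x => g x - G * χ.normed volume x) (hg.sub (contDiff_const.mul hχd))
    (hgc.sub (hχc.mul_left (f := fun _ => G)))
    ((tsupport_sub _ _).trans (union_subset hgs ((tsupport_mul_subset_right
      (f := fun _ => G)).trans hχs)))
    (by
      rw [integral_sub (hg.continuous.integrable_of_hasCompactSupport hgc)
        ((hχd.continuous.integrable_of_hasCompactSupport hχc).const_mul G), integral_const_mul,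
        χ.integral_normed, mul_one, sub_self]) ha
  have h1 := h ψ hψ
  simp only [hψd] at h1
  have e : (fun x => f x * ((g x - G * χ.normed volume x : ℝ) : ℂ))
      = fun x => f x * (g x : ℂ) - (f x * (χ.normed volume x : ℂ)) * G := by
    ext x; push_cast; ring
  rw [e, integral_sub (hmul hg.continuous hgc) ((hmul hχd.continuous hχc).mul_const _),
    integral_mul_const, ← hC] at h1
  have hgz : ∀ x, x ∉ Ioo (-a) a → g x = 0 := fun x hx =>
    image_eq_zero_of_notMem_tsupport fun h' => hx (hgs h')
  rw [← setIntegral_eq_integral_of_forall_compl_eq_zero (s := Ioo (-a) a)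
    (fun x hx => by rw [hgz x hx, zero_smul])]
  have e2 : (fun x => g x • (f x - C)) = fun x => f x * (g x : ℂ) - (g x : ℂ) * C := by
    ext x; rw [Complex.real_smul]; ring
  have e3 : ∫ x in Ioo (-a) a, (g x : ℂ) = G := by
    rw [setIntegral_eq_integral_of_forall_compl_eq_zero (fun x hx => by rw [hgz x hx]; simp),
      hG, integral_complex_ofReal]
  have hgi : Integrable (fun x => (g x : ℂ)) (volume.restrict (Ioo (-a) a)) :=
    (hg.continuous.integrable_of_hasCompactSupport hgc).ofReal.restrict
  rw [e2, integral_sub (hmul hg.continuous hgc) (hgi.mul_const C), integral_mul_const, e3]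
  linear_combination h1

end WeakDerivative

/-! ### The Sobolev spaces and point values -/

section Sobolev

variable {a : ℝ}

theorem isWeakDeriv_zero_left {g : L1 a} (h : IsWeakDeriv 0 g) : g = 0 := by
  refine (Lp.ext_iff).2 (.trans ?_ (Lp.coeFn_zero _ _ _).symm)
  have hloc : LocallyIntegrableOn g (Ioo (-a) a) :=
    IntegrableOn.locallyIntegrableOn (L1.integrable_coeFn g)
  refine (ae_restrict_iff' measurableSet_Ioo).2 ?_
  refine isOpen_Ioo.ae_eq_zero_of_integral_contDiff_smul_eq_zero hloc fun p hp hpc hps => ?_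
  have hs : Function.support (fun x => (p x : ℂ)) = Function.support p := by ext; simp
  have ht : IsTest a fun x => (p x : ℂ) :=
    ⟨Complex.ofRealCLM.contDiff.comp hp, by rwa [HasCompactSupport, tsupport, hs],
      by rwa [tsupport, hs]⟩
  have h1 := h _ ht
  rw [integral_congr_ae (g := fun _ => (0 : ℂ)) (by
    filter_upwards [Lp.coeFn_zero ℂ 1 (volume.restrict (Ioo (-a) a))] with x hx
    rw [hx, Pi.zero_apply, zero_mul]), integral_zero, eq_comm, neg_eq_zero] at h1
  rw [← setIntegral_eq_integral_of_forall_compl_eq_zero (s := Ioo (-a) a)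
    (fun x hx => by
      rw [image_eq_zero_of_notMem_tsupport fun h' => hx (hps h'), zero_smul]), ← h1]
  congr 1 with x
  rw [Complex.real_smul, mul_comm]

theorem IsWeakDeriv.sub {f g f' g' : L1 a} (h : IsWeakDeriv f f') (k : IsWeakDeriv g g') :
    IsWeakDeriv (f - g) (f' - g') := by
  simpa [sub_eq_add_neg] using h.add (k.smul (-1))

theorem IsWeakDeriv.unique {f g g' : L1 a} (h : IsWeakDeriv f g) (h' : IsWeakDeriv f g') :
    g = g' := by
  have := h.sub h'
  rw [sub_self] at this
  exact sub_eq_zero.1 (isWeakDeriv_zero_left this)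

theorem IsWeakDeriv.wderiv_eq {f g : L1 a} (h : IsWeakDeriv f g) : wderiv f = g := by
  have h' : ∃ g : L1 a, IsWeakDeriv f g := ⟨g, h⟩
  rw [wderiv, dif_pos h']
  exact h'.choose_spec.unique h

theorem wderiv_add_primitive (ha : 0 < a) (c : ℂ) (g : L1 a) :
    wderiv (c • power a 0 + primitive a g) = g :=
  (isWeakDeriv_add_primitive ha c g).wderiv_eq

/-- A weakly differentiable function is a constant plus the primitive of its derivative. -/
theorem IsWeakDeriv.exists_eq_add_primitive (ha : 0 < a) {f g : L1 a} (h : IsWeakDeriv f g) :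
    ∃ c : ℂ, f = c • power a 0 + primitive a g := by
  have h0 : IsWeakDeriv (primitive a g) g := by
    simpa using isWeakDeriv_add_primitive ha 0 g
  have h1 := h.sub h0
  rw [sub_self] at h1
  obtain ⟨c, hc⟩ := ae_eq_const_of_forall_integral_mul_deriv_eq_zero ha
    (L1.integrable_coeFn (f - primitive a g)) (fun ψ hψ => by
      rw [h1 ψ hψ, neg_eq_zero]
      refine (integral_congr_ae (g := fun _ => (0 : ℂ)) ?_).trans (integral_zero _ _)
      filter_upwards [Lp.coeFn_zero ℂ 1 (volume.restrict (Ioo (-a) a))] with x hx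
      rw [hx, Pi.zero_apply, zero_mul])
  refine ⟨c, ?_⟩
  rw [← sub_eq_iff_eq_add]
  refine Lp.ext ?_
  filter_upwards [hc, Lp.coeFn_smul c (power a 0), coeFn_power a 0] with x h1 h2 h3
  rw [h1, h2, Pi.smul_apply, h3, pow_zero, smul_eq_mul, mul_one]

theorem mem_sobolev_succ_iff (ha : 0 < a) {k : ℕ} {f : L1 a} :
    f ∈ sobolev a (k + 1) ↔ ∃ c : ℂ, ∃ g ∈ sobolev a k, f = c • power a 0 + primitive a g := by
  constructor
  · rintro ⟨g, hg, h⟩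
    obtain ⟨c, hc⟩ := h.exists_eq_add_primitive ha
    exact ⟨c, g, hg, hc⟩
  · rintro ⟨c, g, hg, rfl⟩
    exact ⟨g, hg, isWeakDeriv_add_primitive ha c g⟩

theorem mem_sobolev_one_iff (ha : 0 < a) {f : L1 a} :
    f ∈ sobolev a 1 ↔ ∃ (c : ℂ) (g : L1 a), f = c • power a 0 + primitive a g := by
  rw [mem_sobolev_succ_iff ha]
  simp [sobolev]

theorem add_primitive_mem_sobolev (ha : 0 < a) {k : ℕ} (c : ℂ) {g : L1 a} (hg : g ∈ sobolev a k) :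
    c • power a 0 + primitive a g ∈ sobolev a (k + 1) :=
  (mem_sobolev_succ_iff ha).2 ⟨c, g, hg, rfl⟩

theorem sobolev_antitone (a : ℝ) : Antitone (sobolev a) := by
  refine antitone_nat_of_succ_le fun k => ?_
  induction k with
  | zero => exact le_top
  | succ k ih =>
    rintro f ⟨g, hg, h⟩
    exact ⟨g, ih hg, h⟩

theorem wderiv_mem_sobolev {k : ℕ} {f : L1 a} (hf : f ∈ sobolev a (k + 1)) :
    wderiv f ∈ sobolev a k := by
  obtain ⟨g, hg, h⟩ := hf
  rwa [h.wderiv_eq]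

theorem eqOn_of_ae_eq_of_continuous {f g : ℝ → ℂ} (hf : Continuous f) (hg : Continuous g)
    (h : f =ᵐ[volume.restrict (Ioo (-a) a)] g) {x : ℝ} (hx : x ∈ Ioo (-a) a) : f x = g x :=
  Measure.eqOn_open_of_ae_eq h isOpen_Ioo hf.continuousOn hg.continuousOn hx

theorem crep_eq {f : L1 a} {g : ℝ → ℂ} (hg : Continuous g)
    (h : f =ᵐ[volume.restrict (Ioo (-a) a)] g) {x : ℝ} (hx : x ∈ Ioo (-a) a) :
    crep f x = g x := by
  have h' : ∃ g : ℝ → ℂ, Continuous g ∧ f =ᵐ[volume.restrict (Ioo (-a) a)] g := ⟨g, hg, h⟩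
  rw [crep, dif_pos h']
  exact eqOn_of_ae_eq_of_continuous h'.choose_spec.1 hg (h'.choose_spec.2.symm.trans h) hx

theorem crep_add_primitive (c : ℂ) (g : L1 a) {x : ℝ} (hx : x ∈ Ioo (-a) a) :
    crep (c • power a 0 + primitive a g) x = c + ∫ s in (0 : ℝ)..x, ext g s :=
  crep_eq (continuous_const.add (continuous_primitive_ext g)) (coeFn_add_primitive c g) hx

theorem zero_mem_Ioo (ha : 0 < a) : (0 : ℝ) ∈ Ioo (-a) a := ⟨by linarith, ha⟩

theorem crep_add_primitive_zero (ha : 0 < a) (c : ℂ) (g : L1 a) :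
    crep (c • power a 0 + primitive a g) 0 = c := by
  rw [crep_add_primitive c g (zero_mem_Ioo ha)]; simp

/-- The fundamental theorem of calculus in `W^{1,1}(I)`. -/
theorem eq_crep_add_primitive_wderiv (ha : 0 < a) {f : L1 a} (hf : f ∈ sobolev a 1) :
    f = crep f 0 • power a 0 + primitive a (wderiv f) := by
  obtain ⟨c, g, rfl⟩ := (mem_sobolev_one_iff ha).1 hf
  rw [wderiv_add_primitive ha, crep_add_primitive_zero ha]

theorem crep_eq_add_primitive (ha : 0 < a) {f : L1 a} (hf : f ∈ sobolev a 1) {x : ℝ}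
    (hx : x ∈ Ioo (-a) a) :
    crep f x = crep f 0 + ∫ s in (0 : ℝ)..x, ext (wderiv f) s := by
  conv_lhs => rw [eq_crep_add_primitive_wderiv ha hf]
  exact crep_add_primitive _ _ hx

theorem ae_eq_add_primitive_wderiv (ha : 0 < a) {f : L1 a} (hf : f ∈ sobolev a 1) :
    f =ᵐ[volume.restrict (Ioo (-a) a)]
      fun x => crep f 0 + ∫ s in (0 : ℝ)..x, ext (wderiv f) s := by
  have h := coeFn_add_primitive (crep f 0) (wderiv f)
  rwa [← eq_crep_add_primitive_wderiv ha hf] at h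

theorem ae_eq_crep (ha : 0 < a) {f : L1 a} (hf : f ∈ sobolev a 1) :
    f =ᵐ[volume.restrict (Ioo (-a) a)] crep f := by
  filter_upwards [ae_eq_add_primitive_wderiv ha hf, ae_restrict_mem measurableSet_Ioo] with x h1 hx
  rw [h1, crep_eq_add_primitive ha hf hx]

theorem isWeakDeriv_wderiv {f : L1 a} (hf : f ∈ sobolev a 1) : IsWeakDeriv f (wderiv f) := by
  obtain ⟨g, -, h⟩ := hf
  rwa [h.wderiv_eq]

theorem wderiv_add {f g : L1 a} (hf : f ∈ sobolev a 1) (hg : g ∈ sobolev a 1) :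
    wderiv (f + g) = wderiv f + wderiv g :=
  ((isWeakDeriv_wderiv hf).add (isWeakDeriv_wderiv hg)).wderiv_eq

theorem wderiv_smul (c : ℂ) {f : L1 a} (hf : f ∈ sobolev a 1) :
    wderiv (c • f) = c • wderiv f :=
  ((isWeakDeriv_wderiv hf).smul c).wderiv_eq

theorem power_zero_mem_sobolev (ha : 0 < a) (k : ℕ) : power a 0 ∈ sobolev a k := by
  cases k with
  | zero => trivial
  | succ k => simpa using add_primitive_mem_sobolev ha 1 (zero_mem (sobolev a k))

theorem primitive_mem_sobolev (ha : 0 < a) {k : ℕ} {g : L1 a} (hg : g ∈ sobolev a k) :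
    primitive a g ∈ sobolev a (k + 1) := by
  simpa using add_primitive_mem_sobolev ha 0 hg

theorem wderiv_primitive (ha : 0 < a) (g : L1 a) : wderiv (primitive a g) = g := by
  simpa using wderiv_add_primitive ha 0 g

theorem wderiv_power_zero (ha : 0 < a) : wderiv (power a 0) = 0 := by
  simpa using wderiv_add_primitive ha 1 0

theorem crep_primitive_zero (ha : 0 < a) (g : L1 a) : crep (primitive a g) 0 = 0 := by
  simpa using crep_add_primitive_zero ha 0 g

theorem crep_add (ha : 0 < a) {f g : L1 a} (hf : f ∈ sobolev a 1) (hg : g ∈ sobolev a 1) :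
    crep (f + g) 0 = crep f 0 + crep g 0 := by
  obtain ⟨c, f', rfl⟩ := (mem_sobolev_one_iff ha).1 hf
  obtain ⟨d, g', rfl⟩ := (mem_sobolev_one_iff ha).1 hg
  rw [add_add_add_comm, ← add_smul, ← map_add]
  simp only [crep_add_primitive_zero ha]

theorem crep_smul (ha : 0 < a) (e : ℂ) {f : L1 a} (hf : f ∈ sobolev a 1) :
    crep (e • f) 0 = e * crep f 0 := by
  obtain ⟨c, f', rfl⟩ := (mem_sobolev_one_iff ha).1 hf
  rw [smul_add, smul_smul, ← map_smul]
  simp only [crep_add_primitive_zero ha]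

theorem primitive_power (k : ℕ) :
    primitive a (power a k) = ((k : ℂ) + 1)⁻¹ • power a (k + 1) := by
  refine Lp.ext ?_
  have he : ext (power a k) =ᵐ[volume.restrict (Ioo (-a) a)] fun x => (x : ℂ) ^ k :=
    (ext_ae_eq _).trans (coeFn_power a k)
  filter_upwards [coeFn_primitive (power a k), coeFn_power a (k + 1),
    Lp.coeFn_smul ((k : ℂ) + 1)⁻¹ (power a (k + 1)), ae_restrict_mem measurableSet_Ioo]
    with x h1 h2 h3 hx
  rw [h1, h3, Pi.smul_apply, h2, primitive_congr hx he]
  have hk : (k : ℂ) + 1 ≠ 0 := by exact_mod_cast k.succ_ne_zero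
  rw [intervalIntegral.integral_eq_sub_of_hasDerivAt
    (f := fun x : ℝ => ((k : ℂ) + 1)⁻¹ * (x : ℂ) ^ (k + 1))]
  · simp
  · intro y _
    have := (hasDerivAt_pow (k + 1) (y : ℂ)).comp_ofReal.const_mul ((k : ℂ) + 1)⁻¹
    rw [add_tsub_cancel_right] at this
    push_cast at this
    rwa [inv_mul_cancel_left₀ hk] at this
  · exact Continuous.intervalIntegrable (by fun_prop) _ _

theorem power_succ_eq (k : ℕ) :
    power a (k + 1) = ((k : ℂ) + 1) • primitive a (power a k) := by
  have hk : (k : ℂ) + 1 ≠ 0 := by exact_mod_cast k.succ_ne_zero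
  rw [primitive_power, smul_smul, mul_inv_cancel₀ hk, one_smul]

theorem power_mem_sobolev (ha : 0 < a) (j k : ℕ) : power a k ∈ sobolev a j := by
  induction j generalizing k with
  | zero => trivial
  | succ j ih =>
    cases k with
    | zero => exact power_zero_mem_sobolev ha _
    | succ k =>
      rw [power_succ_eq]
      exact Submodule.smul_mem _ _ (primitive_mem_sobolev ha (ih k))

theorem wderiv_power_succ (ha : 0 < a) (k : ℕ) :
    wderiv (power a (k + 1)) = ((k : ℂ) + 1) • power a k := by
  rw [power_succ_eq, wderiv_smul _ (primitive_mem_sobolev ha (k := 0) trivial),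
    wderiv_primitive ha]

theorem crep_power_zero (ha : 0 < a) : crep (power a 0) 0 = 1 := by
  simpa using crep_add_primitive_zero ha 1 0

theorem crep_power_succ (ha : 0 < a) (k : ℕ) : crep (power a (k + 1)) 0 = 0 := by
  rw [power_succ_eq, crep_smul ha _ (primitive_mem_sobolev ha (k := 0) trivial),
    crep_primitive_zero ha, mul_zero]

end Sobolev

/-! ### Reflection and parity -/

section Reflection

variable {a : ℝ}

theorem coeFn_reflect (u : L1 a) :
    reflect a u =ᵐ[volume.restrict (Ioo (-a) a)] fun x => u (-x) :=
  Lp.coeFn_compMeasurePreserving u (measurePreserving_neg a)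

theorem reflect_reflect (u : L1 a) : reflect a (reflect a u) = u := by
  refine Lp.ext ?_
  filter_upwards [coeFn_reflect (reflect a u),
    (measurePreserving_neg a).quasiMeasurePreserving.ae (coeFn_reflect u)] with x h1 h2
  rw [h1, h2, neg_neg]

theorem norm_reflect (u : L1 a) : ‖reflect a u‖ = ‖u‖ :=
  Lp.norm_compMeasurePreserving u (measurePreserving_neg a)

theorem reflect_power_zero (a : ℝ) : reflect a (power a 0) = power a 0 := by
  refine Lp.ext ?_
  filter_upwards [coeFn_reflect (power a 0), coeFn_power a 0,
    (measurePreserving_neg a).quasiMeasurePreserving.ae (coeFn_power a 0)] with x h1 h2 h3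
  rw [h1, h2, h3, pow_zero, pow_zero]

theorem primitive_reflect (u : L1 a) :
    primitive a (reflect a u) = -reflect a (primitive a u) := by
  refine Lp.ext ?_
  filter_upwards [coeFn_primitive (reflect a u), Lp.coeFn_neg (reflect a (primitive a u)),
    coeFn_reflect (primitive a u),
    (measurePreserving_neg a).quasiMeasurePreserving.ae (coeFn_primitive u),
    ae_restrict_mem measurableSet_Ioo] with x h1 h2 h3 h4 hx
  have he : ext (reflect a u) =ᵐ[volume.restrict (Ioo (-a) a)] fun x => ext u (-x) := by
    filter_upwards [ext_ae_eq (reflect a u), coeFn_reflect u,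
      (measurePreserving_neg a).quasiMeasurePreserving.ae (ext_ae_eq u)] with y k1 k2 k3
    rw [k1, k2, k3]
  rw [h1, h2, Pi.neg_apply, h3, h4, primitive_congr hx he, primitive_comp_neg]

theorem Pplus_apply (u : L1 a) : Pplus a u = (1 / 2 : ℂ) • (u + reflect a u) := rfl

theorem Pminus_apply (u : L1 a) : Pminus a u = (1 / 2 : ℂ) • (u - reflect a u) := rfl

theorem Pplus_add_Pminus (u : L1 a) : Pplus a u + Pminus a u = u := by
  rw [Pplus_apply, Pminus_apply]; module

theorem Pplus_Pplus (u : L1 a) : Pplus a (Pplus a u) = Pplus a u := by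
  simp only [Pplus_apply, map_smul, map_add, reflect_reflect]; module

theorem Pplus_Pminus (u : L1 a) : Pplus a (Pminus a u) = 0 := by
  simp only [Pplus_apply, Pminus_apply, map_smul, map_sub, reflect_reflect]; module

theorem Pminus_Pplus (u : L1 a) : Pminus a (Pplus a u) = 0 := by
  simp only [Pplus_apply, Pminus_apply, map_smul, map_add, reflect_reflect]; module

theorem Pminus_Pminus (u : L1 a) : Pminus a (Pminus a u) = Pminus a u := by
  simp only [Pminus_apply, map_smul, map_sub, reflect_reflect]; module

theorem Pplus_primitive (u : L1 a) : Pplus a (primitive a u) = primitive a (Pminus a u) := by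
  simp only [Pplus_apply, Pminus_apply, map_smul, map_sub, primitive_reflect]; module

theorem Pminus_primitive (u : L1 a) : Pminus a (primitive a u) = primitive a (Pplus a u) := by
  simp only [Pplus_apply, Pminus_apply, map_smul, map_add, primitive_reflect]; module

theorem Pplus_power_zero (a : ℝ) : Pplus a (power a 0) = power a 0 := by
  rw [Pplus_apply, reflect_power_zero]; module

theorem Pminus_power_zero (a : ℝ) : Pminus a (power a 0) = 0 := by
  rw [Pminus_apply, reflect_power_zero]; module

theorem Pplus_Pminus_mem_sobolev (ha : 0 < a) (k : ℕ) {u : L1 a} (hu : u ∈ sobolev a k) :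
    Pplus a u ∈ sobolev a k ∧ Pminus a u ∈ sobolev a k := by
  induction k generalizing u with
  | zero => exact ⟨trivial, trivial⟩
  | succ k ih =>
    obtain ⟨c, g, hg, rfl⟩ := (mem_sobolev_succ_iff ha).1 hu
    simp only [map_add, map_smul, Pplus_power_zero, Pminus_power_zero, Pplus_primitive,
      Pminus_primitive, smul_zero, zero_add]
    exact ⟨add_primitive_mem_sobolev ha c (ih hg).2, primitive_mem_sobolev ha (ih hg).1⟩

theorem wderiv_Pplus (ha : 0 < a) {u : L1 a} (hu : u ∈ sobolev a 1) :
    wderiv (Pplus a u) = Pminus a (wderiv u) := by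
  obtain ⟨c, g, rfl⟩ := (mem_sobolev_one_iff ha).1 hu
  simp only [map_add, map_smul, Pplus_power_zero, Pplus_primitive, wderiv_add_primitive ha]

theorem wderiv_Pminus (ha : 0 < a) {u : L1 a} (hu : u ∈ sobolev a 1) :
    wderiv (Pminus a u) = Pplus a (wderiv u) := by
  obtain ⟨c, g, rfl⟩ := (mem_sobolev_one_iff ha).1 hu
  simp only [map_add, map_smul, Pminus_power_zero, Pminus_primitive, wderiv_add_primitive ha,
    smul_zero, zero_add, wderiv_primitive ha]

theorem crep_Pplus (ha : 0 < a) {u : L1 a} (hu : u ∈ sobolev a 1) :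
    crep (Pplus a u) 0 = crep u 0 := by
  obtain ⟨c, g, rfl⟩ := (mem_sobolev_one_iff ha).1 hu
  simp only [map_add, map_smul, Pplus_power_zero, Pplus_primitive, crep_add_primitive_zero ha]

theorem crep_Pminus (ha : 0 < a) {u : L1 a} (hu : u ∈ sobolev a 1) :
    crep (Pminus a u) 0 = 0 := by
  obtain ⟨c, g, rfl⟩ := (mem_sobolev_one_iff ha).1 hu
  simp only [map_add, map_smul, Pminus_power_zero, Pminus_primitive, smul_zero, zero_add,
    crep_primitive_zero ha]

/-- An odd function in `W^{1,1}(I)` is the primitive of its derivative. -/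
theorem primitive_wderiv_Pminus (ha : 0 < a) {u : L1 a} (hu : u ∈ sobolev a 1) :
    primitive a (wderiv (Pminus a u)) = Pminus a u := by
  have h := eq_crep_add_primitive_wderiv ha (Pplus_Pminus_mem_sobolev ha 1 hu).2
  rw [crep_Pminus ha hu, zero_smul, zero_add] at h
  exact h.symm

theorem norm_Pplus_le (u : L1 a) : ‖Pplus a u‖ ≤ ‖u‖ := by
  rw [Pplus_apply, norm_smul]
  have := norm_add_le u (reflect a u)
  rw [norm_reflect] at this
  norm_num
  linarith

theorem norm_Pminus_le (u : L1 a) : ‖Pminus a u‖ ≤ ‖u‖ := by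
  rw [Pminus_apply, norm_smul]
  have := norm_sub_le u (reflect a u)
  rw [norm_reflect] at this
  norm_num
  linarith

end Reflection

/-! ### The Goursat integral equation and the Cauchy problem -/

/-- Dominated convergence: `q` may be discontinuous in the variable of integration, since the
parameters enter only through `k` and the end point. -/
theorem continuous_integral_mul {q : ℝ → ℂ} (hq : LocallyIntegrable q) {k : ℝ × ℝ → ℂ}
    (hk : Continuous k) :
    Continuous fun p : ℝ × ℝ => ∫ y in (0 : ℝ)..p.2, q y * k (p.1, y) := by
  rw [continuous_iff_continuousAt]
  rintro ⟨α₀, b₀⟩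
  obtain ⟨C, hC⟩ := ((isCompact_closedBall α₀ 1).prod
    (isCompact_Icc (a := -(|b₀| + 1)) (b := |b₀| + 1))).exists_bound_of_continuousOn hk.continuousOn
  refine intervalIntegral.continuousAt_parametric_primitive_of_dominated
    (F := fun α y => q y * k (α, y)) (fun y => ‖q y‖ * C) (-(|b₀| + 1)) (|b₀| + 1)
    (fun α => ?_) ?_ ?_ ?_ ?_ ?_ (by simp)
  · exact (hq.aestronglyMeasurable.mul (by fun_prop)).restrict
  · filter_upwards [Metric.closedBall_mem_nhds α₀ one_pos] with α hα
    filter_upwards [ae_restrict_mem measurableSet_uIoc] with y hy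
    rw [norm_mul]
    refine mul_le_mul_of_nonneg_left (hC (α, y) ⟨hα, ?_⟩) (norm_nonneg _)
    rw [uIoc_of_le (by linarith [abs_nonneg b₀])] at hy
    exact Ioc_subset_Icc_self hy
  · exact (intervalIntegrable_of_locallyIntegrable hq _ _).norm.mul_const C
  · exact Filter.Eventually.of_forall fun y => by fun_prop
  · constructor <;> linarith [abs_nonneg b₀]
  · constructor <;> linarith [neg_abs_le b₀, le_abs_self b₀]

/-- If `q` is integrable and `g` is continuous, then the integral of `q(α + β) g(α, β)` over
`β ∈ [0, v]` is continuous in `(α, v)`, although `q` need not be. The substitution `y = α + β`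
moves the parameter `α` from `q` to `g` and to the end points. -/
theorem continuous_integral_add_mul {q : ℝ → ℂ} (hq : Integrable q) {g : ℝ × ℝ → ℂ}
    (hg : Continuous g) :
    Continuous fun p : ℝ × ℝ => ∫ β in (0 : ℝ)..p.2, q (p.1 + β) * g (p.1, β) := by
  have hΨ : Continuous fun p : ℝ × ℝ => ∫ y in (0 : ℝ)..p.2, q y * g (p.1, y - p.1) :=
    continuous_integral_mul hq.locallyIntegrable (k := fun z => g (z.1, z.2 - z.1)) (by fun_prop)
  have hi (α b c : ℝ) : IntervalIntegrable (fun y => q y * g (α, y - α)) volume b c :=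
    hq.intervalIntegrable.mul_continuousOn (by fun_prop)
  have e : (fun p : ℝ × ℝ => ∫ β in (0 : ℝ)..p.2, q (p.1 + β) * g (p.1, β))
      = fun p => (∫ y in (0 : ℝ)..(p.1 + p.2), q y * g (p.1, y - p.1))
        - ∫ y in (0 : ℝ)..p.1, q y * g (p.1, y - p.1) := by
    ext p
    rw [intervalIntegral.integral_interval_sub_left (hi _ _ _) (hi _ _ _)]
    have := intervalIntegral.integral_comp_add_left (fun y => q y * g (p.1, y - p.1)) p.1
      (a := 0) (b := p.2)
    simpa using this
  rw [e]
  exact (hΨ.comp (by fun_prop : Continuous fun p : ℝ × ℝ => (p.1, p.1 + p.2))).sub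
    (hΨ.comp (by fun_prop : Continuous fun p : ℝ × ℝ => (p.1, p.1)))

/-- The Goursat integral `∫₀ᵘ ∫₀ᵛ q(α + β) g(α, β) dβ dα`. -/
def goursatIntegral (q : ℝ → ℂ) (g : ℝ × ℝ → ℂ) (p : ℝ × ℝ) : ℂ :=
  ∫ α in (0 : ℝ)..p.1, ∫ β in (0 : ℝ)..p.2, q (α + β) * g (α, β)

theorem continuous_goursatIntegral {q : ℝ → ℂ} (hq : Integrable q) {g : ℝ × ℝ → ℂ}
    (hg : Continuous g) : Continuous (goursatIntegral q g) := by
  refine intervalIntegral.continuous_parametric_intervalIntegral_of_continuous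
    (f := fun (p : ℝ × ℝ) α => ∫ β in (0 : ℝ)..p.2, q (α + β) * g (α, β)) ?_ continuous_fst
  exact (continuous_integral_add_mul hq hg).comp
    (by fun_prop : Continuous fun z : (ℝ × ℝ) × ℝ => (z.2, z.1.2))

theorem intervalIntegrable_add_mul {q : ℝ → ℂ} (hq : Integrable q) {g : ℝ × ℝ → ℂ}
    (hg : Continuous g) (α b c : ℝ) :
    IntervalIntegrable (fun β => q (α + β) * g (α, β)) volume b c :=
  (hq.comp_add_left α).intervalIntegrable.mul_continuousOn (by fun_prop)

theorem goursatIntegral_sub {q : ℝ → ℂ} (hq : Integrable q) {g h : ℝ × ℝ → ℂ}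
    (hg : Continuous g) (hh : Continuous h) (p : ℝ × ℝ) :
    goursatIntegral q g p - goursatIntegral q h p
      = goursatIntegral q (fun z => g z - h z) p := by
  have hc {k : ℝ × ℝ → ℂ} (hk : Continuous k) : IntervalIntegrable
      (fun α => ∫ β in (0 : ℝ)..p.2, q (α + β) * k (α, β)) volume 0 p.1 :=
    ((continuous_integral_add_mul hq hk).comp
      (by fun_prop : Continuous fun α : ℝ => (α, p.2))).intervalIntegrable _ _
  rw [goursatIntegral, goursatIntegral, goursatIntegral,
    ← intervalIntegral.integral_sub (hc hg) (hc hh)]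
  congr 1 with α
  rw [← intervalIntegral.integral_sub (intervalIntegrable_add_mul hq hg _ _ _)
    (intervalIntegrable_add_mul hq hh _ _ _)]
  congr 1 with β
  ring

theorem abs_integral_exp_mul_abs_le {l : ℝ} (hl : 0 < l) (u : ℝ) :
    |∫ α in (0 : ℝ)..u, Real.exp (l * |α|)| ≤ Real.exp (l * |u|) / l := by
  have key : ∀ u : ℝ, 0 ≤ u →
      ∫ α in (0 : ℝ)..u, Real.exp (l * |α|) = (Real.exp (l * |u|) - 1) / l := by
    intro u hu
    have : ∫ α in (0 : ℝ)..u, Real.exp (l * |α|) = ∫ α in (0 : ℝ)..u, Real.exp (l * α) := by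
      refine intervalIntegral.integral_congr fun α hα => ?_
      rw [uIcc_of_le hu] at hα
      simp only [abs_of_nonneg hα.1]
    rw [this, intervalIntegral.integral_comp_mul_left _ hl.ne', integral_exp, abs_of_nonneg hu]
    simp [div_eq_inv_mul]
  have h1 : |∫ α in (0 : ℝ)..u, Real.exp (l * |α|)| = (Real.exp (l * |u|) - 1) / l := by
    have h2 : 0 ≤ (Real.exp (l * |u|) - 1) / l :=
      div_nonneg (by linarith [Real.one_le_exp (mul_nonneg hl.le (abs_nonneg u))]) hl.le
    rcases le_total 0 u with hu | hu
    · rw [key u hu, abs_of_nonneg h2]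
    · have h3 := key (-u) (by linarith)
      have h4 := intervalIntegral.integral_comp_neg (a := 0) (b := -u)
        (fun α => Real.exp (l * |α|))
      simp only [abs_neg, neg_neg, neg_zero] at h4 h3
      rw [intervalIntegral.integral_symm, abs_neg, ← h4, h3, abs_of_nonneg h2]
  rw [h1]
  gcongr
  linarith

theorem norm_intervalIntegral_mul_le {q g : ℝ → ℂ} (hq : Integrable q) {b c M : ℝ} (hM : 0 ≤ M)
    (h : ∀ β ∈ uIoc b c, ‖g β‖ ≤ M) :
    ‖∫ β in b..c, q β * g β‖ ≤ (∫ y, ‖q y‖) * M := by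
  calc ‖∫ β in b..c, q β * g β‖ ≤ ∫ β in uIoc b c, ‖q β * g β‖ :=
        intervalIntegral.norm_integral_le_integral_norm_uIoc
    _ ≤ ∫ β in uIoc b c, ‖q β‖ * M := by
        refine integral_mono_of_nonneg (Filter.Eventually.of_forall fun _ => norm_nonneg _)
          (hq.norm.mul_const M).integrableOn ?_
        filter_upwards [ae_restrict_mem measurableSet_uIoc] with β hβ
        rw [norm_mul]
        exact mul_le_mul_of_nonneg_left (h β hβ) (norm_nonneg _)
    _ ≤ ∫ β, ‖q β‖ * M := setIntegral_le_integral (hq.norm.mul_const M)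
        (Filter.Eventually.of_forall fun _ => mul_nonneg (norm_nonneg _) hM)
    _ = (∫ y, ‖q y‖) * M := integral_mul_const _ _

/-- The exponent of the weight `exp(l |x|)` for which the integral operators with density `q`
have norm at most `1/2`. -/
def weight (q : ℝ → ℂ) : ℝ := 2 * (∫ y, ‖q y‖) + 1

theorem weight_pos (q : ℝ → ℂ) : 0 < weight q := by
  have : 0 ≤ ∫ y, ‖q y‖ := integral_nonneg fun _ => norm_nonneg _
  rw [weight]; linarith

theorem integral_norm_mul_div_weight_le (q : ℝ → ℂ) {M : ℝ} (hM : 0 ≤ M) (u : ℝ) :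
    (∫ y, ‖q y‖) * M * (Real.exp (weight q * |u|) / weight q)
      ≤ M / 2 * Real.exp (weight q * |u|) := by
  have h1 : (∫ y, ‖q y‖) / weight q ≤ 1 / 2 := by
    rw [div_le_div_iff₀ (weight_pos q) two_pos, weight]; linarith
  calc (∫ y, ‖q y‖) * M * (Real.exp (weight q * |u|) / weight q)
      = (∫ y, ‖q y‖) / weight q * (M * Real.exp (weight q * |u|)) := by ring
    _ ≤ 1 / 2 * (M * Real.exp (weight q * |u|)) := by gcongr
    _ = _ := by ring

/-- Integration from `0` gains the factor `1 / weight q`, which absorbs the norm of `q`. -/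
theorem norm_iteratedIntegral_le {q : ℝ → ℂ} {F : ℝ → ℂ} {M u : ℝ} (hM : 0 ≤ M)
    (hF : ∀ α ∈ uIoc 0 u, ‖F α‖ ≤ (∫ y, ‖q y‖) * (M * Real.exp (weight q * |α|))) :
    ‖∫ α in (0 : ℝ)..u, F α‖ ≤ M / 2 * Real.exp (weight q * |u|) := by
  have h0 : 0 ≤ ∫ y, ‖q y‖ := integral_nonneg fun _ => norm_nonneg _
  calc ‖∫ α in (0 : ℝ)..u, F α‖
      ≤ |∫ α in (0 : ℝ)..u, (∫ y, ‖q y‖) * M * Real.exp (weight q * |α|)| := by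
        refine intervalIntegral.norm_integral_le_abs_of_norm_le ?_
          (Continuous.intervalIntegrable (by fun_prop) _ _)
        filter_upwards [ae_restrict_mem measurableSet_uIoc] with α hα
        rw [mul_assoc]
        exact hF α hα
    _ = (∫ y, ‖q y‖) * M * |∫ α in (0 : ℝ)..u, Real.exp (weight q * |α|)| := by
        rw [intervalIntegral.integral_const_mul, abs_mul, abs_of_nonneg (mul_nonneg h0 hM)]
    _ ≤ (∫ y, ‖q y‖) * M * (Real.exp (weight q * |u|) / weight q) := by
        gcongr
        exact abs_integral_exp_mul_abs_le (weight_pos q) u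
    _ ≤ _ := integral_norm_mul_div_weight_le q hM u

/-- The Goursat integral is a contraction for the weighted supremum norm. -/
theorem norm_goursatIntegral_le {q : ℝ → ℂ} (hq : Integrable q) {g : ℝ × ℝ → ℂ} {M u v : ℝ}
    (hM : 0 ≤ M) (h : ∀ α ∈ uIoc 0 u, ∀ β ∈ uIoc 0 v, ‖g (α, β)‖ ≤ M * Real.exp (weight q * |α|)) :
    ‖goursatIntegral q g (u, v)‖ ≤ M / 2 * Real.exp (weight q * |u|) := by
  refine norm_iteratedIntegral_le hM fun α hα => ?_
  have := norm_intervalIntegral_mul_le (hq.comp_add_left α) (b := 0) (c := v)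
    (g := fun β => g (α, β)) (M := M * Real.exp (weight q * |α|)) (by positivity) (h α hα)
  rwa [integral_add_left_eq_self (fun y => ‖q y‖) α] at this

open BoundedContinuousFunction in
/-- The Goursat integral equation has a continuous solution on the plane. -/
theorem exists_goursat {q : ℝ → ℂ} (hq : Integrable q) :
    ∃ H : ℝ × ℝ → ℂ, Continuous H ∧
      ∀ p : ℝ × ℝ, H p = (1 / 2) * (∫ s in (0 : ℝ)..p.1, q s) + goursatIntegral q H p := by
  -- in terms of `G = exp(-l|u|) H`, a solution is a fixed point of a contraction `F` of the space
  -- of bounded continuous functions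
  set l := weight q with hl
  have hw : Continuous fun p : ℝ × ℝ => (Real.exp (l * |p.1|) : ℂ) := by fun_prop
  have hw' : Continuous fun p : ℝ × ℝ => (Real.exp (-(l * |p.1|)) : ℂ) := by fun_prop
  have hQ : Continuous fun p : ℝ × ℝ => ∫ s in (0 : ℝ)..p.1, q s :=
    (continuous_primitive_of_locallyIntegrable hq.locallyIntegrable).comp continuous_fst
  have hG (G : ℝ × ℝ →ᵇ ℂ) : Continuous fun p : ℝ × ℝ => (Real.exp (l * |p.1|) : ℂ) * G p :=
    hw.mul G.continuous
  have hbd (G : ℝ × ℝ →ᵇ ℂ) (p : ℝ × ℝ) :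
      ‖goursatIntegral q (fun p => (Real.exp (l * |p.1|) : ℂ) * G p) p‖
        ≤ ‖G‖ / 2 * Real.exp (l * |p.1|) := by
    refine norm_goursatIntegral_le hq (norm_nonneg G) fun α _ β _ => ?_
    rw [norm_mul, Complex.norm_real, Real.norm_of_nonneg (Real.exp_pos _).le, mul_comm]
    exact mul_le_mul_of_nonneg_right (G.norm_coe_le_norm _) (Real.exp_pos _).le
  have hexp (p : ℝ × ℝ) (z : ℂ) (M : ℝ) (hz : ‖z‖ ≤ M * Real.exp (l * |p.1|)) :
      ‖(Real.exp (-(l * |p.1|)) : ℂ) * z‖ ≤ M := by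
    rw [norm_mul, Complex.norm_real, Real.norm_of_nonneg (Real.exp_pos _).le]
    calc Real.exp (-(l * |p.1|)) * ‖z‖
        ≤ Real.exp (-(l * |p.1|)) * (M * Real.exp (l * |p.1|)) := by gcongr
      _ = M * (Real.exp (-(l * |p.1|)) * Real.exp (l * |p.1|)) := by ring
      _ = M := by rw [← Real.exp_add]; simp
  have hone (p : ℝ × ℝ) : 1 ≤ Real.exp (l * |p.1|) :=
    Real.one_le_exp (mul_nonneg (weight_pos q).le (abs_nonneg _))
  let F : (ℝ × ℝ →ᵇ ℂ) → (ℝ × ℝ →ᵇ ℂ) := fun G =>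
    BoundedContinuousFunction.ofNormedAddCommGroup
      (fun p => (Real.exp (-(l * |p.1|)) : ℂ) * ((1 / 2) * (∫ s in (0 : ℝ)..p.1, q s)
        + goursatIntegral q (fun p => (Real.exp (l * |p.1|) : ℂ) * G p) p))
      (hw'.mul ((continuous_const.mul hQ).add (continuous_goursatIntegral hq (hG G))))
      (1 / 2 * (∫ y, ‖q y‖) + ‖G‖ / 2) (fun p => by
        refine hexp p _ _ ((norm_add_le _ _).trans ?_)
        rw [add_mul]
        refine add_le_add ?_ (hbd G p)
        have h1 : ‖∫ s in (0 : ℝ)..p.1, q s‖ ≤ ∫ y, ‖q y‖ := by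
          simpa using norm_intervalIntegral_mul_le hq (b := 0) (c := p.1) (g := fun _ => 1)
            zero_le_one (by simp)
        have h0 : 0 ≤ ∫ y, ‖q y‖ := integral_nonneg fun _ => norm_nonneg _
        rw [norm_mul]
        norm_num
        nlinarith [hone p])
  have hF : ContractingWith (1 / 2) F := by
    refine ⟨by norm_num, LipschitzWith.of_dist_le_mul fun G₁ G₂ => ?_⟩
    rw [BoundedContinuousFunction.dist_le (by positivity)]
    intro p
    have e : F G₁ p - F G₂ p = (Real.exp (-(l * |p.1|)) : ℂ)
        * goursatIntegral q (fun p => (Real.exp (l * |p.1|) : ℂ) * (G₁ - G₂) p) p := by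
      have h1 : (fun p => (Real.exp (l * |p.1|) : ℂ) * (G₁ - G₂) p)
          = fun p => (Real.exp (l * |p.1|) : ℂ) * G₁ p - (Real.exp (l * |p.1|) : ℂ) * G₂ p := by
        ext p
        simp [mul_sub]
      rw [h1, ← goursatIntegral_sub hq (hG G₁) (hG G₂)]
      simp only [F, BoundedContinuousFunction.coe_ofNormedAddCommGroup]
      ring
    rw [dist_eq_norm, e, dist_eq_norm]
    refine (hexp p _ _ (hbd (G₁ - G₂) p)).trans (le_of_eq ?_)
    push_cast
    ring
  refine ⟨fun p => (Real.exp (l * |p.1|) : ℂ) * hF.fixedPoint F p, hG _, fun p => ?_⟩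
  have h1 : F (hF.fixedPoint F) p = hF.fixedPoint F p := by
    rw [hF.fixedPoint_isFixedPt.eq]
  beta_reduce
  rw [← h1]
  simp only [F, BoundedContinuousFunction.coe_ofNormedAddCommGroup]
  rw [← mul_assoc, ← Complex.ofReal_mul, ← Real.exp_add]
  simp

/-- If every weighted bound on a bounded quantity can be halved, the quantity is zero. -/
theorem eq_zero_of_forall_bound_half {X : Type*} {S : Set X} {f : X → ℂ} {ρ : X → ℝ}
    (hρ : ∀ p ∈ S, 1 ≤ ρ p) (hb : ∃ C, ∀ p ∈ S, ‖f p‖ ≤ C)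
    (h : ∀ M, 0 ≤ M → (∀ p ∈ S, ‖f p‖ ≤ M * ρ p) → ∀ p ∈ S, ‖f p‖ ≤ M / 2 * ρ p) :
    ∀ p ∈ S, f p = 0 := by
  obtain ⟨C, hC⟩ := hb
  have key (n : ℕ) : ∀ p ∈ S, ‖f p‖ ≤ (|C| * (1 / 2) ^ n) * ρ p := by
    induction n with
    | zero =>
      intro p hp
      have h1 := (hC p hp).trans (le_abs_self C)
      have := mul_le_mul_of_nonneg_left (hρ p hp) (abs_nonneg C)
      linarith
    | succ n ih =>
      intro p hp
      refine (h _ (by positivity) ih p hp).trans (le_of_eq ?_)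
      ring
  intro p hp
  have ht : Filter.Tendsto (fun n : ℕ => (|C| * (1 / 2) ^ n) * ρ p) Filter.atTop
      (nhds ((|C| * 0) * ρ p)) :=
    ((tendsto_pow_atTop_nhds_zero_of_lt_one (by norm_num) (by norm_num)).const_mul _).mul_const _
  have := ge_of_tendsto' ht fun n => key n p hp
  rw [mul_zero, zero_mul] at this
  exact norm_le_zero_iff.1 this

/-- The extension by zero of `q`, from the closure of `I` to the line. -/
def extend (a : ℝ) (q : ℝ → ℂ) : ℝ → ℂ := (Icc (-a) a).indicator q

theorem integrable_extend {a : ℝ} {q : ℝ → ℂ} (hq : IntegrableOn q (Ioo (-a) a)) :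
    Integrable (extend a q) :=
  (integrable_indicator_iff measurableSet_Icc).2 ((integrableOn_Icc_iff_integrableOn_Ioo).2 hq)

theorem extend_eq {a : ℝ} {q : ℝ → ℂ} {x : ℝ} (hx : |x| ≤ a) : extend a q x = q x :=
  indicator_of_mem (show x ∈ Icc (-a) a from abs_le.1 hx) q

theorem abs_le_of_mem_uIcc_zero {x y : ℝ} (h : x ∈ uIcc 0 y) : |x| ≤ |y| := by
  simpa using abs_sub_left_of_mem_uIcc h

theorem goursatIntegral_extend {a : ℝ} (q : ℝ → ℂ) (g : ℝ × ℝ → ℂ) {u v : ℝ}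
    (huv : |u| + |v| ≤ a) :
    goursatIntegral (extend a q) g (u, v)
      = ∫ α in (0 : ℝ)..u, ∫ β in (0 : ℝ)..v, q (α + β) * g (α, β) := by
  refine intervalIntegral.integral_congr fun α hα => intervalIntegral.integral_congr fun β hβ => ?_
  have h1 := abs_le_of_mem_uIcc_zero hα
  have h2 := abs_le_of_mem_uIcc_zero hβ
  rw [extend_eq ((abs_add_le α β).trans (by linarith))]

theorem isGoursatSolution_of_extend {a : ℝ} {q : ℝ → ℂ} {H : ℝ × ℝ → ℂ} (hH : Continuous H)
    (h : ∀ p : ℝ × ℝ, H p = (1 / 2) * (∫ s in (0 : ℝ)..p.1, extend a q s)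
      + goursatIntegral (extend a q) H p) :
    IsGoursatSolution a q fun u v => H (u, v) := by
  refine ⟨hH.continuousOn, fun u v huv => ?_⟩
  beta_reduce
  rw [h (u, v), goursatIntegral_extend q H huv]
  congr 2
  refine intervalIntegral.integral_congr fun s hs => ?_
  exact extend_eq ((abs_le_of_mem_uIcc_zero hs).trans (by linarith [abs_nonneg v]))

/-- The Goursat integral equation has at most one solution on the square `|u| + |v| ≤ a`. -/
theorem IsGoursatSolution.unique {a : ℝ} {q : ℝ → ℂ} (hq : IntegrableOn q (Ioo (-a) a))
    {H H' : ℝ → ℝ → ℂ} (h : IsGoursatSolution a q H) (h' : IsGoursatSolution a q H') {u v : ℝ}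
    (huv : |u| + |v| ≤ a) : H u v = H' u v := by
  have hq' := integrable_extend hq
  set D : Set (ℝ × ℝ) := {p | |p.1| + |p.2| ≤ a} with hD
  have hDc : IsCompact D := by
    refine ((isCompact_Icc (a := -a) (b := a)).prod
      (isCompact_Icc (a := -a) (b := a))).of_isClosed_subset
      (isClosed_le (by fun_prop) continuous_const) fun p hp => ?_
    have hp' : |p.1| + |p.2| ≤ a := hp
    exact ⟨abs_le.1 (by linarith [abs_nonneg p.2]), abs_le.1 (by linarith [abs_nonneg p.1])⟩
  have hmem {p : ℝ × ℝ} (hp : p ∈ D) {α β : ℝ} (hα : α ∈ uIcc 0 p.1) (hβ : β ∈ uIcc 0 p.2) :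
      (α, β) ∈ D := by
    have hp' : |p.1| + |p.2| ≤ a := hp
    have h1 := abs_le_of_mem_uIcc_zero hα
    have h2 := abs_le_of_mem_uIcc_zero hβ
    show |α| + |β| ≤ a
    linarith
  -- a solution on the square is extended to a continuous function on the plane
  have hext (K : ℝ → ℝ → ℂ) (hK : IsGoursatSolution a q K) : ∃ g : ℝ × ℝ → ℂ, Continuous g ∧
      (∀ p ∈ D, g p = K p.1 p.2) ∧ ∀ p ∈ D, g p = (1 / 2) * (∫ s in (0 : ℝ)..p.1, q s)
        + goursatIntegral (extend a q) g p := by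
    obtain ⟨g, hg⟩ := ContinuousMap.exists_restrict_eq hDc.isClosed
      (⟨D.domRestrict fun p => K p.1 p.2, hK.1.domRestrict⟩ : C(D, ℂ))
    have hgK : ∀ p ∈ D, g p = K p.1 p.2 := fun p hp => DFunLike.congr_fun hg ⟨p, hp⟩
    refine ⟨g, g.continuous, hgK, fun p hp => ?_⟩
    rw [hgK p hp, hK.2 p.1 p.2 hp, ← Prod.mk.eta (p := p), goursatIntegral_extend q g hp]
    congr 1
    refine intervalIntegral.integral_congr fun α hα =>
      intervalIntegral.integral_congr fun β hβ => ?_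
    rw [hgK _ (hmem hp hα hβ)]
  obtain ⟨g, hg, hgH, hge⟩ := hext H h
  obtain ⟨g', hg', hgH', hge'⟩ := hext H' h'
  have key := eq_zero_of_forall_bound_half (S := D) (f := fun p => g p - g' p)
    (ρ := fun p => Real.exp (weight (extend a q) * |p.1|))
    (fun p _ => Real.one_le_exp (mul_nonneg (weight_pos _).le (abs_nonneg _)))
    (hDc.exists_bound_of_continuousOn (hg.sub hg').continuousOn) (fun M hM hle p hp => by
      rw [hge p hp, hge' p hp, add_sub_add_left_eq_sub, goursatIntegral_sub hq' hg hg']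
      exact norm_goursatIntegral_le hq' hM fun α hα β hβ =>
        hle _ (hmem hp (uIoc_subset_uIcc hα) (uIoc_subset_uIcc hβ)))
  have := key (u, v) huv
  rw [hgH _ huv, hgH' _ huv] at this
  exact sub_eq_zero.1 this

/-- The homogeneous Cauchy problem `y'' = q y`, `y(0) = y'(0) = 0` has only the zero solution. -/
theorem eq_zero_of_eq_primitive_primitive {a : ℝ} {q : ℝ → ℂ} (hq : Integrable q) {y : ℝ → ℂ}
    (hy : Continuous y)
    (h : ∀ x ∈ Ioo (-a) a, y x = ∫ t in (0 : ℝ)..x, ∫ s in (0 : ℝ)..t, q s * y s) :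
    ∀ x ∈ Ioo (-a) a, y x = 0 := by
  have hbd : ∃ C, ∀ x ∈ Ioo (-a) a, ‖y x‖ ≤ C := by
    obtain ⟨C, hC⟩ := (isCompact_Icc (a := -a) (b := a)).exists_bound_of_continuousOn hy.continuousOn
    exact ⟨C, fun x hx => hC x (Ioo_subset_Icc_self hx)⟩
  refine eq_zero_of_forall_bound_half (ρ := fun x => Real.exp (weight q * |x|))
    (fun p _ => Real.one_le_exp (mul_nonneg (weight_pos _).le (abs_nonneg _))) hbd
    fun M hM hle x hx => ?_
  rw [h x hx]
  refine norm_iteratedIntegral_le hM fun t ht => norm_intervalIntegral_mul_le hq (by positivity)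
    fun s hs => ?_
  have h1 := abs_le_of_mem_uIcc_zero (uIoc_subset_uIcc ht)
  have h2 := abs_le_of_mem_uIcc_zero (uIoc_subset_uIcc hs)
  refine (hle s (abs_lt.1 ((h2.trans h1).trans_lt (abs_lt.2 hx)))).trans ?_
  gcongr
  exact (weight_pos q).le

/-! ### Superpositions of elementary kernels -/

/-- The integral operator `w ↦ ∫_{-x}^{x} K(x,t) w(t) dt` on functions on the line. -/
def volterra (K : ℝ → ℝ → ℂ) (w : ℝ → ℂ) (x : ℝ) : ℂ := ∫ t in (-x)..x, K x t * w t

theorem setIntegral_Icc_indicator_Icc {f : ℝ → ℂ} {b c d e : ℝ} (h1 : b ≤ c) (h2 : d ≤ e) :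
    ∫ t in Icc b e, (Icc c d).indicator f t = if c ≤ d then ∫ t in c..d, f t else 0 := by
  rw [setIntegral_indicator measurableSet_Icc, Icc_inter_Icc, sup_eq_right.2 h1, inf_eq_right.2 h2]
  split_ifs with h
  · rw [intervalIntegral.integral_of_le h, integral_Icc_eq_integral_Ioc]
  · rw [Icc_eq_empty h, Measure.restrict_empty, integral_zero_measure]

/-- The identity `(Lk)'' = k''` for the elementary kernel `1[α ≤ (x+t)/2] 1[β ≤ (x-t)/2]`, in
integrated form. Here `W' = w` and `w' = w₁`. -/
theorem elementary_identity {W w w₁ : ℝ → ℂ} (hW : ∀ y, HasDerivAt W (w y) y)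
    (hw : ∀ y, HasDerivAt w (w₁ y) y) (hw₁ : Continuous w₁) (α β x : ℝ) :
    W (x - 2 * β) - W (2 * α - x)
      = (∫ y in (α + β)..x, ((x : ℂ) - y) * (w₁ (y - 2 * β) - w₁ (2 * α - y)))
        + 2 * ((x : ℂ) - (α + β : ℝ)) * w (α - β) := by
  have hd (y : ℝ) : HasDerivAt (fun y : ℝ => ((x : ℂ) - y) * (w (y - 2 * β) + w (2 * α - y))
      + (W (y - 2 * β) - W (2 * α - y)))
      (((x : ℂ) - y) * (w₁ (y - 2 * β) - w₁ (2 * α - y))) y := by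
    have h1 : HasDerivAt (fun y : ℝ => (x : ℂ) - y) (-1) y := by
      simpa using (hasDerivAt_id (y : ℂ)).comp_ofReal.const_sub (x : ℂ)
    have h := (h1.mul (((hw (y - 2 * β)).comp_sub_const y _).add
      ((hw (2 * α - y)).comp_const_sub _ y))).add
      (((hW (y - 2 * β)).comp_sub_const y _).sub ((hW (2 * α - y)).comp_const_sub _ y))
    refine h.congr_deriv ?_
    simp only [Pi.add_apply]
    ring
  rw [intervalIntegral.integral_eq_sub_of_hasDerivAt (fun y _ => hd y)
    (Continuous.intervalIntegrable (by fun_prop) _ _)]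
  have e1 : α + β - 2 * β = α - β := by ring
  have e2 : 2 * α - (α + β) = α - β := by ring
  rw [e1, e2]
  ring

section Superposition

variable {Ω : Type*} [MeasurableSpace Ω] {m : Measure Ω} [SFinite m] {A B : Ω → ℝ} {n : Ω → ℂ}

/-- The integral operator whose kernel is a superposition of elementary kernels, acting on an
integrable function with primitive `W`. -/
theorem integral_superposition (hA : Measurable A) (hB : Measurable B)
    (hpos : ∀ᵐ o ∂m, 0 ≤ A o ∧ 0 ≤ B o) (hn : Integrable n m) {w W : ℝ → ℂ}
    (hw : LocallyIntegrable w) (hW : ∀ b c, ∫ t in b..c, w t = W c - W b) {x : ℝ} (hx : 0 ≤ x) :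
    ∫ t in (-x)..x, (∫ o, {o | A o ≤ (x + t) / 2 ∧ B o ≤ (x - t) / 2}.indicator n o ∂m) * w t
      = ∫ o, n o * (if A o + B o ≤ x then W (x - 2 * B o) - W (2 * A o - x) else 0) ∂m := by
  have hS₁ : MeasurableSet {z : ℝ × Ω | A z.2 ≤ (x + z.1) / 2} :=
    measurableSet_le (by fun_prop) (by fun_prop)
  have hS₂ : MeasurableSet {z : ℝ × Ω | B z.2 ≤ (x - z.1) / 2} :=
    measurableSet_le (by fun_prop) (by fun_prop)
  have hS : MeasurableSet {z : ℝ × Ω | A z.2 ≤ (x + z.1) / 2 ∧ B z.2 ≤ (x - z.1) / 2} :=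
    hS₁.inter hS₂
  have hwi : Integrable w (volume.restrict (Icc (-x) x)) :=
    hw.integrableOn_isCompact isCompact_Icc
  have hint := (hwi.mul_prod hn).indicator hS
  rw [intervalIntegral.integral_of_le (by linarith), ← integral_Icc_eq_integral_Ioc]
  have e1 : ∫ t in Icc (-x) x,
      (∫ o, {o | A o ≤ (x + t) / 2 ∧ B o ≤ (x - t) / 2}.indicator n o ∂m) * w t
      = ∫ t in Icc (-x) x, ∫ o, {z : ℝ × Ω | A z.2 ≤ (x + z.1) / 2 ∧ B z.2 ≤ (x - z.1) / 2}.indicator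
          (fun z => w z.1 * n z.2) (t, o) ∂m := by
    congr 1 with t
    rw [← integral_mul_const]
    congr 1 with o
    by_cases h : A o ≤ (x + t) / 2 ∧ B o ≤ (x - t) / 2
    · simp [indicator, h, mul_comm]
    · simp [indicator, h]
  rw [e1, integral_integral_swap (f := fun t o =>
    {z : ℝ × Ω | A z.2 ≤ (x + z.1) / 2 ∧ B z.2 ≤ (x - z.1) / 2}.indicator
      (fun z => w z.1 * n z.2) (t, o)) hint]
  refine integral_congr_ae ?_
  filter_upwards [hpos] with o ho
  have e2 : ∀ t, {z : ℝ × Ω | A z.2 ≤ (x + z.1) / 2 ∧ B z.2 ≤ (x - z.1) / 2}.indicator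
      (fun z => w z.1 * n z.2) (t, o)
      = n o * (Icc (2 * A o - x) (x - 2 * B o)).indicator w t := by
    intro t
    have h : (A o ≤ (x + t) / 2 ∧ B o ≤ (x - t) / 2) ↔ t ∈ Icc (2 * A o - x) (x - 2 * B o) := by
      constructor
      · rintro ⟨h1, h2⟩; constructor <;> linarith
      · rintro ⟨h1, h2⟩; constructor <;> linarith
    by_cases h' : t ∈ Icc (2 * A o - x) (x - 2 * B o)
    · rw [indicator_of_mem (show (t, o) ∈ _ from h.2 h'), indicator_of_mem h', mul_comm]
    · rw [indicator_of_notMem (show (t, o) ∉ _ from fun h'' => h' (h.1 h'')),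
        indicator_of_notMem h', mul_zero]
  simp only [e2]
  rw [integral_const_mul, setIntegral_Icc_indicator_Icc (by linarith [ho.1]) (by linarith [ho.2])]
  congr 1
  have h : (2 * A o - x ≤ x - 2 * B o) ↔ (A o + B o ≤ x) := by
    constructor <;> intro h <;> linarith
  simp only [h, hW]

/-- The transmutation identity for a superposition `h` of elementary kernels, from
`elementary_identity` by Fubini's theorem. Here `g = w₁'`, `w₁ = w'` and `w = W'`. The last term
becomes the potential term `q 𝐓w` when `h` solves the Goursat equation. -/
theorem superposition_identity (hA : Measurable A) (hB : Measurable B)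
    (hpos : ∀ᵐ o ∂m, 0 ≤ A o ∧ 0 ≤ B o) (hn : Integrable n m) {x : ℝ} (hx : 0 ≤ x)
    {h : ℝ → ℝ → ℂ} (hh : ∀ u v, 0 ≤ u → 0 ≤ v → u + v ≤ x →
      h u v = ∫ o, {o | A o ≤ u ∧ B o ≤ v}.indicator n o ∂m)
    {g w w₁ W : ℝ → ℂ} (hg : Integrable g)
    (hw₁ : ∀ b c, ∫ t in b..c, g t = w₁ c - w₁ b) (hw₁c : Continuous w₁)
    (hw : ∀ y, HasDerivAt w (w₁ y) y) (hW : ∀ y, HasDerivAt W (w y) y) :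
    IntervalIntegrable (fun y : ℝ => ((x : ℂ) - y) * volterra (kernel h) g y) volume 0 x ∧
    volterra (kernel h) w x = (∫ y in (0 : ℝ)..x, ((x : ℂ) - y) * volterra (kernel h) g y)
      + ∫ o, n o * (if A o + B o ≤ x then
          2 * ((x : ℂ) - (A o + B o : ℝ)) * w (A o - B o) else 0) ∂m := by
  have hwc : Continuous w := continuous_iff_continuousAt.2 fun y => (hw y).continuousAt
  have hWc : Continuous W := continuous_iff_continuousAt.2 fun y => (hW y).continuousAt
  -- both Volterra integrals as integrals over `Ω`
  have hv {f F : ℝ → ℂ} (hf : LocallyIntegrable f) (hF : ∀ b c, ∫ t in b..c, f t = F c - F b)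
      {y : ℝ} (hy : y ∈ Icc 0 x) : volterra (kernel h) f y
        = ∫ o, n o * (if A o + B o ≤ y then F (y - 2 * B o) - F (2 * A o - y) else 0) ∂m := by
    rw [← integral_superposition hA hB hpos hn hf hF hy.1, volterra]
    refine intervalIntegral.integral_congr fun t ht => ?_
    rw [uIcc_of_le (by linarith [hy.1])] at ht
    rw [kernel, hh _ _ (by linarith [ht.1]) (by linarith [ht.2]) (by linarith [hy.2])]
  have hWw : ∀ b c, ∫ t in b..c, w t = W c - W b := fun b c =>
    intervalIntegral.integral_eq_sub_of_hasDerivAt (fun y _ => hW y) (hwc.intervalIntegrable _ _)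
  -- the integrand of the double integral, over `y ∈ [0, x]` and `o`
  let Φ : ℝ × Ω → ℂ := {z : ℝ × Ω | A z.2 + B z.2 ≤ z.1}.indicator fun z =>
    (1 * n z.2) * (((x : ℂ) - z.1) * (w₁ (z.1 - 2 * B z.2) - w₁ (2 * A z.2 - z.1)))
  have hS : MeasurableSet {z : ℝ × Ω | A z.2 + B z.2 ≤ z.1} :=
    measurableSet_le (by fun_prop) (by fun_prop)
  have hgi : ∀ c, ‖w₁ c‖ ≤ ‖w₁ 0‖ + ∫ t, ‖g t‖ := by
    intro c
    have h1 := norm_intervalIntegral_mul_le hg (b := 0) (c := c) (g := fun _ => 1) zero_le_one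
      (by simp)
    simp only [mul_one, hw₁] at h1
    calc ‖w₁ c‖ = ‖w₁ 0 + (w₁ c - w₁ 0)‖ := by congr 1; ring
      _ ≤ _ := (norm_add_le _ _).trans (by linarith)
  have hΦ : Integrable Φ ((volume.restrict (Icc 0 x)).prod m) := by
    have h1 : Integrable (fun _ : ℝ => (1 : ℂ)) (volume.restrict (Icc 0 x)) :=
      integrableOn_const (by simp)
    have h2 : Integrable (fun z : ℝ × Ω => ((1 : ℂ) * n z.2)
        * (((x : ℂ) - z.1) * (w₁ (z.1 - 2 * B z.2) - w₁ (2 * A z.2 - z.1))))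
        ((volume.restrict (Icc 0 x)).prod m) := by
      refine (h1.mul_prod hn).mul_bdd (c := x * (2 * (‖w₁ 0‖ + ∫ t, ‖g t‖))) ?_ ?_
      · refine Measurable.aestronglyMeasurable ?_
        have := hw₁c.measurable
        fun_prop
      · have h3 : ∀ᵐ z : ℝ × Ω ∂((volume.restrict (Icc 0 x)).prod m), z.1 ∈ Icc 0 x :=
          Measure.quasiMeasurePreserving_fst.ae (ae_restrict_mem measurableSet_Icc)
        filter_upwards [h3] with z hz
        rw [norm_mul]
        refine mul_le_mul ?_ ?_ (norm_nonneg _) hx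
        · rw [← Complex.ofReal_sub, Complex.norm_real, Real.norm_of_nonneg (by linarith [hz.2])]
          linarith [hz.1]
        · refine (norm_sub_le _ _).trans ?_
          linarith [hgi (z.1 - 2 * B z.2), hgi (2 * A z.2 - z.1)]
    exact h2.indicator hS
  have hΦ1 : ∀ y ∈ Icc 0 x, ∫ o, Φ (y, o) ∂m = ((x : ℂ) - y) * volterra (kernel h) g y := by
    intro y hy
    rw [hv hg.locallyIntegrable hw₁ hy, ← integral_const_mul]
    congr 1 with o
    by_cases h' : A o + B o ≤ y
    · simp only [Φ, indicator, mem_ofPred_eq, h', if_true]; ring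
    · simp only [Φ, indicator, mem_ofPred_eq, h', if_false]; ring
  have hΦ2 : ∀ᵐ o ∂m, ∫ y in Icc 0 x, Φ (y, o) = n o * (if A o + B o ≤ x then
      ∫ y in (A o + B o)..x, ((x : ℂ) - y) * (w₁ (y - 2 * B o) - w₁ (2 * A o - y)) else 0) := by
    filter_upwards [hpos] with o ho
    rw [← setIntegral_Icc_indicator_Icc (b := 0) (by linarith [ho.1, ho.2]) (le_refl x), ← integral_const_mul]
    refine setIntegral_congr_fun measurableSet_Icc fun y hy => ?_
    by_cases h' : A o + B o ≤ y
    · have h'' : y ∈ Icc (A o + B o) x := ⟨h', hy.2⟩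
      simp only [Φ, indicator, mem_ofPred_eq, h', h'', if_true]; ring
    · have h'' : y ∉ Icc (A o + B o) x := fun h'' => h' h''.1
      simp only [Φ, indicator, mem_ofPred_eq, h', h'', if_false]; ring
  refine ⟨?_, ?_⟩
  · rw [intervalIntegrable_iff, uIoc_of_le hx]
    refine IntegrableOn.mono_set ?_ Ioc_subset_Icc_self
    refine hΦ.integral_prod_left.congr ?_
    filter_upwards [ae_restrict_mem measurableSet_Icc] with y hy
    exact hΦ1 y hy
  rw [hv hwc.locallyIntegrable hWw ⟨hx, le_rfl⟩, intervalIntegral.integral_of_le hx,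
    ← integral_Icc_eq_integral_Ioc,
    ← setIntegral_congr_fun measurableSet_Icc hΦ1, integral_integral_swap (f := fun y o => Φ (y, o)) hΦ,
    ← integral_add]
  · refine integral_congr_ae ?_
    filter_upwards [hΦ2] with o ho
    rw [ho, ← mul_add]
    congr 1
    split_ifs with h'
    · exact elementary_identity hW hw hw₁c _ _ _
    · rw [add_zero]
  · exact hΦ.integral_prod_right
  · obtain ⟨C, hC⟩ := (isCompact_Icc (a := -x) (b := x)).exists_bound_of_continuousOn
      hwc.continuousOn
    refine hn.mul_bdd (c := 2 * x * |C|) ?_ ?_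
    · refine (Measurable.ite (measurableSet_le (by fun_prop) (by fun_prop)) ?_
        measurable_const).aestronglyMeasurable
      have := hwc.measurable
      fun_prop
    · filter_upwards [hpos] with o ho
      split_ifs with h'
      · rw [norm_mul, norm_mul, Complex.norm_ofNat, ← Complex.ofReal_sub, Complex.norm_real,
          Real.norm_of_nonneg (by linarith)]
        refine mul_le_mul (by linarith [ho.1, ho.2]) ((hC _ ?_).trans (le_abs_self C))
          (norm_nonneg _) (by linarith)
        constructor <;> linarith [ho.1, ho.2]
      · rw [norm_zero]; positivity

end Superposition

/-! ### The transmutation identity for the Goursat kernel -/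

theorem continuous_volterra {K : ℝ → ℝ → ℂ} (hK : Continuous fun p : ℝ × ℝ => K p.1 p.2)
    {w : ℝ → ℂ} (hw : LocallyIntegrable w) : Continuous (volterra K w) := by
  have h := continuous_integral_mul hw hK
  have e : volterra K w = fun x => (∫ t in (0 : ℝ)..x, w t * K x t)
      - ∫ t in (0 : ℝ)..(-x), w t * K x t := by
    ext x
    have hi (b c : ℝ) : IntervalIntegrable (fun t => w t * K x t) volume b c :=
      (intervalIntegrable_of_locallyIntegrable hw b c).mul_continuousOn
        (hK.comp (by fun_prop : Continuous fun t : ℝ => (x, t))).continuousOn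
    rw [intervalIntegral.integral_interval_sub_left (hi _ _) (hi _ _), volterra]
    simp only [mul_comm]
  rw [e]
  exact (h.comp (by fun_prop : Continuous fun x : ℝ => (x, x))).sub
    (h.comp (by fun_prop : Continuous fun x : ℝ => (x, -x)))

theorem volterra_add_kernel {K K' : ℝ → ℝ → ℂ} (hK : Continuous fun p : ℝ × ℝ => K p.1 p.2)
    (hK' : Continuous fun p : ℝ × ℝ => K' p.1 p.2) {w : ℝ → ℂ} (hw : LocallyIntegrable w) (x : ℝ) :
    volterra (fun x t => K x t + K' x t) w x = volterra K w x + volterra K' w x := by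
  have hi {K : ℝ → ℝ → ℂ} (hK : Continuous fun p : ℝ × ℝ => K p.1 p.2) :
      IntervalIntegrable (fun t => K x t * w t) volume (-x) x :=
    (intervalIntegrable_of_locallyIntegrable hw _ _).continuousOn_mul
      (hK.comp (by fun_prop : Continuous fun t : ℝ => (x, t))).continuousOn
  rw [volterra, volterra, volterra, ← intervalIntegral.integral_add (hi hK) (hi hK')]
  simp only [add_mul]

theorem continuous_kernel {H : ℝ × ℝ → ℂ} (hH : Continuous H) :
    Continuous fun p : ℝ × ℝ => kernel (fun u v => H (u, v)) p.1 p.2 :=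
  hH.comp (by fun_prop : Continuous fun p : ℝ × ℝ => ((p.1 + p.2) / 2, (p.1 - p.2) / 2))

/-- The first term of the Goursat equation as a superposition of elementary kernels. -/
theorem half_primitive_eq_integral_indicator {q : ℝ → ℂ} {u v : ℝ} (hu : 0 ≤ u) (hv : 0 ≤ v) :
    (1 / 2) * (∫ s in (0 : ℝ)..u, q s)
      = ∫ s in Ici (0 : ℝ), {s : ℝ | s ≤ u ∧ (fun _ => (0 : ℝ)) s ≤ v}.indicator
          (fun s => (1 / 2) * q s) s := by
  have e : {s : ℝ | s ≤ u ∧ (fun _ => (0 : ℝ)) s ≤ v} = Iic u := by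
    ext s; simp [hv]
  rw [e, setIntegral_indicator measurableSet_Iic, Ici_inter_Iic, integral_const_mul,
    integral_Icc_eq_integral_Ioc, intervalIntegral.integral_of_le hu]

/-- The triangle `0 ≤ α ≤ y ≤ x`. -/
def triangle (x : ℝ) : Set (ℝ × ℝ) := {p | 0 ≤ p.1 ∧ p.1 ≤ p.2 ∧ p.2 ≤ x}

theorem isClosed_triangle (x : ℝ) : IsClosed (triangle x) :=
  (isClosed_le continuous_const continuous_fst).inter
    ((isClosed_le continuous_fst continuous_snd).inter (isClosed_le continuous_snd continuous_const))

theorem triangle_subset (x : ℝ) : triangle x ⊆ Icc 0 x ×ˢ Icc 0 x :=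
  fun _ hp => ⟨⟨hp.1, hp.2.1.trans hp.2.2⟩, ⟨hp.1.trans hp.2.1, hp.2.2⟩⟩

theorem integrableOn_triangle {q : ℝ → ℂ} (hq : LocallyIntegrable q) {f : ℝ × ℝ → ℂ}
    (hf : Continuous f) (x : ℝ) :
    IntegrableOn (fun p : ℝ × ℝ => q p.2 * f p) (triangle x) := by
  have h1 : Integrable (fun p : ℝ × ℝ => (1 : ℂ) * q p.2)
      ((volume.restrict (Icc 0 x)).prod (volume.restrict (Icc 0 x))) :=
    Integrable.mul_prod (integrable_const (1 : ℂ)) (hq.integrableOn_isCompact isCompact_Icc)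
  rw [Measure.prod_restrict] at h1
  simp only [one_mul] at h1
  have hc : IsCompact (Icc 0 x ×ˢ Icc 0 x) := isCompact_Icc.prod isCompact_Icc
  obtain ⟨C, hC⟩ := hc.exists_bound_of_continuousOn hf.continuousOn
  refine IntegrableOn.mono_set (h1.mul_bdd (c := C) hf.aestronglyMeasurable ?_) (triangle_subset x)
  filter_upwards [ae_restrict_mem hc.measurableSet] with p hp
  exact hC p hp

/-- The second term of the Goursat equation as a superposition of elementary kernels, after the
substitution `y = α + β`. -/
theorem goursatIntegral_eq_integral_indicator {q : ℝ → ℂ} (hq : Integrable q) {H : ℝ × ℝ → ℂ}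
    (hH : Continuous H) {u v x : ℝ} (hu : 0 ≤ u) (hv : 0 ≤ v) (hx : u + v ≤ x) :
    goursatIntegral q H (u, v) = ∫ p in triangle x, {p : ℝ × ℝ | p.1 ≤ u ∧ p.2 - p.1 ≤ v}.indicator
      (fun p => q p.2 * H (p.1, p.2 - p.1)) p := by
  have hm : MeasurableSet {p : ℝ × ℝ | p.1 ≤ u ∧ p.2 - p.1 ≤ v} :=
    ((isClosed_le continuous_fst continuous_const).inter
      (isClosed_le (continuous_snd.sub continuous_fst) continuous_const)).measurableSet
  have hi := (integrableOn_triangle hq.locallyIntegrable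
    (f := fun p => H (p.1, p.2 - p.1)) (by fun_prop) x).indicator hm
  rw [← integrable_indicator_iff (isClosed_triangle x).measurableSet] at hi
  rw [← integral_indicator (isClosed_triangle x).measurableSet, Measure.volume_eq_prod,
    integral_prod _ hi]
  have e (α : ℝ) : ∫ y, (triangle x).indicator ({p : ℝ × ℝ | p.1 ≤ u ∧ p.2 - p.1 ≤ v}.indicator
      (fun p => q p.2 * H (p.1, p.2 - p.1))) (α, y)
      = (Icc 0 u).indicator (fun α => ∫ β in (0 : ℝ)..v, q (α + β) * H (α, β)) α := by
    by_cases hα : α ∈ Icc 0 u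
    · rw [indicator_of_mem hα]
      have h1 := intervalIntegral.integral_comp_add_left
        (fun y => q y * H (α, y - α)) α (a := 0) (b := v)
      simp only [add_sub_cancel_left, add_zero] at h1
      rw [h1, intervalIntegral.integral_of_le (by linarith), ← integral_Icc_eq_integral_Ioc,
        ← integral_indicator measurableSet_Icc]
      congr 1 with y
      by_cases hy : y ∈ Icc α (α + v)
      · rw [indicator_of_mem hy, indicator_of_mem, indicator_of_mem]
        · exact ⟨hα.2, by linarith [hy.2]⟩
        · exact ⟨hα.1, hy.1, by linarith [hy.2, hα.2]⟩
      · rw [indicator_of_notMem hy]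
        by_cases ht : (α, y) ∈ triangle x
        · rw [indicator_of_mem ht, indicator_of_notMem]
          exact fun h => hy ⟨ht.2.1, by have : y - α ≤ v := h.2; linarith⟩
        · rw [indicator_of_notMem ht]
    · rw [indicator_of_notMem hα]
      refine integral_eq_zero_of_ae (Filter.Eventually.of_forall fun y => ?_)
      beta_reduce
      by_cases ht : (α, y) ∈ triangle x
      · rw [indicator_of_mem ht, indicator_of_notMem]
        · rfl
        · exact fun h => hα ⟨ht.1, h.1⟩
      · rw [indicator_of_notMem ht]; rfl
  simp only [e]
  rw [integral_indicator measurableSet_Icc, goursatIntegral, intervalIntegral.integral_of_le hu,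
    integral_Icc_eq_integral_Ioc]

/-- Characteristic coordinates turn an integral over the triangle into the Volterra operator. -/
theorem integral_triangle_eq {q : ℝ → ℂ} (hq : Integrable q) {H : ℝ × ℝ → ℂ}
    (hH : Continuous H) {w : ℝ → ℂ} (hw : Continuous w) {x : ℝ} (hx : 0 ≤ x) :
    ∫ p in triangle x, q p.2 * (H (p.1, p.2 - p.1) * (2 * ((x : ℂ) - p.2) * w (2 * p.1 - p.2)))
      = ∫ y in (0 : ℝ)..x, ((x : ℂ) - y)
        * (q y * volterra (kernel fun u v => H (u, v)) w y) := by
  have hi := integrableOn_triangle hq.locallyIntegrable (f := fun p =>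
    H (p.1, p.2 - p.1) * (2 * ((x : ℂ) - p.2) * w (2 * p.1 - p.2))) (by fun_prop) x
  rw [← integrable_indicator_iff (isClosed_triangle x).measurableSet] at hi
  rw [← integral_indicator (isClosed_triangle x).measurableSet, Measure.volume_eq_prod,
    integral_prod_symm _ hi, intervalIntegral.integral_of_le hx, ← integral_Icc_eq_integral_Ioc,
    ← integral_indicator measurableSet_Icc]
  congr 1 with y
  by_cases hy : y ∈ Icc 0 x
  · rw [indicator_of_mem hy]
    have hv : volterra (kernel fun u v => H (u, v)) w y
        = 2 * ∫ α in (0 : ℝ)..y, H (α, y - α) * w (2 * α - y) := by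
      have h1 := intervalIntegral.smul_integral_comp_mul_sub
        (fun t => kernel (fun u v => H (u, v)) y t * w t) (2 : ℝ) y (a := 0) (b := y)
      have e1 : (2 : ℝ) * 0 - y = -y := by ring
      have e2 : 2 * y - y = y := by ring
      rw [e1, e2] at h1
      rw [volterra, ← h1, Complex.real_smul]
      congr 2
      ext α
      have e3 : (y + (2 * α - y)) / 2 = α := by ring
      have e4 : (y - (2 * α - y)) / 2 = y - α := by ring
      rw [kernel, e3, e4]
    rw [hv, intervalIntegral.integral_of_le hy.1, ← integral_Icc_eq_integral_Ioc,
      ← integral_indicator measurableSet_Icc, ← integral_const_mul, ← integral_const_mul,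
      ← integral_const_mul]
    congr 1 with α
    by_cases hα : α ∈ Icc 0 y
    · rw [indicator_of_mem hα, indicator_of_mem (show (α, y) ∈ triangle x from ⟨hα.1, hα.2, hy.2⟩)]
      ring
    · rw [indicator_of_notMem hα, indicator_of_notMem (show (α, y) ∉ triangle x from
        fun h => hα ⟨h.1, h.2.1⟩)]
      ring
  · rw [indicator_of_notMem hy]
    refine integral_eq_zero_of_ae (Filter.Eventually.of_forall fun α => ?_)
    exact indicator_of_notMem (fun h => hy ⟨h.1.trans h.2.1, h.2.2⟩) _

/-- The two terms of the Goursat equation are superpositions of elementary kernels. In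
`superposition_identity` the first contributes the potential term `q w`, the second `q Vw`. -/
theorem transmutation_identity_of_nonneg {q : ℝ → ℂ} (hq : Integrable q) {H : ℝ × ℝ → ℂ}
    (hHc : Continuous H)
    (hH : ∀ p : ℝ × ℝ, H p = (1 / 2) * (∫ s in (0 : ℝ)..p.1, q s) + goursatIntegral q H p)
    {g w w₁ : ℝ → ℂ} (hg : Integrable g) (hw₁ : ∀ b c, ∫ t in b..c, g t = w₁ c - w₁ b)
    (hw₁c : Continuous w₁) (hw : ∀ y, HasDerivAt w (w₁ y) y) {x : ℝ} (hx : 0 ≤ x) :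
    volterra (kernel fun u v => H (u, v)) w x
      = ∫ y in (0 : ℝ)..x, ((x : ℂ) - y) * (q y * (w y + volterra (kernel fun u v => H (u, v)) w y)
        + volterra (kernel fun u v => H (u, v)) g y) := by
  have hwc : Continuous w := continuous_iff_continuousAt.2 fun y => (hw y).continuousAt
  have hQc : Continuous fun p : ℝ × ℝ => (1 / 2 : ℂ) * ∫ s in (0 : ℝ)..p.1, q s :=
    continuous_const.mul ((continuous_primitive_of_locallyIntegrable hq.locallyIntegrable).comp
      continuous_fst)
  have hGc := continuous_goursatIntegral hq hHc
  set K := kernel fun u v => H (u, v) with hK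
  set K₁ := kernel fun u _ => (1 / 2) * ∫ s in (0 : ℝ)..u, q s with hK₁
  set K₂ := kernel fun u v => goursatIntegral q H (u, v) with hK₂
  have hK12 : K = fun x t => K₁ x t + K₂ x t := by
    ext x t
    rw [hK, kernel, hH]
    rfl
  have hadd {f : ℝ → ℂ} (hf : LocallyIntegrable f) (y : ℝ) :
      volterra K f y = volterra K₁ f y + volterra K₂ f y := by
    rw [hK12]
    exact volterra_add_kernel (continuous_kernel hQc) (continuous_kernel hGc) hf y
  have hWd : ∀ y, HasDerivAt (fun y => ∫ t in (0 : ℝ)..y, w t) (w y) y := fun y =>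
    (hwc.integral_hasStrictDerivAt 0 y).hasDerivAt
  obtain ⟨i₁, h₁⟩ := superposition_identity (m := volume.restrict (Ici (0 : ℝ))) (A := fun s => s)
    (B := fun _ => 0) (n := fun s => (1 / 2) * q s) measurable_id measurable_const
    ((ae_restrict_mem measurableSet_Ici).mono fun s hs => ⟨hs, le_rfl⟩)
    (hq.const_mul _).restrict hx
    (h := fun u _ => (1 / 2) * ∫ s in (0 : ℝ)..u, q s)
    (fun u v hu hv _ => half_primitive_eq_integral_indicator hu hv) hg hw₁ hw₁c hw hWd
  obtain ⟨i₂, h₂⟩ := superposition_identity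
    (m := (volume : Measure (ℝ × ℝ)).restrict (triangle x)) (A := fun p => p.1)
    (B := fun p => p.2 - p.1) (n := fun p => q p.2 * H (p.1, p.2 - p.1)) measurable_fst
    (measurable_snd.sub measurable_fst)
    ((ae_restrict_mem (isClosed_triangle x).measurableSet).mono fun p hp =>
      ⟨hp.1, sub_nonneg.2 hp.2.1⟩)
    (integrableOn_triangle hq.locallyIntegrable (by fun_prop) x) hx
    (h := fun u v => goursatIntegral q H (u, v))
    (fun u v hu hv huv => goursatIntegral_eq_integral_indicator hq hHc hu hv huv)
    hg hw₁ hw₁c hw hWd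
  have e₁ : ∫ s in Ici (0 : ℝ), (1 / 2) * q s * (if s + 0 ≤ x then
      2 * ((x : ℂ) - (s + 0 : ℝ)) * w (s - 0) else 0)
      = ∫ y in (0 : ℝ)..x, ((x : ℂ) - y) * (q y * w y) := by
    rw [intervalIntegral.integral_of_le hx, ← integral_Icc_eq_integral_Ioc, ← Ici_inter_Iic,
      ← setIntegral_indicator measurableSet_Iic]
    congr 1 with s
    by_cases hs : s ≤ x
    · simp only [add_zero, sub_zero, hs, if_true, indicator_of_mem (show s ∈ Iic x from hs)]
      ring
    · simp only [add_zero, hs, if_false, indicator_of_notMem (show s ∉ Iic x from hs), mul_zero]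
  have e₂ : ∫ p in triangle x, q p.2 * H (p.1, p.2 - p.1) * (if p.1 + (p.2 - p.1) ≤ x then
      2 * ((x : ℂ) - (p.1 + (p.2 - p.1) : ℝ)) * w (p.1 - (p.2 - p.1)) else 0)
      = ∫ y in (0 : ℝ)..x, ((x : ℂ) - y) * (q y * volterra K w y) := by
    rw [← integral_triangle_eq hq hHc hwc hx]
    refine setIntegral_congr_fun (isClosed_triangle x).measurableSet fun p hp => ?_
    have h3 : p.1 + (p.2 - p.1) = p.2 := by ring
    have h4 : p.1 - (p.2 - p.1) = 2 * p.1 - p.2 := by ring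
    simp only [h3, h4, hp.2.2, if_true]
    ring
  have hKw : Continuous (volterra K w) :=
    continuous_volterra (continuous_kernel hHc) hwc.locallyIntegrable
  have j₁ : IntervalIntegrable (fun y : ℝ => ((x : ℂ) - y) * (q y * w y)) volume 0 x :=
    (hq.intervalIntegrable.mul_continuousOn hwc.continuousOn).continuousOn_mul (by fun_prop)
  have j₂ : IntervalIntegrable (fun y : ℝ => ((x : ℂ) - y) * (q y * volterra K w y)) volume 0 x :=
    (hq.intervalIntegrable.mul_continuousOn hKw.continuousOn).continuousOn_mul (by fun_prop)
  rw [hadd hwc.locallyIntegrable, h₁, h₂, e₁, e₂]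
  have e : (fun y : ℝ => ((x : ℂ) - y) * (q y * (w y + volterra K w y) + volterra K g y))
      = fun y : ℝ => ((((x : ℂ) - y) * volterra K₁ g y + ((x : ℂ) - y) * (q y * w y))
        + (((x : ℂ) - y) * volterra K₂ g y + ((x : ℂ) - y) * (q y * volterra K w y))) := by
    ext y
    rw [hadd hg.locallyIntegrable]
    ring
  rw [e, intervalIntegral.integral_add (i₁.add j₁) (i₂.add j₂),
    intervalIntegral.integral_add i₁ j₁, intervalIntegral.integral_add i₂ j₂]

/-- Reflection of the Goursat equation: `-H(-u,-v)` solves the equation for `q(-x)`. -/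
theorem goursat_reflect {q : ℝ → ℂ} {H : ℝ × ℝ → ℂ}
    (hH : ∀ p : ℝ × ℝ, H p = (1 / 2) * (∫ s in (0 : ℝ)..p.1, q s) + goursatIntegral q H p)
    (p : ℝ × ℝ) : -H (-p) = (1 / 2) * (∫ s in (0 : ℝ)..p.1, q (-s))
      + goursatIntegral (fun s => q (-s)) (fun p => -H (-p)) p := by
  have h1 (α : ℝ) : ∫ β in (0 : ℝ)..p.2, q (-(α + β)) * -H (-(α, β))
      = ∫ β in (0 : ℝ)..(-p.2), q (-α + β) * H (-α, β) := by
    have := primitive_comp_neg (fun β => q (-α + β) * -H (-α, β)) p.2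
    simp only [mul_neg, intervalIntegral.integral_neg, neg_neg] at this ⊢
    rw [← this]
    simp only [neg_add, Prod.neg_mk]
  have h2 := primitive_comp_neg (fun α => ∫ β in (0 : ℝ)..(-p.2), q (α + β) * H (α, β)) p.1
  rw [goursatIntegral]
  simp only [h1]
  rw [h2, primitive_comp_neg, hH (-p), goursatIntegral, Prod.fst_neg, Prod.snd_neg]
  ring

/-- Reflection intertwines the Volterra operators of the kernels of `-H(-u,-v)` and of `H`. -/
theorem volterra_kernel_reflect (H : ℝ × ℝ → ℂ) (f : ℝ → ℂ) (x : ℝ) :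
    volterra (kernel fun u v => -H (-(u, v))) (fun s => f (-s)) x
      = volterra (kernel fun u v => H (u, v)) f (-x) := by
  have h := intervalIntegral.integral_comp_neg (a := -x) (b := x)
    (fun t => kernel (fun u v => H (u, v)) (-x) t * f t)
  rw [neg_neg] at h
  rw [volterra, volterra, neg_neg, intervalIntegral.integral_symm (-x) x, ← h,
    ← intervalIntegral.integral_neg]
  congr 1 with t
  have e1 : (-x + -t) / 2 = -((x + t) / 2) := by ring
  have e2 : (-x - -t) / 2 = -((x - t) / 2) := by ring
  rw [kernel, kernel, Prod.neg_mk, e1, e2, neg_mul]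

/-- The transmutation identity `(𝐓w)'' - q 𝐓w = 𝐓(w'')`, integrated twice from `0`; here `w'' = g`,
and `𝐓w = w + Vw` with the Volterra operator `V` of kernel `K`. -/
theorem transmutation_identity {q : ℝ → ℂ} (hq : Integrable q) {H : ℝ × ℝ → ℂ}
    (hHc : Continuous H)
    (hH : ∀ p : ℝ × ℝ, H p = (1 / 2) * (∫ s in (0 : ℝ)..p.1, q s) + goursatIntegral q H p)
    {g w w₁ : ℝ → ℂ} (hg : Integrable g) (hw₁ : ∀ b c, ∫ t in b..c, g t = w₁ c - w₁ b)
    (hw₁c : Continuous w₁) (hw : ∀ y, HasDerivAt w (w₁ y) y) (x : ℝ) :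
    volterra (kernel fun u v => H (u, v)) w x
      = ∫ y in (0 : ℝ)..x, ∫ s in (0 : ℝ)..y,
        (q s * (w s + volterra (kernel fun u v => H (u, v)) w s)
          + volterra (kernel fun u v => H (u, v)) g s) := by
  have hwc : Continuous w := continuous_iff_continuousAt.2 fun y => (hw y).continuousAt
  set K := kernel fun u v => H (u, v) with hK
  have hKw : Continuous (volterra K w) :=
    continuous_volterra (continuous_kernel hHc) hwc.locallyIntegrable
  have hKg : Continuous (volterra K g) :=
    continuous_volterra (continuous_kernel hHc) hg.locallyIntegrable
  have hS : LocallyIntegrable fun s => q s * (w s + volterra K w s) + volterra K g s := by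
    refine LocallyIntegrable.add ?_ hKg.locallyIntegrable
    rw [locallyIntegrable_iff]
    exact fun k hk => hq.integrableOn.mul_continuousOn (hwc.add hKw).continuousOn hk
  rw [primitive_primitive hS]
  rcases le_total 0 x with hx | hx
  · exact transmutation_identity_of_nonneg hq hHc hH hg hw₁ hw₁c hw hx
  · have h := transmutation_identity_of_nonneg (q := fun s => q (-s)) (H := fun p => -H (-p))
      (g := fun s => g (-s)) (w := fun s => w (-s)) (w₁ := fun s => -w₁ (-s)) hq.comp_neg
      (by fun_prop) (goursat_reflect hH) hg.comp_neg
      (fun b c => by rw [intervalIntegral.integral_comp_neg, hw₁]; ring) (by fun_prop)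
      (fun y => by
        have := (hw (-y)).scomp y (hasDerivAt_neg y)
        simpa [Function.comp_def] using this) (x := -x) (by linarith)
    simp only [volterra_kernel_reflect, neg_neg] at h
    rw [← hK] at h
    rw [h]
    have h' := primitive_comp_neg (fun y => (((-x : ℝ) : ℂ) + y)
      * (q y * (w y + volterra K w y) + volterra K g y)) (-x)
    rw [neg_neg, ← intervalIntegral.integral_neg] at h'
    refine Eq.trans ?_ (h'.trans ?_)
    · congr 1 with y
      push_cast
      ring
    · congr 1 with y
      push_cast
      ring

/-! ### The Volterra operator on `L¹(I)` -/

section VolterraOperator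

variable {a : ℝ}

theorem volterra_congr {K : ℝ → ℝ → ℂ} {f g : ℝ → ℂ}
    (h : f =ᵐ[volume.restrict (Ioo (-a) a)] g) {x : ℝ} (hx : x ∈ Ioo (-a) a) :
    volterra K f x = volterra K g x := by
  refine intervalIntegral.integral_congr_ae ?_
  filter_upwards [(ae_restrict_iff' measurableSet_Ioo).1 h] with s hs hm
  rw [hs]
  obtain ⟨h1, h2⟩ := hx
  rcases mem_uIoc.1 hm with ⟨h3, h4⟩ | ⟨h3, h4⟩ <;> constructor <;> linarith

theorem volterra_add {K : ℝ → ℝ → ℂ} (hK : Continuous fun p : ℝ × ℝ => K p.1 p.2) {f g : ℝ → ℂ}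
    (hf : LocallyIntegrable f) (hg : LocallyIntegrable g) (x : ℝ) :
    volterra K (f + g) x = volterra K f x + volterra K g x := by
  have hi {f : ℝ → ℂ} (hf : LocallyIntegrable f) :
      IntervalIntegrable (fun t => K x t * f t) volume (-x) x :=
    (intervalIntegrable_of_locallyIntegrable hf _ _).continuousOn_mul
      (hK.comp (by fun_prop : Continuous fun t : ℝ => (x, t))).continuousOn
  rw [volterra, volterra, volterra, ← intervalIntegral.integral_add (hi hf) (hi hg)]
  simp only [Pi.add_apply, mul_add]

theorem volterra_smul (K : ℝ → ℝ → ℂ) (c : ℂ) (f : ℝ → ℂ) (x : ℝ) :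
    volterra K (c • f) x = c * volterra K f x := by
  rw [volterra, volterra, ← intervalIntegral.integral_const_mul]
  simp only [Pi.smul_apply, smul_eq_mul, mul_left_comm]

theorem norm_volterra_ext_le {K : ℝ → ℝ → ℂ} {C : ℝ}
    (hC : ∀ x ∈ Icc (-a) a, ∀ t ∈ Icc (-a) a, ‖K x t‖ ≤ C) (hC0 : 0 ≤ C) (u : L1 a) {x : ℝ}
    (hx : x ∈ Ioo (-a) a) : ‖volterra K (ext u) x‖ ≤ C * ‖u‖ := by
  have h := norm_intervalIntegral_mul_le (integrable_ext u) (b := -x) (c := x) hC0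
    (g := fun t => K x t) (fun t ht => hC x (Ioo_subset_Icc_self hx) t (by
      obtain ⟨h1, h2⟩ := hx
      rcases mem_uIoc.1 ht with ⟨h3, h4⟩ | ⟨h3, h4⟩ <;> constructor <;> linarith))
  rw [integral_norm_ext, mul_comm] at h
  simpa only [volterra, mul_comm] using h

theorem norm_L1_le_of_ae_bound (ha : 0 < a) (u : L1 a) {C : ℝ}
    (h : ∀ᵐ x ∂(volume.restrict (Ioo (-a) a)), ‖u x‖ ≤ C) : ‖u‖ ≤ 2 * a * C := by
  rw [L1.norm_eq_integral_norm]
  refine (integral_mono_ae (L1.integrable_coeFn u).norm (integrable_const C) h).trans (le_of_eq ?_)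
  rw [integral_const, smul_eq_mul, measureReal_restrict_apply_univ, Real.volume_real_Ioo_of_le
    (by linarith)]
  ring

theorem exists_kernel_bound {K : ℝ → ℝ → ℂ} (hK : Continuous fun p : ℝ × ℝ => K p.1 p.2) (a : ℝ) :
    ∃ C, 0 ≤ C ∧ ∀ x ∈ Icc (-a) a, ∀ t ∈ Icc (-a) a, ‖K x t‖ ≤ C := by
  obtain ⟨C, hC⟩ := ((isCompact_Icc (a := -a) (b := a)).prod
    (isCompact_Icc (a := -a) (b := a))).exists_bound_of_continuousOn hK.continuousOn
  exact ⟨|C|, abs_nonneg C, fun x hx t ht => (hC (x, t) ⟨hx, ht⟩).trans (le_abs_self C)⟩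

/-- The Volterra operator `u ↦ ∫_{-x}^{x} K(x,t) u(t) dt` as a bounded operator on `L¹(I)`. -/
theorem exists_volterraCLM (ha : 0 < a) {K : ℝ → ℝ → ℂ}
    (hK : Continuous fun p : ℝ × ℝ => K p.1 p.2) :
    ∃ V : L1 a →L[ℂ] L1 a, ∀ u, V u =ᵐ[volume.restrict (Ioo (-a) a)] volterra K (ext u) := by
  have hc (u : L1 a) : MemLp (volterra K (ext u)) 1 (volume.restrict (Ioo (-a) a)) :=
    memLp_one_iff_integrable.2 (integrable_of_continuous
      (continuous_volterra hK (integrable_ext u).locallyIntegrable))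
  obtain ⟨C, hC0, hC⟩ := exists_kernel_bound hK a
  let V : L1 a →ₗ[ℂ] L1 a :=
    { toFun := fun u => (hc u).toLp _
      map_add' := fun u v => by
        refine Lp.ext ?_
        filter_upwards [(hc (u + v)).coeFn_toLp, (hc u).coeFn_toLp, (hc v).coeFn_toLp,
          Lp.coeFn_add ((hc u).toLp _) ((hc v).toLp _), ae_restrict_mem measurableSet_Ioo]
          with x h1 h2 h3 h4 hx
        rw [h1, h4, Pi.add_apply, h2, h3, ← volterra_add hK (integrable_ext u).locallyIntegrable
          (integrable_ext v).locallyIntegrable]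
        refine volterra_congr (a := a) ?_ hx
        filter_upwards [ext_ae_eq (u + v), ext_ae_eq u, ext_ae_eq v, Lp.coeFn_add u v]
          with y k1 k2 k3 k4
        rw [k1, k4, Pi.add_apply, Pi.add_apply, k2, k3]
      map_smul' := fun c u => by
        refine Lp.ext ?_
        filter_upwards [(hc (c • u)).coeFn_toLp, (hc u).coeFn_toLp,
          Lp.coeFn_smul c ((hc u).toLp _), ae_restrict_mem measurableSet_Ioo] with x h1 h2 h3 hx
        rw [h1, RingHom.id_apply, h3, Pi.smul_apply, h2, smul_eq_mul, ← volterra_smul]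
        refine volterra_congr (a := a) ?_ hx
        filter_upwards [ext_ae_eq (c • u), ext_ae_eq u, Lp.coeFn_smul c u] with y k1 k2 k3
        rw [k1, k3, Pi.smul_apply, Pi.smul_apply, k2] }
  have hV (u : L1 a) : V u =ᵐ[volume.restrict (Ioo (-a) a)] volterra K (ext u) :=
    (hc u).coeFn_toLp
  refine ⟨V.mkContinuous (2 * a * C) fun u => ?_, hV⟩
  rw [mul_assoc]
  refine norm_L1_le_of_ae_bound ha _ ?_
  filter_upwards [hV u, ae_restrict_mem measurableSet_Ioo] with x h1 hx
  rw [h1]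
  exact norm_volterra_ext_le hC hC0 u hx

/-- A Volterra operator with kernel bounded by `C` halves exponential bounds of exponent `4C + 1`. -/
theorem norm_volterra_le_of_exp_bound {K : ℝ → ℝ → ℂ} {C D : ℝ} (hC0 : 0 ≤ C)
    (hC : ∀ x ∈ Icc (-a) a, ∀ t ∈ Icc (-a) a, ‖K x t‖ ≤ C) {f : ℝ → ℂ} (hD : 0 ≤ D)
    (hf : ∀ᵐ t ∂(volume.restrict (Ioo (-a) a)), ‖f t‖ ≤ D * Real.exp ((4 * C + 1) * |t|)) {x : ℝ}
    (hx : x ∈ Ioo (-a) a) : ‖volterra K f x‖ ≤ D / 2 * Real.exp ((4 * C + 1) * |x|) := by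
  have hl : 0 < 4 * C + 1 := by linarith
  have hcont : Continuous fun t : ℝ => Real.exp ((4 * C + 1) * |t|) := by fun_prop
  have h1 : ‖volterra K f x‖
      ≤ |∫ t in (-x)..x, C * D * Real.exp ((4 * C + 1) * |t|)| := by
    refine intervalIntegral.norm_integral_le_abs_of_norm_le ?_
      ((continuous_const.mul hcont).intervalIntegrable _ _)
    rw [ae_restrict_iff' measurableSet_uIoc]
    filter_upwards [(ae_restrict_iff' measurableSet_Ioo).1 hf] with t ht hm
    have hmem : t ∈ Ioo (-a) a := by
      obtain ⟨h1, h2⟩ := hx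
      rcases mem_uIoc.1 hm with ⟨h3, h4⟩ | ⟨h3, h4⟩ <;> constructor <;> linarith
    rw [norm_mul, mul_assoc]
    exact mul_le_mul (hC x (Ioo_subset_Icc_self hx) t (Ioo_subset_Icc_self hmem)) (ht hmem)
      (norm_nonneg _) hC0
  have h2 : |∫ t in (-x)..x, Real.exp ((4 * C + 1) * |t|)|
      ≤ 2 * (Real.exp ((4 * C + 1) * |x|) / (4 * C + 1)) := by
    rw [← intervalIntegral.integral_interval_sub_left (a := 0) (hcont.intervalIntegrable _ _)
      (hcont.intervalIntegrable _ _)]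
    have h3 := abs_integral_exp_mul_abs_le hl x
    have h4 := abs_integral_exp_mul_abs_le hl (-x)
    rw [abs_neg] at h4
    exact (abs_sub _ _).trans (by linarith)
  rw [intervalIntegral.integral_const_mul, abs_mul, abs_of_nonneg (mul_nonneg hC0 hD)] at h1
  refine h1.trans ((mul_le_mul_of_nonneg_left h2 (mul_nonneg hC0 hD)).trans ?_)
  have h5 : C / (4 * C + 1) ≤ 1 / 4 := by
    rw [div_le_div_iff₀ hl (by norm_num)]; linarith
  calc C * D * (2 * (Real.exp ((4 * C + 1) * |x|) / (4 * C + 1)))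
      = C / (4 * C + 1) * (2 * D * Real.exp ((4 * C + 1) * |x|)) := by ring
    _ ≤ 1 / 4 * (2 * D * Real.exp ((4 * C + 1) * |x|)) := by gcongr
    _ = _ := by ring

/-- An operator of which some power has norm less than one differs from `-1` by a unit. -/
theorem isUnit_one_add_of_norm_pow_lt_one {R : Type*} [NormedRing R] [HasSummableGeomSeries R]
    {V : R} {n : ℕ} (h : ‖V ^ n‖ < 1) : IsUnit (1 + V) := by
  have h1 : ‖(-V) ^ n‖ < 1 := by
    rcases neg_one_pow_eq_or R n with h' | h' <;> rw [neg_pow, h'] <;> simpa using h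
  have h2 : IsUnit (1 - (-V) ^ n) := isUnit_one_sub_of_norm_lt_one h1
  rw [← mul_neg_geom_sum] at h2
  have hc : Commute (1 - -V) (∑ i ∈ Finset.range n, (-V) ^ i) :=
    (Commute.one_left _).sub_left (Commute.sum_right _ _ _ fun i _ => (Commute.refl (-V)).pow_right i)
  rw [hc.isUnit_mul_iff, sub_neg_eq_add] at h2
  exact h2.1

/-- `1 + V` is invertible on `L¹(I)`, for the Volterra operator `V` of a continuous kernel. -/
theorem exists_volterraEquiv (ha : 0 < a) {K : ℝ → ℝ → ℂ}
    (hK : Continuous fun p : ℝ × ℝ => K p.1 p.2) :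
    ∃ T : L1 a ≃L[ℂ] L1 a, IsVolterra K T := by
  obtain ⟨V, hV⟩ := exists_volterraCLM ha hK
  obtain ⟨C, hC0, hC⟩ := exists_kernel_bound hK a
  set l := 4 * C + 1 with hl
  have hpow (u : L1 a) (n : ℕ) : ∀ᵐ x ∂(volume.restrict (Ioo (-a) a)),
      ‖(V ^ (n + 1)) u x‖ ≤ C * ‖u‖ * (1 / 2) ^ n * Real.exp (l * |x|) := by
    induction n with
    | zero =>
      -- one application of `V` turns an integrable function into a bounded one
      filter_upwards [hV u, ae_restrict_mem measurableSet_Ioo] with x h1 hx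
      rw [zero_add, pow_one, h1, pow_zero, mul_one]
      refine (norm_volterra_ext_le hC hC0 u hx).trans (le_mul_of_one_le_right (by positivity) ?_)
      exact Real.one_le_exp (by positivity)
    | succ n ih =>
      filter_upwards [hV ((V ^ (n + 1)) u), ae_restrict_mem measurableSet_Ioo] with x h1 hx
      rw [pow_succ', mul_apply_eq_comp, h1, volterra_congr (ext_ae_eq _) hx]
      refine (norm_volterra_le_of_exp_bound hC0 hC (by positivity) ih hx).trans (le_of_eq ?_)
      ring
  have hnorm (n : ℕ) : ‖V ^ (n + 1)‖ ≤ 2 * a * C * Real.exp (l * a) * (1 / 2) ^ n := by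
    refine ContinuousLinearMap.opNorm_le_bound _ (by positivity) fun u => ?_
    have h : ∀ᵐ x ∂(volume.restrict (Ioo (-a) a)),
        ‖(V ^ (n + 1)) u x‖ ≤ C * ‖u‖ * (1 / 2) ^ n * Real.exp (l * a) := by
      filter_upwards [hpow u n, ae_restrict_mem measurableSet_Ioo] with x h1 hx
      refine h1.trans ?_
      have := (abs_lt.2 hx).le
      gcongr
    refine (norm_L1_le_of_ae_bound ha _ h).trans (le_of_eq ?_)
    ring
  obtain ⟨n, hn⟩ : ∃ n : ℕ, 2 * a * C * Real.exp (l * a) * (1 / 2) ^ n < 1 := by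
    have ht : Filter.Tendsto (fun n : ℕ => 2 * a * C * Real.exp (l * a) * (1 / 2) ^ n)
        Filter.atTop (nhds (2 * a * C * Real.exp (l * a) * 0)) :=
      (tendsto_pow_atTop_nhds_zero_of_lt_one (by norm_num) (by norm_num)).const_mul _
    rw [mul_zero] at ht
    exact (ht.eventually_lt_const one_pos).exists
  obtain ⟨U, hU⟩ := isUnit_one_add_of_norm_pow_lt_one ((hnorm n).trans_lt hn)
  refine ⟨ContinuousLinearEquiv.ofUnit U, fun u => ?_⟩
  have e : ContinuousLinearEquiv.ofUnit U u = u + V u := by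
    change (U : L1 a →L[ℂ] L1 a) u = u + V u
    rw [hU]
    rfl
  rw [e]
  filter_upwards [Lp.coeFn_add u (V u), hV u, ae_restrict_mem measurableSet_Ioo] with x h1 h2 hx
  rw [h1, Pi.add_apply, h2, volterra_congr (ext_ae_eq u) hx, volterra]

end VolterraOperator

/-! ### The operator `𝐓` and its inverse on `W^{2,1}(I)` -/

section CauchyProblem

variable {a : ℝ}

theorem mem_sobolev_two_iff (ha : 0 < a) {f : L1 a} : f ∈ sobolev a 2 ↔
    ∃ (c d : ℂ) (g : L1 a), f = c • power a 0 + primitive a (d • power a 0 + primitive a g) := by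
  rw [mem_sobolev_succ_iff ha]
  constructor
  · rintro ⟨c, f', hf', rfl⟩
    obtain ⟨d, g, rfl⟩ := (mem_sobolev_one_iff ha).1 hf'
    exact ⟨c, d, g, rfl⟩
  · rintro ⟨c, d, g, rfl⟩
    exact ⟨c, _, (mem_sobolev_one_iff ha).2 ⟨d, g, rfl⟩, rfl⟩

theorem eq_of_mem_sobolev_two (ha : 0 < a) {f : L1 a} (hf : f ∈ sobolev a 2) :
    f = crep f 0 • power a 0
      + primitive a (crep (wderiv f) 0 • power a 0 + primitive a (wderiv (wderiv f))) := by
  rw [← eq_crep_add_primitive_wderiv ha (wderiv_mem_sobolev hf)]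
  exact eq_crep_add_primitive_wderiv ha (sobolev_antitone a one_le_two hf)

theorem coeFn_add_primitive_add_primitive (c d : ℂ) (g : L1 a) :
    (c • power a 0 + primitive a (d • power a 0 + primitive a g) : L1 a)
      =ᵐ[volume.restrict (Ioo (-a) a)]
        fun x => c + ∫ y in (0 : ℝ)..x, (d + ∫ s in (0 : ℝ)..y, ext g s) := by
  filter_upwards [coeFn_add_primitive c (d • power a 0 + primitive a g),
    ae_restrict_mem measurableSet_Ioo] with x h1 hx
  rw [h1, primitive_congr hx ((ext_ae_eq _).trans (coeFn_add_primitive d g))]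

/-- The product of `q` with a continuous function, as an element of `L¹(I)`. -/
theorem exists_L1_mul {q : ℝ → ℂ} (hq : IntegrableOn q (Ioo (-a) a)) {z : ℝ → ℂ}
    (hz : Continuous z) :
    ∃ m : L1 a, m =ᵐ[volume.restrict (Ioo (-a) a)] fun x => q x * z x := by
  obtain ⟨C, hC⟩ := (isCompact_Icc (a := -a) (b := a)).exists_bound_of_continuousOn hz.continuousOn
  have hi : Integrable (fun x => q x * z x) (volume.restrict (Ioo (-a) a)) := by
    refine hq.mul_bdd (c := C) hz.aestronglyMeasurable ?_
    filter_upwards [ae_restrict_mem measurableSet_Ioo] with x hx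
    exact hC x (Ioo_subset_Icc_self hx)
  exact ⟨(memLp_one_iff_integrable.2 hi).toLp _, MemLp.coeFn_toLp _⟩

theorem extend_ae_eq (a : ℝ) (q : ℝ → ℂ) : extend a q =ᵐ[volume.restrict (Ioo (-a) a)] q := by
  filter_upwards [ae_restrict_mem measurableSet_Ioo] with x hx
  exact extend_eq (abs_lt.2 hx).le

/-- `v = u'' - q u` almost everywhere on `I`, for `u` in `W^{2,1}(I)`. -/
def IsStrongSolution (q : ℝ → ℂ) (u v : L1 a) : Prop :=
  u ∈ sobolev a 2 ∧
    (fun x => wderiv (wderiv u) x - q x * u x) =ᵐ[volume.restrict (Ioo (-a) a)] v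

/-- Weak solutions are in `W^{2,1}(I)`: the equation says that `q u + h` is the weak derivative of
`u'`, and `q u` is integrable because `u` is bounded. -/
theorem IsWeakSolution.isStrongSolution (ha : 0 < a) {q : ℝ → ℂ}
    (hq : IntegrableOn q (Ioo (-a) a)) {u h : L1 a} (hu : IsWeakSolution q u h) :
    IsStrongSolution q u h := by
  obtain ⟨hu1, hw⟩ := hu
  have huc : Continuous fun x => crep u 0 + ∫ s in (0 : ℝ)..x, ext (wderiv u) s :=
    continuous_const.add (continuous_primitive_ext _)
  have hue : u =ᵐ[volume.restrict (Ioo (-a) a)]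
      fun x => crep u 0 + ∫ s in (0 : ℝ)..x, ext (wderiv u) s := ae_eq_add_primitive_wderiv ha hu1
  obtain ⟨m, hm⟩ := exists_L1_mul hq huc
  have hmu : m =ᵐ[volume.restrict (Ioo (-a) a)] fun x => q x * u x := by
    filter_upwards [hm, hue] with x h1 h2
    rw [h1, h2]
  have hd : IsWeakDeriv (wderiv u) (m + h) := by
    intro ψ hψ
    have h1 := isWeakDeriv_wderiv hu1 (deriv ψ) hψ.isTest_deriv
    have h2 := hw ψ hψ
    have e1 : ∫ x in Ioo (-a) a, q x * u x * ψ x = ∫ x in Ioo (-a) a, m x * ψ x := by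
      refine integral_congr_ae ?_
      filter_upwards [hmu] with x hx
      rw [hx]
    have e2 : ∫ x in Ioo (-a) a, (m + h : L1 a) x * ψ x
        = (∫ x in Ioo (-a) a, m x * ψ x) + ∫ x in Ioo (-a) a, h x * ψ x := by
      rw [← integral_add (integrable_mul_of_bounded m hψ.1.continuous hψ.2.1)
        (integrable_mul_of_bounded h hψ.1.continuous hψ.2.1)]
      refine integral_congr_ae ?_
      filter_upwards [Lp.coeFn_add m h] with x hx
      rw [hx, Pi.add_apply, add_mul]
    rw [e1] at h2
    rw [e2]
    linear_combination h1 - h2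
  have hu2 : u ∈ sobolev a 2 := ⟨wderiv u, ⟨m + h, trivial, hd⟩, isWeakDeriv_wderiv hu1⟩
  refine ⟨hu2, ?_⟩
  rw [hd.wderiv_eq]
  filter_upwards [Lp.coeFn_add m h, hmu] with x h1 h2
  rw [h1, Pi.add_apply, h2]
  ring

/-- Uniqueness for the Cauchy problem `u'' - q u = v` with data at `0`. -/
theorem IsStrongSolution.unique (ha : 0 < a) {q : ℝ → ℂ} (hq : IntegrableOn q (Ioo (-a) a))
    {u₁ u₂ v : L1 a} (h₁ : IsStrongSolution q u₁ v) (h₂ : IsStrongSolution q u₂ v)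
    (h0 : crep u₁ 0 = crep u₂ 0) (h0' : crep (wderiv u₁) 0 = crep (wderiv u₂) 0) : u₁ = u₂ := by
  have e₁ := eq_of_mem_sobolev_two ha h₁.1
  have e₂ := eq_of_mem_sobolev_two ha h₂.1
  set g : L1 a := wderiv (wderiv u₁) - wderiv (wderiv u₂) with hg
  set y : ℝ → ℂ := fun x => ∫ t in (0 : ℝ)..x, ∫ s in (0 : ℝ)..t, ext g s with hy
  have hyc : Continuous y :=
    continuous_primitive_of_locallyIntegrable (continuous_primitive_ext g).locallyIntegrable
  have hd : u₁ - u₂ = (0 : ℂ) • power a 0 + primitive a ((0 : ℂ) • power a 0 + primitive a g) := by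
    conv_lhs => rw [e₁, e₂, h0, h0']
    simp only [map_add, zero_smul, zero_add, hg, map_sub]
    abel
  have hdy : (u₁ - u₂ : L1 a) =ᵐ[volume.restrict (Ioo (-a) a)] y := by
    rw [hd]
    refine (coeFn_add_primitive_add_primitive 0 0 g).trans (Filter.Eventually.of_forall fun x => ?_)
    simp only [zero_add, hy]
  have hgy : ext g =ᵐ[volume.restrict (Ioo (-a) a)] fun s => extend a q s * y s := by
    filter_upwards [ext_ae_eq g, Lp.coeFn_sub (wderiv (wderiv u₁)) (wderiv (wderiv u₂)), h₁.2, h₂.2,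
      Lp.coeFn_sub u₁ u₂, hdy, extend_ae_eq a q] with x k1 k2 k3 k4 k5 k6 k7
    rw [k1, k2, Pi.sub_apply, k7, ← k6, k5, Pi.sub_apply]
    linear_combination k3 - k4
  have hz := eq_zero_of_eq_primitive_primitive (a := a) (integrable_extend hq) hyc fun x hx => by
    refine intervalIntegral.integral_congr fun t ht => ?_
    refine primitive_congr (a := a) ?_ hgy
    exact abs_lt.1 ((abs_le_of_mem_uIcc_zero ht).trans_lt (abs_lt.2 hx))
  rw [← sub_eq_zero]
  refine Lp.ext ?_
  filter_upwards [hdy, Lp.coeFn_zero ℂ 1 (volume.restrict (Ioo (-a) a)),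
    ae_restrict_mem measurableSet_Ioo] with x h1 h2 hx
  rw [h1, h2, hz x hx, Pi.zero_apply]

/-- `𝐓` maps `W^{2,1}(I)` to itself, satisfies `(𝐓u)'' - q 𝐓u = 𝐓(u'')` there, and keeps the
values of `u` and `u'` at `0`. -/
theorem volterra_transmutes (ha : 0 < a) {q : ℝ → ℂ} (hq : IntegrableOn q (Ioo (-a) a))
    {H : ℝ × ℝ → ℂ} (hHc : Continuous H)
    (hH : ∀ p : ℝ × ℝ, H p = (1 / 2) * (∫ s in (0 : ℝ)..p.1, extend a q s)
      + goursatIntegral (extend a q) H p)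
    {T : L1 a → L1 a} (hT : IsVolterra (kernel fun u v => H (u, v)) T) {u : L1 a}
    (hu : u ∈ sobolev a 2) :
    IsStrongSolution q (T u) (T (wderiv (wderiv u))) ∧ crep (T u) 0 = crep u 0 ∧
      crep (wderiv (T u)) 0 = crep (wderiv u) 0 := by
  set K := kernel fun u v => H (u, v) with hK
  have hKc := continuous_kernel hHc
  have hTe (u : L1 a) : T u =ᵐ[volume.restrict (Ioo (-a) a)]
      fun x => u x + volterra K (ext u) x := by
    filter_upwards [hT u, ae_restrict_mem measurableSet_Ioo] with x h1 hx
    rw [h1, volterra_congr (ext_ae_eq u) hx, volterra]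
  obtain ⟨c, d, g, rfl⟩ := (mem_sobolev_two_iff ha).1 hu
  rw [crep_add_primitive_zero ha, wderiv_add_primitive ha, crep_add_primitive_zero ha,
    wderiv_add_primitive ha]
  set u : L1 a := c • power a 0 + primitive a (d • power a 0 + primitive a g) with hu_def
  set w₁ : ℝ → ℂ := fun y => d + ∫ s in (0 : ℝ)..y, ext g s with hw₁
  set w : ℝ → ℂ := fun x => c + ∫ y in (0 : ℝ)..x, w₁ y with hw
  have hw₁c : Continuous w₁ := continuous_const.add (continuous_primitive_ext g)
  have hwd (y : ℝ) : HasDerivAt w (w₁ y) y :=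
    (hw₁c.integral_hasStrictDerivAt 0 y).hasDerivAt.const_add c
  have hwc : Continuous w := continuous_iff_continuousAt.2 fun y => (hwd y).continuousAt
  have huw : u =ᵐ[volume.restrict (Ioo (-a) a)] w := coeFn_add_primitive_add_primitive c d g
  have hgi (b e : ℝ) : ∫ t in b..e, ext g t = w₁ e - w₁ b := by
    rw [hw₁, add_sub_add_left_eq_sub, intervalIntegral.integral_interval_sub_left
      (integrable_ext g).intervalIntegrable (integrable_ext g).intervalIntegrable]
  have key := transmutation_identity (integrable_extend hq) hHc hH (integrable_ext g) hgi hw₁c hwd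
  rw [← hK] at key
  set z : ℝ → ℂ := fun x => w x + volterra K w x with hz
  have hVw : Continuous (volterra K w) := continuous_volterra hKc hwc.locallyIntegrable
  have hzc : Continuous z := hwc.add hVw
  have hTu : T u =ᵐ[volume.restrict (Ioo (-a) a)] z := by
    filter_upwards [hTe u, huw, ae_restrict_mem measurableSet_Ioo] with x h1 h2 hx
    rw [h1, h2, volterra_congr ((ext_ae_eq u).trans huw) hx]
  obtain ⟨m, hm⟩ := exists_L1_mul hq hzc
  have hext : ext (m + T g) =ᵐ[volume.restrict (Ioo (-a) a)]
      fun s => ext g s + (extend a q s * z s + volterra K (ext g) s) := by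
    filter_upwards [ext_ae_eq (m + T g), Lp.coeFn_add m (T g), hm, hTe g, ext_ae_eq g,
      extend_ae_eq a q] with x h1 h2 h3 h4 h5 h6
    rw [h1, h2, Pi.add_apply, h3, h4, h5, h6]
    ring
  have hS : LocallyIntegrable fun s => extend a q s * z s + volterra K (ext g) s := by
    refine LocallyIntegrable.add ?_
      (continuous_volterra hKc (integrable_ext g).locallyIntegrable).locallyIntegrable
    rw [locallyIntegrable_iff]
    exact fun k hk => (integrable_extend hq).integrableOn.mul_continuousOn hzc.continuousOn hk
  have hTeq : T u = c • power a 0 + primitive a (d • power a 0 + primitive a (m + T g)) := by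
    refine Lp.ext (hTu.trans ?_)
    refine Filter.EventuallyEq.trans ?_ (coeFn_add_primitive_add_primitive c d (m + T g)).symm
    filter_upwards [ae_restrict_mem measurableSet_Ioo] with x hx
    have e : ∫ y in (0 : ℝ)..x, (d + ∫ s in (0 : ℝ)..y, ext (m + T g) s)
        = ∫ y in (0 : ℝ)..x, (w₁ y
          + ∫ s in (0 : ℝ)..y, (extend a q s * z s + volterra K (ext g) s)) := by
      refine intervalIntegral.integral_congr fun y hy => ?_
      have hya : y ∈ Ioo (-a) a :=
        abs_lt.1 ((abs_le_of_mem_uIcc_zero hy).trans_lt (abs_lt.2 hx))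
      rw [primitive_congr hya hext, intervalIntegral.integral_add
        (integrable_ext g).intervalIntegrable (intervalIntegrable_of_locallyIntegrable hS _ _), hw₁,
        add_assoc]
    rw [e, intervalIntegral.integral_add (hw₁c.intervalIntegrable _ _)
      ((continuous_primitive_of_locallyIntegrable hS).intervalIntegrable _ _), ← key x]
    exact add_assoc _ _ _
  refine ⟨⟨(mem_sobolev_two_iff ha).2 ⟨c, d, m + T g, hTeq⟩, ?_⟩, ?_, ?_⟩
  · have e2 : wderiv (wderiv (T u)) = m + T g := by
      rw [hTeq, wderiv_add_primitive ha, wderiv_add_primitive ha]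
    rw [e2]
    filter_upwards [Lp.coeFn_add m (T g), hm, hTu] with x h1 h2 h3
    rw [h1, Pi.add_apply, h2, h3]
    ring
  · rw [hTeq, crep_add_primitive_zero ha]
  · rw [hTeq, wderiv_add_primitive ha, crep_add_primitive_zero ha]

/-- The inverse of `𝐓` maps `W^{2,1}(I)` to itself: solve `w'' = 𝐓⁻¹(v'' - q v)` with the data
of `v` at `0`; then `𝐓w` and `v` solve the same Cauchy problem. -/
theorem symm_mem_sobolev_two (ha : 0 < a) {q : ℝ → ℂ} (hq : IntegrableOn q (Ioo (-a) a))
    {T : L1 a ≃L[ℂ] L1 a}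
    (hT : ∀ u ∈ sobolev a 2, IsStrongSolution q (T u) (T (wderiv (wderiv u))) ∧
      crep (T u) 0 = crep u 0 ∧ crep (wderiv (T u)) 0 = crep (wderiv u) 0) {v : L1 a}
    (hv : v ∈ sobolev a 2) : T.symm v ∈ sobolev a 2 := by
  have hv1 := sobolev_antitone a one_le_two hv
  have hvc : Continuous fun x => crep v 0 + ∫ s in (0 : ℝ)..x, ext (wderiv v) s :=
    continuous_const.add (continuous_primitive_ext _)
  obtain ⟨m, hm⟩ := exists_L1_mul hq hvc
  have hvs : IsStrongSolution q v (wderiv (wderiv v) - m) := by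
    refine ⟨hv, ?_⟩
    filter_upwards [Lp.coeFn_sub (wderiv (wderiv v)) m, hm, ae_eq_crep ha hv1,
      ae_restrict_mem measurableSet_Ioo] with x h1 h2 h3 hx
    rw [h1, Pi.sub_apply, h2, h3, crep_eq_add_primitive ha hv1 hx]
  set w : L1 a := crep v 0 • power a 0 + primitive a (crep (wderiv v) 0 • power a 0
    + primitive a (T.symm (wderiv (wderiv v) - m))) with hw
  have hw2 : w ∈ sobolev a 2 := (mem_sobolev_two_iff ha).2 ⟨_, _, _, hw⟩
  obtain ⟨h1, h2, h3⟩ := hT w hw2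
  rw [hw, wderiv_add_primitive ha, wderiv_add_primitive ha, ← hw, T.apply_symm_apply] at h1
  rw [hw, crep_add_primitive_zero ha, ← hw] at h2
  have h3' : crep (wderiv (T w)) 0 = crep (wderiv v) 0 := by
    rw [h3, hw, wderiv_add_primitive ha, crep_add_primitive_zero ha]
  rw [← h1.unique ha hq hvs h2 h3', T.symm_apply_apply]
  exact hw2

end CauchyProblem

/-! ### The Wronskian and the parity operators -/

section Parity

variable {a : ℝ}

/-- The Wronskian of two solutions of `u'' = q u` is constant: by the product rule, its derivative
is `f q g - q f g`. -/
theorem wronskian_eq (ha : 0 < a) {q : ℝ → ℂ} {f g : L1 a} (hf : IsStrongSolution q f 0)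
    (hg : IsStrongSolution q g 0) {x : ℝ} (hx : x ∈ Ioo (-a) a) :
    wronskian f g x = wronskian f g 0 := by
  have hf1 := sobolev_antitone a one_le_two hf.1
  have hg1 := sobolev_antitone a one_le_two hg.1
  have hf1' := wderiv_mem_sobolev hf.1
  have hg1' := wderiv_mem_sobolev hg.1
  rw [wronskian, crep_eq_add_primitive ha hf1 hx, crep_eq_add_primitive ha hg1' hx,
    crep_eq_add_primitive ha hf1' hx, crep_eq_add_primitive ha hg1 hx,
    add_primitive_mul_add_primitive (integrable_ext _).locallyIntegrable
      (integrable_ext _).locallyIntegrable,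
    add_primitive_mul_add_primitive (integrable_ext _).locallyIntegrable
      (integrable_ext _).locallyIntegrable, wronskian, add_sub_add_comm]
  refine add_eq_left.2 (sub_eq_zero.2 (primitive_congr hx ?_))
  filter_upwards [ae_eq_add_primitive_wderiv ha hf1, ae_eq_add_primitive_wderiv ha hg1,
    ae_eq_add_primitive_wderiv ha hf1', ae_eq_add_primitive_wderiv ha hg1', hf.2, hg.2,
    ext_ae_eq (wderiv f), ext_ae_eq (wderiv g), ext_ae_eq (wderiv (wderiv f)), ext_ae_eq (wderiv (wderiv g)),
    Lp.coeFn_zero ℂ 1 (volume.restrict (Ioo (-a) a))] with y h1 h2 h3 h4 h5 h6 k1 k2 k3 k4 h0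
  rw [← h1, ← h2, ← h3, ← h4, k1, k2, k3, k4]
  rw [h0, Pi.zero_apply] at h5 h6
  linear_combination f y * h6 - g y * h5

/-- The operator `c₀ P₊ + c₀' A P₊ + c₁ (d/dx) P₋ + c₁' P₋`. It commutes with `d²/dx²`, and it maps
the values `(u(0), u'(0))` to `(c₀ u(0) + c₁ u'(0), c₀' u(0) + c₁' u'(0))`. -/
def paritySum (c₀ c₀' c₁ c₁' : ℂ) (u : L1 a) : L1 a :=
  c₀ • Pplus a u + c₀' • primitive a (Pplus a u) + c₁ • wderiv (Pminus a u) + c₁' • Pminus a u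

/-- The inverse of `paritySum c₀ c₀' c₁ c₁'`, if the determinant `c₀ c₁' - c₀' c₁` is not zero. -/
def parityInverse (c₀ c₀' c₁ c₁' : ℂ) (v : L1 a) : L1 a :=
  (c₀ * c₁' - c₀' * c₁)⁻¹ • (c₁' • Pplus a v - c₀' • primitive a (Pplus a v)
    - c₁ • wderiv (Pminus a v) + c₀ • Pminus a v)

theorem fundamentalSum_eq (T : L1 a ≃L[ℂ] L1 a) (φ₀ φ₁ u : L1 a) :
    fundamentalSum T φ₀ φ₁ u
      = T (paritySum (crep φ₀ 0) (crep (wderiv φ₀) 0) (crep φ₁ 0) (crep (wderiv φ₁) 0) u) := by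
  simp only [fundamentalSum, paritySum, map_add, map_smul]

theorem inverseSum_eq (T : L1 a ≃L[ℂ] L1 a) (φ₀ φ₁ v : L1 a) :
    inverseSum T φ₀ φ₁ v
      = parityInverse (crep φ₀ 0) (crep (wderiv φ₀) 0) (crep φ₁ 0) (crep (wderiv φ₁) 0)
        (T.symm v) := rfl

section Algebra

variable {c₀ c₀' c₁ c₁' : ℂ}

theorem Pminus_mem_sobolev (ha : 0 < a) {k : ℕ} {u : L1 a} (hu : u ∈ sobolev a k) :
    Pminus a u ∈ sobolev a k := (Pplus_Pminus_mem_sobolev ha k hu).2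

theorem Pplus_mem_sobolev (ha : 0 < a) {k : ℕ} {u : L1 a} (hu : u ∈ sobolev a k) :
    Pplus a u ∈ sobolev a k := (Pplus_Pminus_mem_sobolev ha k hu).1

theorem paritySum_add (ha : 0 < a) {u v : L1 a} (hu : u ∈ sobolev a 1) (hv : v ∈ sobolev a 1) :
    paritySum c₀ c₀' c₁ c₁' (u + v) = paritySum c₀ c₀' c₁ c₁' u + paritySum c₀ c₀' c₁ c₁' v := by
  simp only [paritySum, map_add, wderiv_add (Pminus_mem_sobolev ha hu) (Pminus_mem_sobolev ha hv)]
  module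

theorem paritySum_smul (ha : 0 < a) (c : ℂ) {u : L1 a} (hu : u ∈ sobolev a 1) :
    paritySum c₀ c₀' c₁ c₁' (c • u) = c • paritySum c₀ c₀' c₁ c₁' u := by
  simp only [paritySum, map_smul, wderiv_smul c (Pminus_mem_sobolev ha hu)]
  module

theorem paritySum_of_mem_sobolev (ha : 0 < a) {u : L1 a} (hu : u ∈ sobolev a 1) :
    paritySum c₀ c₀' c₁ c₁' u = c₀ • Pplus a u + c₀' • primitive a (Pplus a u)
      + c₁ • Pplus a (wderiv u) + c₁' • Pminus a u := by
  rw [paritySum, wderiv_Pminus ha hu]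

/-- Derivatives exchange the parities: `(P₊u)' = P₋u'` and `(P₋u)' = P₊u'`. -/
theorem wderiv_paritySum (ha : 0 < a) {u : L1 a} (hu : u ∈ sobolev a 2) :
    wderiv (paritySum c₀ c₀' c₁ c₁' u) = c₀ • Pminus a (wderiv u) + c₀' • Pplus a u
      + c₁ • Pminus a (wderiv (wderiv u)) + c₁' • Pplus a (wderiv u) := by
  have hu1 := sobolev_antitone a one_le_two hu
  have h1 := Pplus_mem_sobolev ha hu1
  have h2 := Pminus_mem_sobolev ha hu1
  have h3 := primitive_mem_sobolev ha (k := 0) (g := Pplus a u) trivial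
  have h4 := Pplus_mem_sobolev ha (wderiv_mem_sobolev hu)
  rw [paritySum_of_mem_sobolev ha hu1,
    wderiv_add (add_mem (add_mem (Submodule.smul_mem _ _ h1) (Submodule.smul_mem _ _ h3))
      (Submodule.smul_mem _ _ h4)) (Submodule.smul_mem _ _ h2),
    wderiv_add (add_mem (Submodule.smul_mem _ _ h1) (Submodule.smul_mem _ _ h3))
      (Submodule.smul_mem _ _ h4),
    wderiv_add (Submodule.smul_mem _ _ h1) (Submodule.smul_mem _ _ h3),
    wderiv_smul _ h1, wderiv_smul _ h2, wderiv_smul _ h3, wderiv_smul _ h4,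
    wderiv_Pplus ha hu1, wderiv_primitive ha, wderiv_Pplus ha (wderiv_mem_sobolev hu),
    wderiv_Pminus ha hu1]

theorem paritySum_mem_sobolev (ha : 0 < a) {k : ℕ} {u : L1 a} (hu : u ∈ sobolev a (k + 1)) :
    paritySum c₀ c₀' c₁ c₁' u ∈ sobolev a k := by
  have huk := sobolev_antitone a k.le_succ hu
  exact add_mem (add_mem (add_mem (Submodule.smul_mem _ _ (Pplus_mem_sobolev ha huk))
    (Submodule.smul_mem _ _ (sobolev_antitone a k.le_succ
      (primitive_mem_sobolev ha (Pplus_mem_sobolev ha huk)))))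
    (Submodule.smul_mem _ _ (wderiv_mem_sobolev (Pminus_mem_sobolev ha hu))))
    (Submodule.smul_mem _ _ (Pminus_mem_sobolev ha huk))

theorem wderiv_wderiv_paritySum (ha : 0 < a) {u : L1 a} (hu : u ∈ sobolev a 3) :
    wderiv (wderiv (paritySum c₀ c₀' c₁ c₁' u))
      = paritySum c₀ c₀' c₁ c₁' (wderiv (wderiv u)) := by
  have hu' : wderiv u ∈ sobolev a 2 := wderiv_mem_sobolev hu
  have hu'' : wderiv (wderiv u) ∈ sobolev a 1 := wderiv_mem_sobolev hu'
  have hu2 : u ∈ sobolev a 2 := sobolev_antitone a (by norm_num) hu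
  have hu1 : u ∈ sobolev a 1 := sobolev_antitone a one_le_two hu2
  have hu1' : wderiv u ∈ sobolev a 1 := sobolev_antitone a one_le_two hu'
  have h1 := Pminus_mem_sobolev ha hu1'
  have h2 := Pplus_mem_sobolev ha hu1
  have h3 := Pminus_mem_sobolev ha hu''
  have h4 := Pplus_mem_sobolev ha hu1'
  rw [wderiv_paritySum ha hu2,
    wderiv_add (add_mem (add_mem (Submodule.smul_mem _ _ h1) (Submodule.smul_mem _ _ h2))
      (Submodule.smul_mem _ _ h3)) (Submodule.smul_mem _ _ h4),
    wderiv_add (add_mem (Submodule.smul_mem _ _ h1) (Submodule.smul_mem _ _ h2))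
      (Submodule.smul_mem _ _ h3),
    wderiv_add (Submodule.smul_mem _ _ h1) (Submodule.smul_mem _ _ h2),
    wderiv_smul _ h1, wderiv_smul _ h2, wderiv_smul _ h3, wderiv_smul _ h4,
    wderiv_Pplus ha hu1, wderiv_Pplus ha hu1', paritySum,
    -- `P₋u'` is odd, hence the primitive of its derivative `P₊u''`
    ← primitive_wderiv_Pminus ha hu1', wderiv_primitive ha, wderiv_Pminus ha hu1']

theorem crep_paritySum (ha : 0 < a) {u : L1 a} (hu : u ∈ sobolev a 2) :
    crep (paritySum c₀ c₀' c₁ c₁' u) 0 = c₀ * crep u 0 + c₁ * crep (wderiv u) 0 := by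
  have hu1 := sobolev_antitone a one_le_two hu
  have hu1' := wderiv_mem_sobolev hu
  have h1 := Pplus_mem_sobolev ha hu1
  have h2 := Pminus_mem_sobolev ha hu1
  have h3 := primitive_mem_sobolev ha (k := 0) (g := Pplus a u) trivial
  have h4 := Pplus_mem_sobolev ha hu1'
  rw [paritySum_of_mem_sobolev ha hu1,
    crep_add ha (add_mem (add_mem (Submodule.smul_mem _ _ h1) (Submodule.smul_mem _ _ h3))
      (Submodule.smul_mem _ _ h4)) (Submodule.smul_mem _ _ h2),
    crep_add ha (add_mem (Submodule.smul_mem _ _ h1) (Submodule.smul_mem _ _ h3))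
      (Submodule.smul_mem _ _ h4),
    crep_add ha (Submodule.smul_mem _ _ h1) (Submodule.smul_mem _ _ h3),
    crep_smul ha _ h1, crep_smul ha _ h2, crep_smul ha _ h3, crep_smul ha _ h4,
    crep_Pplus ha hu1, crep_Pminus ha hu1, crep_primitive_zero ha, crep_Pplus ha hu1']
  ring

theorem crep_wderiv_paritySum (ha : 0 < a) {u : L1 a} (hu : u ∈ sobolev a 3) :
    crep (wderiv (paritySum c₀ c₀' c₁ c₁' u)) 0 = c₀' * crep u 0 + c₁' * crep (wderiv u) 0 := by
  have hu' : wderiv u ∈ sobolev a 2 := wderiv_mem_sobolev hu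
  have hu'' : wderiv (wderiv u) ∈ sobolev a 1 := wderiv_mem_sobolev hu'
  have hu2 : u ∈ sobolev a 2 := sobolev_antitone a (by norm_num) hu
  have hu1 : u ∈ sobolev a 1 := sobolev_antitone a one_le_two hu2
  have hu1' : wderiv u ∈ sobolev a 1 := sobolev_antitone a one_le_two hu'
  have h1 := Pminus_mem_sobolev ha hu1'
  have h2 := Pplus_mem_sobolev ha hu1
  have h3 := Pminus_mem_sobolev ha hu''
  have h4 := Pplus_mem_sobolev ha hu1'
  rw [wderiv_paritySum ha hu2,
    crep_add ha (add_mem (add_mem (Submodule.smul_mem _ _ h1) (Submodule.smul_mem _ _ h2))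
      (Submodule.smul_mem _ _ h3)) (Submodule.smul_mem _ _ h4),
    crep_add ha (add_mem (Submodule.smul_mem _ _ h1) (Submodule.smul_mem _ _ h2))
      (Submodule.smul_mem _ _ h3),
    crep_add ha (Submodule.smul_mem _ _ h1) (Submodule.smul_mem _ _ h2),
    crep_smul ha _ h1, crep_smul ha _ h2, crep_smul ha _ h3, crep_smul ha _ h4,
    crep_Pplus ha hu1, crep_Pminus ha hu1', crep_Pminus ha hu'', crep_Pplus ha hu1']
  ring

theorem Pminus_paritySum (ha : 0 < a) {u : L1 a} (hu : u ∈ sobolev a 1) :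
    Pminus a (paritySum c₀ c₀' c₁ c₁' u)
      = c₀' • primitive a (Pplus a u) + c₁' • Pminus a u := by
  simp only [paritySum_of_mem_sobolev ha hu, map_add, map_smul, Pminus_primitive, Pminus_Pplus,
    Pplus_Pplus, Pminus_Pminus, smul_zero, zero_add, add_zero]

theorem Pminus_paritySum_mem_sobolev (ha : 0 < a) {u : L1 a} (hu : u ∈ sobolev a 1) :
    Pminus a (paritySum c₀ c₀' c₁ c₁' u) ∈ sobolev a 1 := by
  rw [Pminus_paritySum ha hu]
  exact add_mem (Submodule.smul_mem _ _ (primitive_mem_sobolev ha (k := 0) trivial))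
    (Submodule.smul_mem _ _ (Pminus_mem_sobolev ha hu))

theorem parityInverse_mem_sobolev (ha : 0 < a) {v : L1 a} (hv : v ∈ sobolev a 2) :
    parityInverse c₀ c₀' c₁ c₁' v ∈ sobolev a 1 := by
  have hv1 := sobolev_antitone a one_le_two hv
  exact Submodule.smul_mem _ _ (add_mem (sub_mem (sub_mem
    (Submodule.smul_mem _ _ (Pplus_mem_sobolev ha hv1))
    (Submodule.smul_mem _ _ (primitive_mem_sobolev ha (k := 0) trivial)))
    (Submodule.smul_mem _ _ (wderiv_mem_sobolev (Pminus_mem_sobolev ha hv))))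
    (Submodule.smul_mem _ _ (Pminus_mem_sobolev ha hv1)))

theorem parityInverse_paritySum (ha : 0 < a) (hW : c₀ * c₁' - c₀' * c₁ ≠ 0) {u : L1 a}
    (hu : u ∈ sobolev a 1) :
    parityInverse c₀ c₀' c₁ c₁' (paritySum c₀ c₀' c₁ c₁' u) = u := by
  have h1 : Pplus a (paritySum c₀ c₀' c₁ c₁' u) = c₀ • Pplus a u + c₁ • Pplus a (wderiv u) := by
    simp only [paritySum_of_mem_sobolev ha hu, map_add, map_smul, Pplus_primitive, Pminus_Pplus,
      Pplus_Pplus, Pplus_Pminus, smul_zero, add_zero, map_zero]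
  have h2 : primitive a (Pplus a (wderiv u)) = Pminus a u := by
    rw [← wderiv_Pminus ha hu, primitive_wderiv_Pminus ha hu]
  have h3 : wderiv (Pminus a (paritySum c₀ c₀' c₁ c₁' u))
      = c₀' • Pplus a u + c₁' • Pplus a (wderiv u) := by
    have k1 := primitive_mem_sobolev ha (k := 0) (g := Pplus a u) trivial
    have k2 := Pminus_mem_sobolev ha hu
    rw [Pminus_paritySum ha hu, wderiv_add (Submodule.smul_mem _ _ k1) (Submodule.smul_mem _ _ k2),
      wderiv_smul _ k1, wderiv_smul _ k2, wderiv_primitive ha, wderiv_Pminus ha hu]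
  rw [parityInverse, h3, h1, Pminus_paritySum ha hu, map_add, map_smul, map_smul, h2,
    inv_smul_eq_iff₀ hW]
  conv_rhs => rw [← Pplus_add_Pminus u]
  module

theorem paritySum_parityInverse (ha : 0 < a) (hW : c₀ * c₁' - c₀' * c₁ ≠ 0) {v : L1 a}
    (hv : v ∈ sobolev a 1) :
    paritySum c₀ c₀' c₁ c₁' (parityInverse c₀ c₀' c₁ c₁' v) = v := by
  set W := c₀ * c₁' - c₀' * c₁ with hWd
  have h1 : Pplus a (parityInverse c₀ c₀' c₁ c₁' v)
      = W⁻¹ • (c₁' • Pplus a v - c₁ • Pplus a (wderiv v)) := by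
    simp only [parityInverse, wderiv_Pminus ha hv, map_add, map_sub, map_smul, Pplus_primitive,
      Pminus_Pplus, Pplus_Pplus, Pplus_Pminus, smul_zero, add_zero, map_zero, sub_zero, hWd]
  have h2 : primitive a (Pplus a (wderiv v)) = Pminus a v := by
    rw [← wderiv_Pminus ha hv, primitive_wderiv_Pminus ha hv]
  have h3 : Pminus a (parityInverse c₀ c₀' c₁ c₁' v)
      = W⁻¹ • (c₀ • Pminus a v - c₀' • primitive a (Pplus a v)) := by
    simp only [parityInverse, wderiv_Pminus ha hv, map_add, map_sub, map_smul, Pminus_primitive,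
      Pminus_Pplus, Pplus_Pplus, Pminus_Pminus, smul_zero, zero_sub, sub_zero, hWd]
    module
  have h4 : wderiv (Pminus a (parityInverse c₀ c₀' c₁ c₁' v))
      = W⁻¹ • (c₀ • Pplus a (wderiv v) - c₀' • Pplus a v) := by
    have k1 := isWeakDeriv_wderiv (primitive_mem_sobolev ha (k := 0) (g := Pplus a v) trivial)
    have k2 := isWeakDeriv_wderiv (Pminus_mem_sobolev ha hv)
    rw [h3, (((k2.smul c₀).sub (k1.smul c₀')).smul W⁻¹).wderiv_eq, wderiv_primitive ha,
      wderiv_Pminus ha hv]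
  rw [paritySum, h4, h1, h3, map_smul, map_sub, map_smul, map_smul, h2]
  have h5 : v = W⁻¹ • (W • (Pplus a v + Pminus a v)) := by
    rw [inv_smul_smul₀ hW, Pplus_add_Pminus]
  conv_rhs => rw [h5, hWd]
  module

/-! ### The case `c₁ = 0` -/

theorem norm_primitive_le (ha : 0 < a) (u : L1 a) : ‖primitive a u‖ ≤ 2 * a * ‖u‖ := by
  refine norm_L1_le_of_ae_bound ha _ ?_
  filter_upwards [coeFn_primitive u] with x hx
  have h := norm_intervalIntegral_mul_le (integrable_ext u) (b := 0) (c := x) (g := fun _ => 1)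
    zero_le_one (by simp)
  rw [integral_norm_ext] at h
  rw [hx]
  simpa using h

/-- The bounded operator `b P₊ + c A P₊ + d P₋` on `L¹(I)`. -/
def parityCLM (ha : 0 < a) (b c d : ℂ) : L1 a →L[ℂ] L1 a :=
  (b • Pplus a + c • (primitive a ∘ₗ Pplus a) + d • Pminus a).mkContinuous
    (‖b‖ + ‖c‖ * (2 * a) + ‖d‖) fun u => by
    have h1 := norm_Pplus_le u
    have h2 := (norm_primitive_le ha (Pplus a u)).trans
      (mul_le_mul_of_nonneg_left h1 (by linarith : 0 ≤ 2 * a))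
    have h3 := norm_Pminus_le u
    refine (norm_add₃_le).trans ?_
    simp only [LinearMap.smul_apply, LinearMap.comp_apply, norm_smul]
    calc ‖b‖ * ‖Pplus a u‖ + ‖c‖ * ‖primitive a (Pplus a u)‖ + ‖d‖ * ‖Pminus a u‖
        ≤ ‖b‖ * ‖u‖ + ‖c‖ * (2 * a * ‖u‖) + ‖d‖ * ‖u‖ := by gcongr
      _ = _ := by ring

theorem parityCLM_apply (ha : 0 < a) (b c d : ℂ) (u : L1 a) :
    parityCLM ha b c d u = b • Pplus a u + c • primitive a (Pplus a u) + d • Pminus a u := rfl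

theorem paritySum_zero_eq (ha : 0 < a) (u : L1 a) :
    paritySum c₀ c₀' 0 c₁' u = parityCLM ha c₀ c₀' c₁' u := by
  rw [paritySum, parityCLM_apply, zero_smul, add_zero]

/-- The factors are `c₁'/W`, `-c₀'/W` and `c₀/W`, with `W = c₀ c₁'`. -/
theorem parityInverse_zero_eq (ha : 0 < a) (h₀ : c₀ ≠ 0) (h₁ : c₁' ≠ 0) (v : L1 a) :
    parityInverse c₀ c₀' 0 c₁' v = parityCLM ha c₀⁻¹ (-(c₀' / (c₀ * c₁'))) c₁'⁻¹ v := by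
  rw [parityInverse, parityCLM_apply, mul_zero, sub_zero, inv_smul_eq_iff₀ (mul_ne_zero h₀ h₁)]
  simp only [smul_add, smul_smul, zero_smul, sub_zero]
  have e1 : c₀ * c₁' * c₀⁻¹ = c₁' := by field_simp
  have e2 : c₀ * c₁' * -(c₀' / (c₀ * c₁')) = -c₀' := by field_simp
  have e3 : c₀ * c₁' * c₁'⁻¹ = c₀ := by field_simp
  rw [e1, e2, e3]
  module

theorem parityCLM_parityCLM (ha : 0 < a) (b c d b' c' d' : ℂ) (u : L1 a) :
    parityCLM ha b c d (parityCLM ha b' c' d' u)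
      = parityCLM ha (b * b') (c * b' + d * c') (d * d') u := by
  simp only [parityCLM_apply, map_add, map_smul, Pplus_Pplus, Pplus_primitive, Pminus_Pplus,
    Pplus_Pminus, Pminus_primitive, Pminus_Pminus, map_zero, smul_zero, add_zero, zero_add]
  module

theorem parityCLM_one (ha : 0 < a) (u : L1 a) : parityCLM ha 1 0 1 u = u := by
  rw [parityCLM_apply, one_smul, one_smul, zero_smul, add_zero, Pplus_add_Pminus]

/-- For `c₀, c₁'` not zero, `c₀ P₊ + c₀' A P₊ + c₁' P₋` is an automorphism of `L¹(I)`. -/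
def parityEquiv (ha : 0 < a) (c₀' : ℂ) (h₀ : c₀ ≠ 0) (h₁ : c₁' ≠ 0) : L1 a ≃L[ℂ] L1 a :=
  ContinuousLinearEquiv.equivOfInverse (parityCLM ha c₀ c₀' c₁')
    (parityCLM ha c₀⁻¹ (-(c₀' / (c₀ * c₁'))) c₁'⁻¹)
    (fun u => by
      have e : -(c₀' / (c₀ * c₁')) * c₀ + c₁'⁻¹ * c₀' = 0 := by field_simp; ring
      rw [parityCLM_parityCLM, inv_mul_cancel₀ h₀, inv_mul_cancel₀ h₁, e, parityCLM_one])
    (fun u => by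
      have e : c₀' * c₀⁻¹ + c₁' * -(c₀' / (c₀ * c₁')) = 0 := by field_simp; ring
      rw [parityCLM_parityCLM, mul_inv_cancel₀ h₀, mul_inv_cancel₀ h₁, e, parityCLM_one])

end Algebra

end Parity

/-! ### The transmutation operator -/

section TransmutationOperator

variable {a : ℝ}

/-- The operator `𝐓(c₀ P₊ + c₀' A P₊ + c₁ (d/dx) P₋ + c₁' P₋)` with domain `W^{1,1}(I)`. -/
def transmutation (ha : 0 < a) (T : L1 a ≃L[ℂ] L1 a) (c₀ c₀' c₁ c₁' : ℂ) :
    L1 a →ₗ.[ℂ] L1 a where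
  domain := sobolev a 1
  toFun :=
    { toFun := fun u => T (paritySum c₀ c₀' c₁ c₁' u)
      map_add' := fun u v => by
        rw [Submodule.coe_add, paritySum_add ha u.2 v.2, map_add]
      map_smul' := fun c u => by
        rw [Submodule.coe_smul, paritySum_smul ha c u.2, map_smul, RingHom.id_apply] }

theorem transmutation_apply (ha : 0 < a) (T : L1 a ≃L[ℂ] L1 a) (c₀ c₀' c₁ c₁' : ℂ)
    (u : (transmutation ha T c₀ c₀' c₁ c₁').domain) :
    transmutation ha T c₀ c₀' c₁ c₁' u = T (paritySum c₀ c₀' c₁ c₁' u) := rfl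

theorem wderiv_wderiv_power_add_two (ha : 0 < a) (k : ℕ) :
    wderiv (wderiv (power a (k + 2))) = (((k : ℂ) + 2) * ((k : ℂ) + 1)) • power a k := by
  rw [wderiv_power_succ ha, wderiv_smul _ (power_mem_sobolev ha 1 _), wderiv_power_succ ha,
    smul_smul]
  congr 1
  push_cast
  ring

theorem crep_zero (ha : 0 < a) : crep (0 : L1 a) 0 = 0 := by
  simpa using crep_add_primitive_zero ha 0 (0 : L1 a)

/-- The powers are mapped to the given standard base: by induction, the image of `x^k` and `φ k`
solve the same Cauchy problem. -/
theorem apply_paritySum_power (ha : 0 < a) {q : ℝ → ℂ} (hq : IntegrableOn q (Ioo (-a) a))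
    {φ : ℕ → L1 a} (hφ : IsStandardLBase q φ) {T : L1 a ≃L[ℂ] L1 a}
    (hT : ∀ u ∈ sobolev a 2, IsStrongSolution q (T u) (T (wderiv (wderiv u))) ∧
      crep (T u) 0 = crep u 0 ∧ crep (wderiv (T u)) 0 = crep (wderiv u) 0) (k : ℕ) :
    T (paritySum (crep (φ 0) 0) (crep (wderiv (φ 0)) 0) (crep (φ 1) 0) (crep (wderiv (φ 1)) 0)
      (power a k)) = φ k := by
  set R : L1 a → L1 a := paritySum (crep (φ 0) 0) (crep (wderiv (φ 0)) 0) (crep (φ 1) 0)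
    (crep (wderiv (φ 1)) 0) with hR
  have key (k : ℕ) : IsStrongSolution q (T (R (power a k))) (T (R (wderiv (wderiv (power a k))))) ∧
      crep (T (R (power a k))) 0
        = crep (φ 0) 0 * crep (power a k) 0 + crep (φ 1) 0 * crep (wderiv (power a k)) 0 ∧
      crep (wderiv (T (R (power a k)))) 0 = crep (wderiv (φ 0)) 0 * crep (power a k) 0
        + crep (wderiv (φ 1)) 0 * crep (wderiv (power a k)) 0 := by
    have h3 := power_mem_sobolev ha 3 k
    obtain ⟨h4, h5, h6⟩ := hT (R (power a k)) (paritySum_mem_sobolev ha h3)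
    rw [wderiv_wderiv_paritySum ha h3] at h4
    rw [crep_paritySum ha (power_mem_sobolev ha 2 k)] at h5
    rw [crep_wderiv_paritySum ha h3] at h6
    exact ⟨h4, h5, h6⟩
  have hR0 : R 0 = 0 := by
    have := paritySum_smul (c₀ := crep (φ 0) 0) (c₀' := crep (wderiv (φ 0)) 0)
      (c₁ := crep (φ 1) 0) (c₁' := crep (wderiv (φ 1)) 0) ha 0 (zero_mem (sobolev a 1))
    rwa [zero_smul, zero_smul] at this
  have hw0 : wderiv (0 : L1 a) = 0 := IsWeakDeriv.zero.wderiv_eq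
  induction k using Nat.strong_induction_on with
  | _ k ih =>
    obtain ⟨h1, h2, h3⟩ := key k
    match k with
    | 0 =>
      rw [wderiv_power_zero ha, hw0, hR0, map_zero] at h1
      rw [wderiv_power_zero ha, crep_power_zero ha, crep_zero ha, mul_one, mul_zero, add_zero]
        at h2 h3
      exact h1.unique ha hq (hφ.zero.isStrongSolution ha hq) h2 h3
    | 1 =>
      have e : wderiv (power a 1) = power a 0 := by
        simpa using wderiv_power_succ ha 0
      have e0 : crep (power a 1) 0 = 0 := crep_power_succ ha 0
      rw [e, wderiv_power_zero ha, hR0, map_zero] at h1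
      rw [e, e0, crep_power_zero ha, mul_zero, zero_add, mul_one] at h2 h3
      exact h1.unique ha hq (hφ.one.isStrongSolution ha hq) h2 h3
    | k + 2 =>
      have e0 : crep (power a (k + 2)) 0 = 0 := crep_power_succ ha (k + 1)
      have e1 : crep (wderiv (power a (k + 2))) 0 = 0 := by
        rw [wderiv_power_succ ha, crep_smul ha _ (power_mem_sobolev ha 1 _), crep_power_succ ha,
          mul_zero]
      rw [wderiv_wderiv_power_add_two ha, hR, paritySum_smul ha _ (power_mem_sobolev ha 1 k), ← hR,
        map_smul, ih k (by omega)] at h1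
      rw [e0, e1, mul_zero, mul_zero, add_zero] at h2 h3
      exact h1.unique ha hq ((hφ.add_two k).isStrongSolution ha hq)
        (h2.trans (hφ.value (k + 2) (by omega)).symm)
        (h3.trans (hφ.deriv_value (k + 2) (by omega)).symm)

end TransmutationOperator

end Transmutation

end

theorem mainTheorem1 (a : ℝ) (ha : 0 < a) (q : ℝ → ℂ) (hq : IntegrableOn q (Ioo (-a) a))
    (φ : ℕ → Transmutation.L1 a) (hφ : IsStandardLBase q φ) :
    -- the solution `H` of the integral equation, unique among the continuous ones
    ∃ H : ℝ → ℝ → ℂ, IsGoursatSolution a q H ∧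
      (∀ H' : ℝ → ℝ → ℂ, IsGoursatSolution a q H' →
        ∀ u v : ℝ, |u| + |v| ≤ a → H' u v = H u v) ∧
    -- the Volterra operator, a bounded bijection of `L¹(I)` with bounded inverse `T.symm`
    ∃ T : Transmutation.L1 a ≃L[ℂ] Transmutation.L1 a, IsVolterra (kernel H) T ∧
    -- the operator `T_φ` on `W^{1,1}(I)`
    ∃ Tφ : Transmutation.L1 a →ₗ.[ℂ] Transmutation.L1 a,
      Tφ.domain = sobolev a 1 ∧
      IsStandardTransmutation q Tφ (sobolev a 3) ∧
      MapsPowers Tφ φ ∧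
      (∀ u : Tφ.domain, Pminus a u ∈ sobolev a 1 ∧ Tφ u = fundamentalSum T (φ 0) (φ 1) u) ∧
      (∃ C : ℝ, ∀ u : Tφ.domain,
        ‖Tφ u‖ ≤ C * (‖(u : Transmutation.L1 a)‖ + ‖wderiv (u : Transmutation.L1 a)‖)) ∧
      -- the Wronskian is constant
      (∀ x ∈ Ioo (-a) a, wronskian (φ 0) (φ 1) x = wronskian (φ 0) (φ 1) 0) ∧
      -- if it is not zero, then `M_φ` is a two-sided inverse on `W^{2,1}(I)`
      (wronskian (φ 0) (φ 1) 0 ≠ 0 → ∀ u ∈ sobolev a 2,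
        (Pminus a (T.symm u) ∈ sobolev a 1 ∧
          ∃ h : inverseSum T (φ 0) (φ 1) u ∈ Tφ.domain,
            Tφ ⟨inverseSum T (φ 0) (φ 1) u, h⟩ = u) ∧
        (∃ h : u ∈ Tφ.domain, Pminus a (T.symm (Tφ ⟨u, h⟩)) ∈ sobolev a 1 ∧
          inverseSum T (φ 0) (φ 1) (Tφ ⟨u, h⟩) = u)) ∧
      -- if `φ₁(0) = 0`, then `T_φ` is (extends to) a bounded operator on `L¹(I)`,
      -- and if also `φ₀(0) ≠ 0`, with the Wronskian not zero, then its inverse is `M_φ`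
      (crep (φ 1) 0 = 0 →
        ∃ S : Transmutation.L1 a →L[ℂ] Transmutation.L1 a,
          (∀ u : Tφ.domain, S u = Tφ u) ∧
          (∀ u : Transmutation.L1 a, S u = fundamentalSum T (φ 0) (φ 1) u) ∧
          (crep (φ 0) 0 ≠ 0 → wronskian (φ 0) (φ 1) 0 ≠ 0 →
            ∃ S' : Transmutation.L1 a ≃L[ℂ] Transmutation.L1 a,
              (S' : Transmutation.L1 a →L[ℂ] Transmutation.L1 a) = S ∧
              ∀ v : Transmutation.L1 a, S'.symm v = inverseSum T (φ 0) (φ 1) v)) := by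
  obtain ⟨H, hHc, hH⟩ := exists_goursat (integrable_extend hq)
  have hHs := isGoursatSolution_of_extend hHc hH
  refine ⟨fun u v => H (u, v), hHs, fun H' hH' u v huv => hH'.unique hq hHs huv, ?_⟩
  obtain ⟨T, hT⟩ := exists_volterraEquiv ha (continuous_kernel hHc)
  have hT2 : ∀ u ∈ sobolev a 2, IsStrongSolution q (T u) (T (wderiv (wderiv u))) ∧
      crep (T u) 0 = crep u 0 ∧ crep (wderiv (T u)) 0 = crep (wderiv u) 0 :=
    fun u hu => volterra_transmutes ha hq hHc hH hT hu
  refine ⟨T, hT, transmutation ha T (crep (φ 0) 0) (crep (wderiv (φ 0)) 0) (crep (φ 1) 0)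
    (crep (wderiv (φ 1)) 0), rfl, ?_, ?_, ?_, ?_, ?_, ?_, ?_⟩
  · refine ⟨fun u hu => ⟨sobolev_antitone a (by norm_num) hu,
      sobolev_antitone a (by norm_num) hu, wderiv_mem_sobolev (wderiv_mem_sobolev hu), ?_⟩,
      φ, hφ, fun k => ⟨power_mem_sobolev ha 1 k, apply_paritySum_power ha hq hφ hT2 k⟩⟩
    have h := (hT2 _ (paritySum_mem_sobolev (c₀ := crep (φ 0) 0) (c₀' := crep (wderiv (φ 0)) 0)
      (c₁ := crep (φ 1) 0) (c₁' := crep (wderiv (φ 1)) 0) ha hu)).1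
    rw [wderiv_wderiv_paritySum ha hu] at h
    exact h
  · exact fun k => ⟨power_mem_sobolev ha 1 k, apply_paritySum_power ha hq hφ hT2 k⟩
  · exact fun u => ⟨Pminus_mem_sobolev ha u.2, (fundamentalSum_eq T (φ 0) (φ 1) u).symm⟩
  · refine ⟨‖(T : Transmutation.L1 a →L[ℂ] Transmutation.L1 a)‖
      * (‖parityCLM ha (crep (φ 0) 0) (crep (wderiv (φ 0)) 0) (crep (wderiv (φ 1)) 0)‖
        + ‖crep (φ 1) 0‖), fun u => ?_⟩
    have hu : (u : Transmutation.L1 a) ∈ sobolev a 1 := u.2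
    rw [transmutation_apply, mul_assoc]
    refine ((T : Transmutation.L1 a →L[ℂ] Transmutation.L1 a).le_opNorm _).trans ?_
    gcongr
    have e : paritySum (crep (φ 0) 0) (crep (wderiv (φ 0)) 0) (crep (φ 1) 0) (crep (wderiv (φ 1)) 0)
        (u : Transmutation.L1 a)
        = parityCLM ha (crep (φ 0) 0) (crep (wderiv (φ 0)) 0) (crep (wderiv (φ 1)) 0) u
          + crep (φ 1) 0 • Pplus a (wderiv (u : Transmutation.L1 a)) := by
      rw [paritySum_of_mem_sobolev ha hu, parityCLM_apply]
      abel
    rw [e]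
    refine (norm_add_le _ _).trans ?_
    have h1 := (parityCLM ha (crep (φ 0) 0) (crep (wderiv (φ 0)) 0)
      (crep (wderiv (φ 1)) 0)).le_opNorm (u : Transmutation.L1 a)
    have h2 : ‖crep (φ 1) 0 • Pplus a (wderiv (u : Transmutation.L1 a))‖
        ≤ ‖crep (φ 1) 0‖ * ‖wderiv (u : Transmutation.L1 a)‖ := by
      rw [norm_smul]
      exact mul_le_mul_of_nonneg_left (norm_Pplus_le _) (norm_nonneg _)
    have h3 : 0 ≤ ‖parityCLM ha (crep (φ 0) 0) (crep (wderiv (φ 0)) 0) (crep (wderiv (φ 1)) 0)‖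
        * ‖wderiv (u : Transmutation.L1 a)‖ := by positivity
    have h4 : 0 ≤ ‖crep (φ 1) 0‖ * ‖(u : Transmutation.L1 a)‖ := by positivity
    linarith
  · exact fun x hx => wronskian_eq ha (hφ.zero.isStrongSolution ha hq)
      (hφ.one.isStrongSolution ha hq) hx
  · intro hW u hu
    have hv := symm_mem_sobolev_two ha hq hT2 hu
    have hv1 := sobolev_antitone a one_le_two hv
    have hu1 := sobolev_antitone a one_le_two hu
    refine ⟨⟨Pminus_mem_sobolev ha hv1, parityInverse_mem_sobolev ha hv, ?_⟩, hu1, ?_, ?_⟩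
    · exact (congrArg T (paritySum_parityInverse ha hW hv1)).trans (T.apply_symm_apply u)
    · rw [transmutation_apply, T.symm_apply_apply]
      exact Pminus_paritySum_mem_sobolev ha hu1
    · rw [transmutation_apply, inverseSum_eq, T.symm_apply_apply]
      exact parityInverse_paritySum ha hW hu1
  · intro h1
    have hS (u : Transmutation.L1 a) :
        T (parityCLM ha (crep (φ 0) 0) (crep (wderiv (φ 0)) 0) (crep (wderiv (φ 1)) 0) u)
          = fundamentalSum T (φ 0) (φ 1) u := by
      rw [fundamentalSum_eq, h1, paritySum_zero_eq ha]
    refine ⟨(T : Transmutation.L1 a →L[ℂ] Transmutation.L1 a) ∘L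
      parityCLM ha (crep (φ 0) 0) (crep (wderiv (φ 0)) 0) (crep (wderiv (φ 1)) 0),
      fun u => (hS u).trans (fundamentalSum_eq T (φ 0) (φ 1) u), hS, fun h0 hW => ?_⟩
    have h0' : crep (wderiv (φ 1)) 0 ≠ 0 := by
      intro h
      rw [wronskian, h, h1, mul_zero, mul_zero, sub_zero] at hW
      exact hW rfl
    refine ⟨(parityEquiv ha (crep (wderiv (φ 0)) 0) h0 h0').trans T, rfl, fun v => ?_⟩
    rw [inverseSum_eq, h1, parityInverse_zero_eq ha h0 h0']
    rfl
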